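/- **Setting.** Let $\xi=(\xi_1,\dots,\xi_N):\Omega\to\Xi\subseteq\mathbb R^N$ ($\Xi$ Borel) be a random vector on a probability space with independent components having densities $w_i$. Write $w(y)=\prod_i w_i(y_i)$, let $\tilde{\mathbb P}$ be the law of $\xi$, and for measurable $\tilde\Xi\subseteq\Xi$ set $\|f\|_{L^2_w(\tilde\Xi;E)}^2=\int_{\tilde\Xi}\|f(y)\|_E^2\,w(y)\,dy$. Let $\Lambda=\mathbb R$ or $\Lambda=[0,1]_{\mathrm{per}}$ (periodic boundary conditions), let $T>0$, and let $\mathcal U\subseteq\mathbb R^m$ be open. Consider $$\partial_t u(t,x,y)+\partial_x F(u(t,x,y),y)=0,\qquad u(0,x,y)=u^0(x,y),\qquad (t,x,y)\in(0,T)\times\Lambda\times\Xi ,$$ where $F(\cdot,y)\in C^2(\mathcal U;\mathbb R^m)$ for almost every $y$, $F$ is measurable in $y$, and $u^0\in L^1_w(\Xi;L^1(\Lambda;\mathcal U))$. Let $(\eta,q)$ be a random entropy/entropy-flux pair: for almost every $y$, $\eta(\cdot,y),q(\cdot,y)\in C^2(\mathcal U;\mathbb R)$, $\eta(\cdot,y)$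 is strictly convex, and $D\eta(\cdot,y)\,DF(\cdot,y)=Dq(\cdot,y)$. A *random entropy admissible solution* is a function $u\in L^1_w(\Xi;L^1((0,T)\times\Lambda;\mathcal U))$ such that, for almost every $y$, $$\int_0^T\!\!\int_\Lambda \big(u\cdot\partial_t\phi+F(u,y)\cdot\partial_x\phi\big)\,dx\,dt=-\int_\Lambda u^0\cdot\phi(0,x)\,dx\quad\text{for all }\phi\in C_c^\infty([0,T)\times\Lambda;\mathbb R^m),$$ $$\int_0^T\!\!\int_\Lambda \big(\eta(u,y)\,\partial_t\Phi+q(u,y)\,\partial_x\Phi\big)\,dx\,dt\ge-\int_\Lambda \eta(u^0,y)\,\Phi(0,x)\,dx\quad\text{for all }\Phi\in C_c^\infty([0,T)\times\Lambda;[0,\infty)).$$ Values $u(t,\cdot,y)$ at fixed times $t\in[0,T]$ are those of the representative that is continuous in time in the sense of distributions. **Constants.** Let $\mathcal C\subset\mathcal U$ be compact and convex, and suppose that $u$ and $u^0$ take values in $\mathcal C$ almost everywhere. Let $C_F\ge 0$ and $0<\underline\eta\le\overline\eta$ be constants, independent of $y$, such that for almost every $y$, all $z\in\mathcal C$ and all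 $v\in\mathbb R^m$, $$|v^\top H_uF(z,y)v|\le C_F|v|^2,\qquad \underline\eta|v|^2\le v^\top H_u\eta(z,y)v\le\overline\eta|v|^2 ,$$ where $H_u$ denotes the Hessian in the state variable. **Discretization.** For each $i\le N$ let $y_{i,0},\dots,y_{i,r}$ be pairwise distinct nodes with one-dimensional Lagrange polynomials $l_{i,0},\dots,l_{i,r}$. For multi-indices $k\in\{0,\dots,r\}^N$ set $y_k=(y_{1,k_1},\dots,y_{N,k_N})$ and $l_k(y)=\prod_i l_{i,k_i}(y_i)$, and assume $y_k\in\Xi$ and $F(\cdot,y_k)\in C^2(\mathcal U;\mathbb R^m)$. Let $0=t_0<\dots<t_{N_t}=T$. For every $k$ let $u_h^n(\cdot,y_k):\Lambda\to\mathbb R^m$, $n=0,\dots,N_t$, be any measurable functions (the discrete solutions at the collocation points, e.g. from a Runge–Kutta discontinuous Galerkin scheme), and let $\hat u^{st}(\cdot,\cdot,y_k):[0,T]\times\Lambda\to\mathbb R^m$ be any Lipschitz continuous function (the space-time reconstruction). Put $$u_h^n(x,y)=\sum_k u_h^n(x,y_k)\,l_k(y),\qquad \hat u^{sts}(t,x,y)=\sum_k\hat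 u^{st}(t,x,y_k)\,l_k(y),$$ and assume that $\hat u^{sts}$ takes values in $\mathcal C$ on $[0,T]\times\Lambda\times\Xi$. Define the deterministic and the stochastic residual by $$\mathcal R^{det}(t,x,y)=\sum_k\Big(\partial_t\hat u^{st}(t,x,y_k)+\partial_xF\big(\hat u^{st}(t,x,y_k),y_k\big)\Big)l_k(y),$$ $$\mathcal R^{stoch}(t,x,y)=\partial_xF\big(\hat u^{sts}(t,x,y),y\big)-\sum_k\partial_xF\big(\hat u^{st}(t,x,y_k),y_k\big)\,l_k(y).$$ **Claim.** For all $n=0,\dots,N_t$ and all $\tilde{\mathbb P}$-measurable sets $\tilde\Xi\subseteq\Xi$, $$\begin{aligned} \|u(t_n,\cdot,\cdot)-u_h^n\|_{L^2_w(\tilde\Xi;L^2(\Lambda))}^2\le{}&2\,\|\hat u^{sts}(t_n,\cdot,\cdot)-u_h^n\|_{L^2_w(\tilde\Xi;L^2(\Lambda))}^2\\ &+2\,\underline\eta^{-1}\Big(2\,\mathcal E^{det}(t_n)+2\,\mathcal E^{stoch}(t_n)+\overline\eta\,\mathcal E_0\Big)\\ &\quad\times\exp\Big(\underline\eta^{-1}\int_0^{t_n}\big(\overline\eta\,C_F\,\|\partial_x\hat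 u^{sts}(t,\cdot,\cdot)\|_{L^\infty_w(\tilde\Xi;L^\infty(\Lambda))}+\overline\eta^{\,2}\big)\,dt\Big), \end{aligned}$$ where $$\mathcal E^{det}(t_n)=\|\mathcal R^{det}\|^2_{L^2_w(\tilde\Xi;L^2((0,t_n)\times\Lambda))},\qquad \mathcal E^{stoch}(t_n)=\|\mathcal R^{stoch}\|^2_{L^2_w(\tilde\Xi;L^2((0,t_n)\times\Lambda))},$$ $$\mathcal E_0=\|u^0-\hat u^{sts}(0,\cdot,\cdot)\|^2_{L^2_w(\tilde\Xi;L^2(\Lambda))} .$$ The inequality is between elements of $[0,\infty]$. -/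

import Mathlib

open MeasureTheory ProbabilityTheory Set
open scoped NNReal ENNReal ContDiff

noncomputable section

namespace RandomConservationLaw

/-- The state vectors, `ℝ^m` with the Euclidean norm. -/
abbrev State (m : ℕ) : Type := EuclideanSpace ℝ (Fin m)

/-- The parameter vectors `y = (y₁, …, y_N)`. -/
abbrev Param (N : ℕ) : Type := Fin N → ℝ

/-! ### The random parameter -/

/-- The joint density `w(y) = ∏ᵢ wᵢ(yᵢ)`. -/
def jointDensity {N : ℕ} (w : Fin N → ℝ → ℝ≥0) (y : Param N) : ℝ≥0 := ∏ i, w i (y i)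

/-- The weighted measure `w(y) dy`, with respect to which the spaces `L^p_w` are formed. -/
def weightedMeasure {N : ℕ} (w : Fin N → ℝ → ℝ≥0) : Measure (Param N) :=
  volume.withDensity fun y => (jointDensity w y : ℝ≥0∞)

/-- `ξ : Ω → Ξ ⊆ ℝ^N` is a random vector with independent, absolutely continuous components;
`w i` is the density of the `i`-th component. -/
structure IsRandomParameter {Ω : Type*} [MeasurableSpace Ω] (P : Measure Ω) {N : ℕ}
    (ξ : Ω → Param N) (Ξ : Set (Param N)) (w : Fin N → ℝ → ℝ≥0) : Prop where
  measurable : Measurable ξ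
  measurableSet : MeasurableSet Ξ
  mem : ∀ a, ξ a ∈ Ξ
  indep : iIndepFun (fun i a => ξ a i) P
  measurable_density : ∀ i, Measurable (w i)
  density : ∀ i, P.map (fun a => ξ a i) = volume.withDensity fun s => (w i s : ℝ≥0∞)

/-! ### The spatial domain -/

/-- The spatial domain is the real line or the unit interval with periodic boundary conditions. -/
inductive SpatialDomain : Type
  | line
  | periodic

/-- The set over which one integrates: `ℝ`, respectively one period. -/
def SpatialDomain.cell : SpatialDomain → Set ℝ
  | .line => univ
  | .periodic => Icc 0 1

/-- A function on `ℝ` that is a continuous (or smooth) lift of a function on the domain has to be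
`1`-periodic in the periodic case. -/
def SpatialDomain.Compatible {α : Type*} : SpatialDomain → (ℝ → α) → Prop
  | .line, _ => True
  | .periodic, f => Function.Periodic f 1

/-- `φ ∈ C_c^∞([0,T) × Λ; V)`, where `φ(t,x)` is written `φ (t, x)`: restrictions to `t ≥ 0` of
smooth functions on `ℝ × Λ` whose support is a compact subset of `(-∞,T) × Λ`. -/
def IsSpaceTimeTest {V : Type*} [NormedAddCommGroup V] [NormedSpace ℝ V]
    (Λ : SpatialDomain) (T : ℝ) (φ : ℝ × ℝ → V) : Prop :=
  ContDiff ℝ ∞ φ ∧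
    match Λ with
    | .line => HasCompactSupport φ ∧ tsupport φ ⊆ {p | p.1 < T}
    | .periodic => (∀ t, Function.Periodic (fun x => φ (t, x)) 1) ∧
        ∃ a b : ℝ, b < T ∧ ∀ t x, t ∉ Icc a b → φ (t, x) = 0

/-- `ψ ∈ C_c^∞(Λ; V)`. -/
def IsSpaceTest {V : Type*} [NormedAddCommGroup V] [NormedSpace ℝ V]
    (Λ : SpatialDomain) (ψ : ℝ → V) : Prop :=
  ContDiff ℝ ∞ ψ ∧
    match Λ with
    | .line => HasCompactSupport ψ
    | .periodic => Function.Periodic ψ 1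

/-! ### Fluxes, entropies and entropy admissible solutions -/

variable {m N : ℕ}

/-- A random function of class `C²` on `U`: measurable in `y`, and of class `C²` in the state for
almost every `y`. -/
structure IsRandomC2 {V : Type*} [NormedAddCommGroup V] [NormedSpace ℝ V]
    (μ : Measure (Param N)) (U : Set (State m)) (f : State m → Param N → V) : Prop where
  measurable : ∀ z ∈ U, AEStronglyMeasurable (fun y => f z y) μ
  contDiffOn : ∀ᵐ y ∂μ, ContDiffOn ℝ 2 (fun z => f z y) U

/-- `(η, q)` is a random entropy/entropy-flux pair for the flux `F` on `U`. As the open set `U`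
need not be convex, strict convexity is required on each convex subset of `U`. -/
structure IsRandomEntropyPair (μ : Measure (Param N)) (U : Set (State m))
    (F : State m → Param N → State m) (η q : State m → Param N → ℝ) : Prop where
  entropy : IsRandomC2 μ U η
  entropyFlux : IsRandomC2 μ U q
  strictConvex : ∀ᵐ y ∂μ, ∀ K ⊆ U, Convex ℝ K → StrictConvexOn ℝ K (fun z => η z y)
  compatible : ∀ᵐ y ∂μ, ∀ z ∈ U,
    (fderiv ℝ (fun a => η a y) z).comp (fderiv ℝ (fun a => F a y) z)
      = fderiv ℝ (fun a => q a y) z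

/-- Weak solutions of `∂ₜ u + ∂ₓ f(u) = 0` on `(0,T) × Λ` with initial datum `u₀`. -/
def IsWeakSolution (Λ : SpatialDomain) (T : ℝ) (f : State m → State m)
    (u₀ : ℝ → State m) (u : ℝ → ℝ → State m) : Prop :=
  ∀ φ : ℝ × ℝ → State m, IsSpaceTimeTest Λ T φ →
    ∫ t in Ioo 0 T, ∫ x in Λ.cell,
        (inner ℝ (u t x) (deriv (fun s => φ (s, x)) t)
          + inner ℝ (f (u t x)) (deriv (fun z => φ (t, z)) x))
      = - ∫ x in Λ.cell, inner ℝ (u₀ x) (φ (0, x))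

/-- The weak form of the entropy inequality `∂ₜ η(u) + ∂ₓ q(u) ≤ 0`. -/
def SatisfiesEntropyInequality (Λ : SpatialDomain) (T : ℝ) (η q : State m → ℝ)
    (u₀ : ℝ → State m) (u : ℝ → ℝ → State m) : Prop :=
  ∀ φ : ℝ × ℝ → ℝ, IsSpaceTimeTest Λ T φ → (∀ t x, 0 ≤ t → 0 ≤ φ (t, x)) →
    - ∫ x in Λ.cell, η (u₀ x) * φ (0, x)
      ≤ ∫ t in Ioo 0 T, ∫ x in Λ.cell,
        (η (u t x) * deriv (fun s => φ (s, x)) t + q (u t x) * deriv (fun z => φ (t, z)) x)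

/-- The measure `dt ⊗ dx ⊗ μ` on `(0,T) × Λ × Ξ`. -/
def spaceTimeParamMeasure (Λ : SpatialDomain) (T : ℝ) (μ : Measure (Param N)) :
    Measure ((ℝ × ℝ) × Param N) :=
  ((volume.restrict (Ioo 0 T)).prod (volume.restrict Λ.cell)).prod μ

/-- Random entropy admissible solutions `u ∈ L¹(Ξ; L¹((0,T) × Λ; U))`, `u = u t x y`, of the random
conservation law with flux `F`, entropy pair `(η, q)` and initial datum `u₀ = u₀ x y`. -/
structure IsRandomEntropySolution (Λ : SpatialDomain) (T : ℝ) (μ : Measure (Param N))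
    (U : Set (State m)) (F : State m → Param N → State m) (η q : State m → Param N → ℝ)
    (u₀ : ℝ → Param N → State m) (u : ℝ → ℝ → Param N → State m) : Prop where
  integrable : Integrable (fun p : (ℝ × ℝ) × Param N => u p.1.1 p.1.2 p.2)
    (spaceTimeParamMeasure Λ T μ)
  mem : ∀ᵐ p ∂(spaceTimeParamMeasure Λ T μ), u p.1.1 p.1.2 p.2 ∈ U
  weak : ∀ᵐ y ∂μ,
    IsWeakSolution Λ T (fun z => F z y) (fun x => u₀ x y) (fun t x => u t x y)
  entropy : ∀ᵐ y ∂μ,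
    SatisfiesEntropyInequality Λ T (fun z => η z y) (fun z => q z y)
      (fun x => u₀ x y) (fun t x => u t x y)

/-- For almost every `y`, the values `u(t,·,y)`, `t ∈ [0,T]`, are those of the representative that
is continuous in time in the sense of distributions. This gives `u(tₙ,·,y)` its meaning. -/
def IsWeaklyContinuousInTime (Λ : SpatialDomain) (T : ℝ) (μ : Measure (Param N))
    (u : ℝ → ℝ → Param N → State m) : Prop :=
  ∀ᵐ y ∂μ, (∀ t ∈ Icc 0 T, LocallyIntegrableOn (fun x => u t x y) Λ.cell) ∧
    ∀ ψ : ℝ → State m, IsSpaceTest Λ ψ →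
      ContinuousOn (fun t => ∫ x in Λ.cell, inner ℝ (u t x y) (ψ x)) (Icc 0 T)

/-- Bounds on the second derivatives of the flux and of the entropy on `C`, with constants that
are uniform in `y`. -/
structure HasUniformHessianBounds (μ : Measure (Param N)) (C : Set (State m))
    (F : State m → Param N → State m) (η : State m → Param N → ℝ)
    (CF ηlow ηup : ℝ) : Prop where
  flux_nonneg : 0 ≤ CF
  low_pos : 0 < ηlow
  low_le_up : ηlow ≤ ηup
  flux : ∀ᵐ y ∂μ, ∀ z ∈ C, ∀ v : State m,
    ‖fderiv ℝ (fderiv ℝ (fun a => F a y)) z v v‖ ≤ CF * ‖v‖ ^ 2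
  entropy : ∀ᵐ y ∂μ, ∀ z ∈ C, ∀ v : State m,
    ηlow * ‖v‖ ^ 2 ≤ fderiv ℝ (fderiv ℝ (fun a => η a y)) z v v ∧
      fderiv ℝ (fderiv ℝ (fun a => η a y)) z v v ≤ ηup * ‖v‖ ^ 2

/-! ### Stochastic collocation -/

variable {r : ℕ}

/-- The multi-indices `k = (k₁, …, k_N)` with `0 ≤ kᵢ ≤ r`. -/
abbrev MultiIndex (N r : ℕ) : Type := Fin N → Fin (r + 1)

/-- The collocation point `y_k = (y_{1,k₁}, …, y_{N,k_N})`. -/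
def collocationPoint (node : Fin N → Fin (r + 1) → ℝ) (k : MultiIndex N r) : Param N :=
  fun i => node i (k i)

/-- The tensor product Lagrange polynomial `l_k(y) = ∏ᵢ l_{i,kᵢ}(yᵢ)`. -/
def lagrangePoly (node : Fin N → Fin (r + 1) → ℝ) (k : MultiIndex N r) (y : Param N) : ℝ :=
  ∏ i, (Lagrange.basis Finset.univ (node i) (k i)).eval (y i)

/-- The collocation interpolant `∑ₖ v_k(x) l_k(y)`. -/
def interpolant (node : Fin N → Fin (r + 1) → ℝ) (v : MultiIndex N r → ℝ → State m)
    (x : ℝ) (y : Param N) : State m :=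
  ∑ k, lagrangePoly node k y • v k x

/-- The space-time-stochastic reconstruction `∑ₖ û(t,x,y_k) l_k(y)` formed from the space-time
reconstructions `st k = û(·,·,y_k)`. -/
def stsReconstruction (node : Fin N → Fin (r + 1) → ℝ) (st : MultiIndex N r → ℝ → ℝ → State m)
    (t x : ℝ) (y : Param N) : State m :=
  interpolant node (fun k => st k t) x y

/-- A space-time reconstruction is a Lipschitz function of `(t,x) ∈ [0,T] × Λ`. -/
def IsLipschitzReconstruction (Λ : SpatialDomain) (T : ℝ) (v : ℝ → ℝ → State m) : Prop :=
  (∃ L : ℝ≥0, LipschitzOnWith L (fun p : ℝ × ℝ => v p.1 p.2) (Icc 0 T ×ˢ univ)) ∧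
    ∀ t, Λ.Compatible (v t)

/-- The space-time residual `∂ₜ v + ∂ₓ f(v)`, which is defined for almost every `(t,x)` when `v` is
Lipschitz. -/
def spaceTimeResidual (f : State m → State m) (v : ℝ → ℝ → State m) (t x : ℝ) : State m :=
  deriv (fun s => v s x) t + deriv (fun z => f (v t z)) x

/-- The deterministic residual: the interpolant of the space-time residuals at the collocation
points. -/
def detResidual (F : State m → Param N → State m) (node : Fin N → Fin (r + 1) → ℝ)
    (st : MultiIndex N r → ℝ → ℝ → State m) (t x : ℝ) (y : Param N) : State m :=
  ∑ k, lagrangePoly node k y •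
    spaceTimeResidual (fun z => F z (collocationPoint node k)) (st k) t x

/-- The stochastic residual `∂ₓ F(∑ₖ û(y_k) l_k(y), y) - ∑ₖ ∂ₓ F(û(y_k), y_k) l_k(y)`. -/
def stochResidual (F : State m → Param N → State m) (node : Fin N → Fin (r + 1) → ℝ)
    (st : MultiIndex N r → ℝ → ℝ → State m) (t x : ℝ) (y : Param N) : State m :=
  deriv (fun z => F (stsReconstruction node st t z y) y) x -
    ∑ k, lagrangePoly node k y • deriv (fun z => F (st k t z) (collocationPoint node k)) x

/-! ### Norms -/

/-- `‖f‖²` in `L²_μ(S; L²(Λ))`, for `f = f x y`. -/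
def sqNormSpace (μ : Measure (Param N)) (S : Set (Param N)) (Λ : SpatialDomain)
    (f : ℝ → Param N → State m) : ℝ≥0∞ :=
  ∫⁻ y in S, ∫⁻ x in Λ.cell, ‖f x y‖ₑ ^ 2 ∂volume ∂μ

/-- `‖f‖²` in `L²_μ(S; L²((0,τ) × Λ))`, for `f = f t x y`. -/
def sqNormSpaceTime (μ : Measure (Param N)) (S : Set (Param N)) (Λ : SpatialDomain) (τ : ℝ)
    (f : ℝ → ℝ → Param N → State m) : ℝ≥0∞ :=
  ∫⁻ y in S, ∫⁻ t in Ioo 0 τ, ∫⁻ x in Λ.cell, ‖f t x y‖ₑ ^ 2 ∂volume ∂volume ∂μ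

/-- `‖f‖` in `L^∞_μ(S; L^∞(Λ))`, for `f = f x y`. -/
def supNormSpace (μ : Measure (Param N)) (S : Set (Param N)) (Λ : SpatialDomain)
    (f : ℝ → Param N → State m) : ℝ≥0∞ :=
  essSup (fun y => essSup (fun x => ‖f x y‖ₑ) (volume.restrict Λ.cell)) (μ.restrict S)

/-- The exponent `ηlow⁻¹ ∫₀^τ (ηup CF ‖∂ₓ v(t,·,·)‖_{L^∞(S; L^∞(Λ))} + ηup²) dt`. -/
def growthExponent (μ : Measure (Param N)) (S : Set (Param N)) (Λ : SpatialDomain)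
    (CF ηlow ηup τ : ℝ) (v : ℝ → ℝ → Param N → State m) : ℝ≥0∞ :=
  (ENNReal.ofReal ηlow)⁻¹ * ∫⁻ t in Ioo 0 τ,
    (ENNReal.ofReal (ηup * CF)
        * supNormSpace μ S Λ (fun x y => deriv (fun z => v t z y) x)
      + ENNReal.ofReal (ηup ^ 2))

end RandomConservationLaw

end

/-!
The proof is the relative entropy method, applied for almost every parameter `y` separately and
integrated over `y` afterwards.

**A fixed parameter.** Let `f = F(·, y)`, let `u` be the entropy admissible solution and `v` the
space-time-stochastic reconstruction, a Lipschitz field with values in `C`. The relative entropy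
`η(u) - η(v) - Dη(v)(u - v)` lies between `ηlow / 2 · |u - v|²` and `ηup / 2 · |u - v|²`. Its
evolution follows from the entropy inequality with a test function `κ ≥ 0` and the weak formulation
with the test function `κ ∇η(v)`. The latter is only Lipschitz continuous, so the weak formulation
is extended to such test functions by mollification. In the resulting
`IsEntropySolutionIn.relativeEntropy_inequality`, the symmetry of `D²η Df`, which follows from the
compatibility of `η` and `q`, leaves two error terms: the residual `∂ₜv + ∂ₓf(v)` paired with
`D²η(v)(u - v)`, and `∂ₓv` paired with the quadratic remainder of the flux. Young's inequality and
the Hessian bounds turn them into the squared residual and the rate `ηup · CF · |∂ₓv| + ηup²`.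

On the line a constant is not an admissible weight. The weight `coneWeight` approximates the
indicator function of a cone whose boundary moves so fast that the relative entropy flux, which is
at most a multiple of the relative entropy, leaves through it (`relativeEntropyDensity_le`). Cutting
off in time gives a Gronwall inequality for almost every time (`ae_le_of_average_le`,
`gronwall_of_ae`), and letting the cone exhaust the line gives `IsEntropySolutionIn.ae_stability`.

The weak continuity in time extends the bound to every time: the `L²` norm is the supremum over test
functions of a concave expression (`lintegral_enorm_sq_le`), hence lower semicontinuous
(`lintegral_sub_field_le_of_ae`). At time `0` the weakly continuous representative agrees with the
initial datum (`IsEntropySolutionIn.ae_initial_eq`). The result is `IsEntropySolutionIn.stability`.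

**The residual.** The residual of the reconstruction is the sum of the deterministic and the
stochastic residual, because the flux terms at the collocation points cancel
(`fieldResidual_eq_add`). The factors `2` come from the squares of this sum and of
`u - uₕ = (u - v) + (v - uₕ)`.

**Integration over the parameter.** The law of `ξ` is `w(y) dy` by independence
(`IsRandomParameter.map_eq_weightedMeasure`). The exponent for a fixed `y` contains the spatial
Lipschitz constants of `v(t, ·, y)`, and they have to be bounded by the essential suprema over the
parameter for all times at once, outside one null set of parameters. This holds because such a bound
defines a closed set of parameters, so that it is valid on the whole support of the measure
(`ae_spatialLipschitzConstant_le`). The essential suprema may be infinite, on an unbounded set of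
parameters, while the other factor vanishes; `lintegral_le_lintegral_mul` covers this case, since
the growth factor is finite for each `y`.
-/

namespace RandomConservationLaw

open Filter Topology

set_option linter.unusedSectionVars false

/-! ### Mollification -/

section Mollify

open scoped Convolution

variable {E V : Type*} [NormedAddCommGroup E] [NormedSpace ℝ E] [FiniteDimensional ℝ E]
  [MeasureSpace E] [BorelSpace E] [(volume : Measure E).IsAddHaarMeasure]
  [NormedAddCommGroup V] [NormedSpace ℝ V]

/-- A smooth bump supported in the ball of radius `1 / (n + 1)` around the origin. -/
noncomputable def mollifier (E : Type*) [NormedAddCommGroup E] [NormedSpace ℝ E] (n : ℕ) :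
    ContDiffBump (0 : E) where
  rIn := 1 / (2 * ((n : ℝ) + 1))
  rOut := 1 / ((n : ℝ) + 1)
  rIn_pos := by positivity
  rIn_lt_rOut := by
    have : (0 : ℝ) < n + 1 := by positivity
    exact one_div_lt_one_div_of_lt this (by linarith)

/-- The `n`-th mollification of `g`. -/
noncomputable def mollify (n : ℕ) (g : E → V) : E → V :=
  (mollifier E n).normed volume ⋆[ContinuousLinearMap.lsmul ℝ ℝ, volume] g

lemma mollify_apply (n : ℕ) (g : E → V) (p : E) :
    mollify n g p = ∫ q, (mollifier E n).normed volume q • g (p - q) := rfl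

lemma contDiff_mollify (n : ℕ) {g : E → V} (hg : LocallyIntegrable g) :
    ContDiff ℝ ∞ (mollify n g) :=
  (mollifier E n).hasCompactSupport_normed.contDiff_convolution_left _
    (mollifier E n).contDiff_normed hg

lemma norm_mollify_le (n : ℕ) {g : E → V} {M : ℝ} (hg : ∀ p, ‖g p‖ ≤ M) (p : E) :
    ‖mollify n g p‖ ≤ M := by
  have h1 : ‖mollify n g p‖ ≤ ∫ q, (mollifier E n).normed volume q * M := by
    refine norm_integral_le_of_norm_le
      ((mollifier E n).integrable_normed.mul_const M) (Eventually.of_forall fun q => ?_)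
    simp only [ContinuousLinearMap.lsmul_apply, norm_smul, Real.norm_eq_abs,
      abs_of_nonneg ((mollifier E n).nonneg_normed q)]
    exact mul_le_mul_of_nonneg_left (hg _) ((mollifier E n).nonneg_normed q)
  rwa [integral_mul_const, (mollifier E n).integral_normed, one_mul] at h1

lemma mollify_nonneg (n : ℕ) {g : E → ℝ} (hg : ∀ p, 0 ≤ g p) (p : E) : 0 ≤ mollify n g p :=
  integral_nonneg fun q => mul_nonneg ((mollifier E n).nonneg_normed q) (hg _)

lemma mollify_eq_zero (n : ℕ) {g : E → V} {p : E}
    (hg : ∀ q, dist q p < 1 / ((n : ℝ) + 1) → g q = 0) : mollify n g p = 0 := by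
  rw [mollify_apply]
  refine integral_eq_zero_of_ae (Eventually.of_forall fun q => ?_)
  by_cases hq : dist q 0 < 1 / ((n : ℝ) + 1)
  · simp only [Pi.zero_apply]
    rw [hg, smul_zero]
    simpa [dist_eq_norm] using hq
  · have : q ∉ Function.support ((mollifier E n).normed volume) := by
      rw [(mollifier E n).support_normed_eq]
      exact hq
    simp only [Function.mem_support, not_not] at this
    simp [this]

lemma mollify_add_period (n : ℕ) {g : E → V} {c : E} (hg : ∀ p, g (p + c) = g p) (p : E) :
    mollify n g (p + c) = mollify n g p := by
  simp only [mollify_apply, add_sub_right_comm, hg]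

lemma tendsto_mollifier_rOut : Tendsto (fun n => (mollifier E n).rOut) atTop (𝓝 0) :=
  tendsto_one_div_add_atTop_nhds_zero_nat

lemma tendsto_mollify [CompleteSpace V] {g : E → V} (hg : Continuous g) (p : E) :
    Tendsto (fun n => mollify n g p) atTop (𝓝 (g p)) :=
  ContDiffBump.convolution_tendsto_right_of_continuous tendsto_mollifier_rOut hg p

lemma ae_tendsto_mollify [CompleteSpace V] {g : E → V} (hg : LocallyIntegrable g) :
    ∀ᵐ p, Tendsto (fun n => mollify n g p) atTop (𝓝 (g p)) := by
  refine ContDiffBump.ae_convolution_tendsto_right_of_locallyIntegrable (K := 2)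
    tendsto_mollifier_rOut (Eventually.of_forall fun n => ?_) hg
  simp only [mollifier]
  have : (0 : ℝ) < n + 1 := by positivity
  field_simp
  rfl

variable [FiniteDimensional ℝ V]

/-- By Rademacher's theorem, differentiation commutes with the mollification of a Lipschitz
function. -/
lemma fderiv_mollify (n : ℕ) {g : E → V} {L : ℝ≥0} (hg : LipschitzWith L g) (p e : E) :
    fderiv ℝ (mollify n g) p e = mollify n (fun q => fderiv ℝ g q e) p := by
  let _ : MeasurableSpace V := borel V
  have _ : BorelSpace V := ⟨rfl⟩
  have hsmooth : DifferentiableAt ℝ (mollify n g) p :=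
    (contDiff_mollify n hg.continuous.locallyIntegrable).differentiable (by simp) p
  have h1 : HasDerivAt (fun s : ℝ => mollify n g (p + s • e))
      (fderiv ℝ (mollify n g) p e) 0 := hsmooth.hasFDerivAt.hasLineDerivAt e
  have hρ := (mollifier E n).continuous_normed (μ := volume)
  have hint : ∀ {G : E → ℝ}, Continuous G →
      Integrable (fun q => (mollifier E n).normed volume q * G q) := fun hG =>
    (hρ.mul hG).integrable_of_hasCompactSupport
      ((mollifier E n).hasCompactSupport_normed.mul_right)
  have hmeas : Measurable fun q : E => fderiv ℝ g q e := measurable_fderiv_apply_const ℝ g e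
  have h2 := (hasDerivAt_integral_of_dominated_loc_of_lip (𝕜 := ℝ) (μ := (volume : Measure E))
    (s := univ) (x₀ := (0 : ℝ))
    (F := fun s q => (mollifier E n).normed volume q • g (p + s • e - q))
    (F' := fun q => (mollifier E n).normed volume q • fderiv ℝ g (p - q) e)
    (bound := fun q => (mollifier E n).normed volume q * (L * ‖e‖)) univ_mem
    (Eventually.of_forall fun s => (hρ.smul
      (hg.continuous.comp (continuous_const.sub continuous_id))).aestronglyMeasurable)
    ((hρ.smul (hg.continuous.comp
      (continuous_const.sub continuous_id))).integrable_of_hasCompactSupport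
      ((mollifier E n).hasCompactSupport_normed.smul_right))
    ((hρ.measurable.smul (hmeas.comp (measurable_const.sub measurable_id))).aestronglyMeasurable)
    (Eventually.of_forall fun q => ?_) (hint continuous_const) ?_).2
  · exact h1.unique h2
  · refine LipschitzOnWith.of_dist_le_mul fun s _ s' _ => ?_
    have h0 := (mollifier E n).nonneg_normed (μ := volume) q
    rw [dist_smul₀, Real.norm_eq_abs, abs_of_nonneg h0, Real.coe_nnabs,
      abs_of_nonneg (by positivity), mul_assoc]
    refine mul_le_mul_of_nonneg_left ((hg.dist_le_mul _ _).trans (le_of_eq ?_)) h0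
    rw [dist_eq_norm, dist_eq_norm, mul_assoc, show p + s • e - q - (p + s' • e - q) = (s - s') • e
      by rw [sub_smul]; abel, norm_smul, mul_comm ‖e‖]
  · have hd : ∀ᵐ q : E, DifferentiableAt ℝ g (p - q) :=
      (Measure.measurePreserving_sub_left volume p).quasiMeasurePreserving.ae hg.ae_differentiableAt
    filter_upwards [hd] with q hq
    have h3 : HasDerivAt (fun s : ℝ => g (p - q + s • e)) (fderiv ℝ g (p - q) e) 0 :=
      hq.hasFDerivAt.hasLineDerivAt e
    simp only [sub_add_eq_add_sub] at h3
    exact h3.const_smul _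

end Mollify

/-! ### Lipschitz test functions -/

section LipschitzTest

variable {V : Type*} [NormedAddCommGroup V]

/-- The measure `dt ⊗ dx` on `(0,T) × Λ`. -/
noncomputable def spaceTimeMeasure (Λ : SpatialDomain) (T : ℝ) : Measure (ℝ × ℝ) :=
  (volume.restrict (Ioo 0 T)).prod (volume.restrict Λ.cell)

lemma SpatialDomain.measurableSet_cell (Λ : SpatialDomain) : MeasurableSet Λ.cell := by
  cases Λ
  · exact MeasurableSet.univ
  · exact measurableSet_Icc

lemma spaceTimeMeasure_eq_restrict (Λ : SpatialDomain) (T : ℝ) :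
    spaceTimeMeasure Λ T = volume.restrict (Ioo 0 T ×ˢ Λ.cell) :=
  Measure.prod_restrict _ _

lemma ae_spaceTimeMeasure_mem (Λ : SpatialDomain) (T : ℝ) :
    ∀ᵐ p ∂(spaceTimeMeasure Λ T), p.1 ∈ Ioo 0 T ∧ p.2 ∈ Λ.cell := by
  rw [spaceTimeMeasure_eq_restrict]
  exact ae_restrict_mem (measurableSet_Ioo.prod Λ.measurableSet_cell)

lemma ae_spaceTimeMeasure_of_ae {Λ : SpatialDomain} {T : ℝ} {P : ℝ × ℝ → Prop}
    (h : ∀ᵐ p, P p) : ∀ᵐ p ∂(spaceTimeMeasure Λ T), P p := by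
  rw [spaceTimeMeasure_eq_restrict]
  exact ae_restrict_of_ae h

/-- Lipschitz functions on `ℝ × Λ` with compact support in `(-∞,T) × Λ`. They are limits of
smooth test functions and can be used in the weak formulation as well. -/
structure IsLipschitzTest (Λ : SpatialDomain) (T : ℝ) (W : ℝ × ℝ → V) : Prop where
  lipschitz : ∃ L : ℝ≥0, LipschitzWith L W
  time : ∃ a b : ℝ, b < T ∧ ∀ t x, t ∉ Icc a b → W (t, x) = 0
  space : match Λ with
    | .line => ∃ A : ℝ, ∀ t x, A < |x| → W (t, x) = 0
    | .periodic => ∀ t, Function.Periodic (fun x => W (t, x)) 1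

namespace IsLipschitzTest

variable {Λ : SpatialDomain} {T : ℝ} {W : ℝ × ℝ → V}

lemma exists_norm_le (hW : IsLipschitzTest Λ T W) : ∃ M : ℝ, ∀ p, ‖W p‖ ≤ M := by
  obtain ⟨L, hL⟩ := hW.lipschitz
  obtain ⟨a, b, -, hab⟩ := hW.time
  refine ⟨L * |b + 1 - a|, fun p => ?_⟩
  obtain ⟨t, x⟩ := p
  by_cases ht : t ∈ Icc a b
  · have h0 : W (b + 1, x) = 0 := hab _ _ fun h => by linarith [h.2]
    have h1 := hL.dist_le_mul (t, x) (b + 1, x)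
    rw [h0, dist_zero_right] at h1
    refine h1.trans (mul_le_mul_of_nonneg_left ?_ L.2)
    rw [Prod.dist_eq, dist_self, max_eq_left dist_nonneg, Real.dist_eq, abs_sub_comm,
      abs_of_nonneg (by linarith [ht.2]), abs_of_nonneg (by linarith [ht.1, ht.2])]
    linarith [ht.1]
  · rw [hab t x ht, norm_zero]
    positivity

/-- On the cell, a test function vanishes outside of a bounded interval. -/
lemma exists_space_bound (hW : IsLipschitzTest Λ T W) :
    ∃ A : ℝ, ∀ q : ℝ × ℝ, ∀ x ∈ Λ.cell, |q.2 - x| ≤ 1 → A < |x| → W q = 0 := by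
  cases Λ with
  | line =>
    obtain ⟨A, hA⟩ := hW.space
    refine ⟨A + 1, fun q x _ hqx hx => hA q.1 q.2 ?_⟩
    have := abs_sub_abs_le_abs_sub x q.2
    rw [abs_sub_comm] at this
    linarith
  | periodic =>
    refine ⟨1, fun q x hx _ hx1 => absurd hx1 (not_lt.2 ?_)⟩
    exact abs_le.2 ⟨by linarith [hx.1], hx.2⟩

variable [NormedSpace ℝ V] [FiniteDimensional ℝ V]

lemma norm_fderiv_apply_le {L : ℝ≥0} (hL : LipschitzWith L W) (q e : ℝ × ℝ) (he : ‖e‖ ≤ 1) :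
    ‖fderiv ℝ W q e‖ ≤ L :=
  ((fderiv ℝ W q).le_opNorm e).trans <| by
    calc _ ≤ (L : ℝ) * 1 := mul_le_mul (norm_fderiv_le_of_lipschitz ℝ hL) he (norm_nonneg _) L.2
      _ = L := mul_one _

/-- On the cell, the mollifications vanish outside of a bounded interval that does not depend
on the mollification parameter, and so do their derivatives. -/
lemma exists_mollify_bound (hW : IsLipschitzTest Λ T W) :
    ∃ A : ℝ, ∀ p : ℝ × ℝ, p.2 ∈ Λ.cell → A < |p.2| → ∀ n : ℕ,
      mollify n W p = 0 ∧ ∀ e, mollify n (fun q => fderiv ℝ W q e) p = 0 := by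
  obtain ⟨A, hA⟩ := hW.exists_space_bound
  have hball : ∀ (n : ℕ) (q p : ℝ × ℝ), dist q p < 1 / ((n : ℝ) + 1) → |q.2 - p.2| < 1 := by
    intro n q p hq
    have h1 : 1 / ((n : ℝ) + 1) ≤ 1 := by
      rw [div_le_one (by positivity)]; linarith [n.cast_nonneg (α := ℝ)]
    rw [Prod.dist_eq] at hq
    exact ((le_max_right _ _).trans_lt hq).trans_le h1
  refine ⟨A, fun p hp hpA n => ⟨mollify_eq_zero n fun q hq =>
    hA q p.2 hp (hball n q p hq).le hpA, fun e => mollify_eq_zero n fun q hq => ?_⟩⟩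
  have hev : W =ᶠ[𝓝 q] fun _ => 0 := by
    have : ∀ᶠ q' in 𝓝 q, |q'.2 - p.2| < 1 :=
      (((continuous_snd.sub continuous_const).abs).tendsto q).eventually_lt_const
        (hball n q p hq)
    exact this.mono fun q' hq' => hA q' p.2 hp hq'.le hpA
  simp [hev.fderiv_eq]

/-- Mollifications of Lipschitz test functions are eventually smooth test functions. -/
lemma eventually_isSpaceTimeTest_mollify (hW : IsLipschitzTest Λ T W) :
    ∀ᶠ n : ℕ in atTop, IsSpaceTimeTest Λ T (mollify n W) := by
  obtain ⟨L, hL⟩ := hW.lipschitz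
  obtain ⟨a, b, hb, hab⟩ := hW.time
  have hlim : ∀ᶠ n : ℕ in atTop, 1 / ((n : ℝ) + 1) < (T - b) / 2 :=
    tendsto_one_div_add_atTop_nhds_zero_nat.eventually_lt_const (by linarith)
  filter_upwards [hlim] with n hn
  have htime : ∀ t x, t ∉ Icc (a - 1) ((T + b) / 2) → mollify n W (t, x) = 0 := by
    intro t x ht
    refine mollify_eq_zero n fun q hq => hab q.1 q.2 fun hq1 => ht ?_
    have h1 : 1 / ((n : ℝ) + 1) ≤ 1 := by
      rw [div_le_one (by positivity)]; linarith [n.cast_nonneg (α := ℝ)]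
    rw [Prod.dist_eq] at hq
    have h2 := (le_max_left _ _).trans_lt hq
    rw [Real.dist_eq, abs_lt] at h2
    simp only at h2
    exact ⟨by linarith [hq1.1], by linarith [hq1.2]⟩
  refine ⟨contDiff_mollify n hL.continuous.locallyIntegrable, ?_⟩
  cases Λ with
  | line =>
    obtain ⟨A, hA⟩ := hW.exists_mollify_bound
    have hsub : Function.support (mollify n W) ⊆ Icc (a - 1) ((T + b) / 2) ×ˢ Icc (-A) A := by
      rintro ⟨t, x⟩ hp
      refine ⟨by_contra fun h => hp (htime t x h), abs_le.1 (not_lt.1 fun h => hp ?_)⟩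
      exact (hA (t, x) (mem_univ _) h n).1
    have hts : tsupport (mollify n W) ⊆ Icc (a - 1) ((T + b) / 2) ×ˢ Icc (-A) A :=
      closure_minimal hsub (isClosed_Icc.prod isClosed_Icc)
    refine ⟨(isCompact_Icc.prod isCompact_Icc).of_isClosed_subset (isClosed_tsupport _) hts,
      fun p hp => ?_⟩
    have := (hts hp).1.2
    simp only [mem_ofPred_eq]
    linarith
  | periodic =>
    refine ⟨fun t x => ?_, a - 1, (T + b) / 2, by linarith, htime⟩
    have := mollify_add_period n (g := W) (c := (0, 1)) (fun p => by
      have := hW.space p.1 p.2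
      obtain ⟨t, x⟩ := p
      simpa using this) (t, x)
    simpa using this

end IsLipschitzTest

lemma deriv_left_eq_fderiv [NormedSpace ℝ V] {φ : ℝ × ℝ → V} {t x : ℝ}
    (h : DifferentiableAt ℝ φ (t, x)) :
    HasDerivAt (fun s => φ (s, x)) (fderiv ℝ φ (t, x) (1, 0)) t :=
  h.hasFDerivAt.comp_hasDerivAt t ((hasDerivAt_id t).prodMk (hasDerivAt_const t x))

lemma deriv_right_eq_fderiv [NormedSpace ℝ V] {φ : ℝ × ℝ → V} {t x : ℝ}
    (h : DifferentiableAt ℝ φ (t, x)) :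
    HasDerivAt (fun z => φ (t, z)) (fderiv ℝ φ (t, x) (0, 1)) x :=
  h.hasFDerivAt.comp_hasDerivAt x ((hasDerivAt_const x t).prodMk (hasDerivAt_id x))

end LipschitzTest

section Limits

variable {V : Type*} [NormedAddCommGroup V] [InnerProductSpace ℝ V] [FiniteDimensional ℝ V]
  {Λ : SpatialDomain} {T : ℝ} {W : ℝ × ℝ → V}

lemma integrable_indicator_box (A c : ℝ) :
    Integrable (fun p : ℝ × ℝ => {p : ℝ × ℝ | |p.2| ≤ A}.indicator (fun _ => c) p)
      (spaceTimeMeasure Λ T) := by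
  have hm : MeasurableSet {p : ℝ × ℝ | |p.2| ≤ A} :=
    (isClosed_le (continuous_snd.abs) continuous_const).measurableSet
  refine (integrable_indicator_iff hm).2 (integrableOn_const ?_)
  rw [spaceTimeMeasure_eq_restrict, Measure.restrict_apply hm]
  refine ((measure_mono (t := Icc 0 T ×ˢ Icc (-A) A) ?_).trans_lt
    (isCompact_Icc.prod isCompact_Icc).measure_lt_top).ne
  rintro p ⟨h1, h2, -⟩
  exact ⟨Ioo_subset_Icc_self h2, abs_le.1 h1⟩

lemma integrable_indicator_cell (A c : ℝ) :
    Integrable (fun x : ℝ => {x : ℝ | |x| ≤ A}.indicator (fun _ => c) x)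
      (volume.restrict Λ.cell) := by
  have hm : MeasurableSet {x : ℝ | |x| ≤ A} :=
    (isClosed_le continuous_abs continuous_const).measurableSet
  refine (integrable_indicator_iff hm).2 (integrableOn_const ?_)
  refine ((Measure.restrict_apply_le _ _).trans_lt
    ((measure_mono (t := Icc (-A) A) fun x hx => abs_le.1 hx).trans_lt
    isCompact_Icc.measure_lt_top)).ne

variable {a b : ℝ × ℝ → V} {M : ℝ}

/-- The weak form of a conservation law, tested with the mollifications of a Lipschitz test
function, converges to the weak form tested with the function itself. -/
lemma tendsto_weakForm_mollify (hW : IsLipschitzTest Λ T W)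
    (ha : AEStronglyMeasurable a (spaceTimeMeasure Λ T))
    (hb : AEStronglyMeasurable b (spaceTimeMeasure Λ T))
    (haM : ∀ᵐ p ∂(spaceTimeMeasure Λ T), ‖a p‖ ≤ M)
    (hbM : ∀ᵐ p ∂(spaceTimeMeasure Λ T), ‖b p‖ ≤ M) :
    Tendsto (fun n => ∫ t in Ioo 0 T, ∫ x in Λ.cell,
        (inner ℝ (a (t, x)) (deriv (fun s => mollify n W (s, x)) t)
          + inner ℝ (b (t, x)) (deriv (fun z => mollify n W (t, z)) x))) atTop
      (𝓝 (∫ p, (inner ℝ (a p) (fderiv ℝ W p (1, 0))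
        + inner ℝ (b p) (fderiv ℝ W p (0, 1))) ∂(spaceTimeMeasure Λ T))) := by
  let _ : MeasurableSpace V := borel V
  have _ : BorelSpace V := ⟨rfl⟩
  obtain ⟨L, hL⟩ := hW.lipschitz
  obtain ⟨A, hA⟩ := hW.exists_mollify_bound
  set G : ℕ → ℝ × ℝ → ℝ := fun n p =>
    inner ℝ (a p) (mollify n (fun q => fderiv ℝ W q (1, 0)) p)
        + inner ℝ (b p) (mollify n (fun q => fderiv ℝ W q (0, 1)) p) with hG
  have he1 : ‖((1, 0) : ℝ × ℝ)‖ ≤ 1 := by simp [Prod.norm_def]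
  have he2 : ‖((0, 1) : ℝ × ℝ)‖ ≤ 1 := by simp [Prod.norm_def]
  have hloc : ∀ e : ℝ × ℝ, ‖e‖ ≤ 1 → LocallyIntegrable (fun q => fderiv ℝ W q e) := fun e he =>
    (locallyIntegrable_const (L : ℝ)).mono
      (measurable_fderiv_apply_const ℝ W e).aestronglyMeasurable
      (Eventually.of_forall fun q => by
        simpa using IsLipschitzTest.norm_fderiv_apply_le hL q e he)
  have hGm : ∀ n, AEStronglyMeasurable (G n) (spaceTimeMeasure Λ T) := fun n =>
    (ha.inner (contDiff_mollify n (hloc _ he1)).continuous.aestronglyMeasurable).add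
      (hb.inner (contDiff_mollify n (hloc _ he2)).continuous.aestronglyMeasurable)
  have hGb : ∀ n, ∀ᵐ p ∂(spaceTimeMeasure Λ T), ‖G n p‖ ≤
      {p : ℝ × ℝ | |p.2| ≤ A}.indicator (fun _ => M * L + M * L) p := by
    intro n
    filter_upwards [haM, hbM, ae_spaceTimeMeasure_mem Λ T] with p h1 h2 h3
    by_cases hp : |p.2| ≤ A
    · rw [indicator_of_mem (show p ∈ {p : ℝ × ℝ | |p.2| ≤ A} from hp)]
      have hM : 0 ≤ M := (norm_nonneg _).trans h1
      refine (norm_add_le _ _).trans (add_le_add ?_ ?_)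
      · exact (norm_inner_le_norm _ _).trans (mul_le_mul h1 (norm_mollify_le n (fun q =>
          IsLipschitzTest.norm_fderiv_apply_le hL q _ he1) p) (norm_nonneg _) hM)
      · exact (norm_inner_le_norm _ _).trans (mul_le_mul h2 (norm_mollify_le n (fun q =>
          IsLipschitzTest.norm_fderiv_apply_le hL q _ he2) p) (norm_nonneg _) hM)
    · rw [indicator_of_notMem (show p ∉ {p : ℝ × ℝ | |p.2| ≤ A} from hp)]
      have := (hA p h3.2 (not_le.1 hp) n).2
      simp [hG, this]
  have hGi : ∀ n, Integrable (G n) (spaceTimeMeasure Λ T) := fun n =>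
    (integrable_indicator_box A _).mono' (hGm n) (hGb n)
  have key : ∀ n, ∫ t in Ioo 0 T, ∫ x in Λ.cell,
        (inner ℝ (a (t, x)) (deriv (fun s => mollify n W (s, x)) t)
          + inner ℝ (b (t, x)) (deriv (fun z => mollify n W (t, z)) x))
      = ∫ p, G n p ∂(spaceTimeMeasure Λ T) := by
    intro n
    rw [spaceTimeMeasure, integral_prod _ (hGi n)]
    have hd : ∀ p, DifferentiableAt ℝ (mollify n W) p :=
      (contDiff_mollify n hL.continuous.locallyIntegrable).differentiable (by simp)
    simp only [(deriv_left_eq_fderiv (hd _)).deriv, (deriv_right_eq_fderiv (hd _)).deriv,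
      fderiv_mollify n hL, hG]
  simp only [key]
  refine tendsto_integral_of_dominated_convergence _ hGm (integrable_indicator_box A _) hGb ?_
  filter_upwards [ae_spaceTimeMeasure_of_ae (ae_tendsto_mollify (hloc _ he1)),
    ae_spaceTimeMeasure_of_ae (ae_tendsto_mollify (hloc _ he2))] with p h1 h2
  exact (tendsto_const_nhds.inner h1).add (tendsto_const_nhds.inner h2)

lemma tendsto_initial_mollify (hW : IsLipschitzTest Λ T W) {c : ℝ → V}
    (hc : AEStronglyMeasurable c (volume.restrict Λ.cell))
    (hcM : ∀ᵐ x ∂(volume.restrict Λ.cell), ‖c x‖ ≤ M) :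
    Tendsto (fun n => ∫ x in Λ.cell, inner ℝ (c x) (mollify n W (0, x))) atTop
      (𝓝 (∫ x in Λ.cell, inner ℝ (c x) (W (0, x)))) := by
  obtain ⟨L, hL⟩ := hW.lipschitz
  obtain ⟨A, hA⟩ := hW.exists_mollify_bound
  obtain ⟨B, hB⟩ := hW.exists_norm_le
  refine tendsto_integral_of_dominated_convergence _ (fun n => ?_)
    (integrable_indicator_cell A (M * B)) (fun n => ?_) (Eventually.of_forall fun x => ?_)
  · exact hc.inner (((contDiff_mollify n hL.continuous.locallyIntegrable).continuous.comp
      (by fun_prop : Continuous fun x : ℝ => ((0 : ℝ), x))).aestronglyMeasurable)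
  · filter_upwards [hcM, ae_restrict_mem Λ.measurableSet_cell] with x h1 h2
    by_cases hx : |x| ≤ A
    · rw [indicator_of_mem (show x ∈ {x : ℝ | |x| ≤ A} from hx)]
      exact (norm_inner_le_norm _ _).trans (mul_le_mul h1 (norm_mollify_le n hB _)
        (norm_nonneg _) ((norm_nonneg _).trans h1))
    · rw [indicator_of_notMem (show x ∉ {x : ℝ | |x| ≤ A} from hx),
        (hA (0, x) h2 (not_le.1 hx) n).1, inner_zero_right, norm_zero]
  · exact tendsto_const_nhds.inner (tendsto_mollify hL.continuous _)

/-- The weak formulation holds for Lipschitz test functions. -/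
lemma IsWeakSolution.integral_lipschitz {m : ℕ} {f : State m → State m} {u₀ : ℝ → State m}
    {u : ℝ → ℝ → State m} {W : ℝ × ℝ → State m}
    (h : IsWeakSolution Λ T f u₀ u) (hW : IsLipschitzTest Λ T W)
    (hu : AEStronglyMeasurable (fun p : ℝ × ℝ => u p.1 p.2) (spaceTimeMeasure Λ T))
    (hf : AEStronglyMeasurable (fun p : ℝ × ℝ => f (u p.1 p.2)) (spaceTimeMeasure Λ T))
    (huM : ∀ᵐ p ∂(spaceTimeMeasure Λ T), ‖u p.1 p.2‖ ≤ M)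
    (hfM : ∀ᵐ p ∂(spaceTimeMeasure Λ T), ‖f (u p.1 p.2)‖ ≤ M)
    (hu₀ : AEStronglyMeasurable u₀ (volume.restrict Λ.cell))
    (hu₀M : ∀ᵐ x ∂(volume.restrict Λ.cell), ‖u₀ x‖ ≤ M) :
    ∫ p, (inner ℝ (u p.1 p.2) (fderiv ℝ W p (1, 0))
        + inner ℝ (f (u p.1 p.2)) (fderiv ℝ W p (0, 1))) ∂(spaceTimeMeasure Λ T)
      = - ∫ x in Λ.cell, inner ℝ (u₀ x) (W (0, x)) := by
  refine tendsto_nhds_unique (tendsto_weakForm_mollify hW hu hf huM hfM)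
    ((tendsto_initial_mollify hW hu₀ hu₀M).neg.congr' ?_)
  filter_upwards [hW.eventually_isSpaceTimeTest_mollify] with n hn
  exact (h _ hn).symm

/-- The entropy inequality holds for nonnegative Lipschitz test functions. -/
lemma SatisfiesEntropyInequality.le_integral_lipschitz {m : ℕ} {η q : State m → ℝ}
    {u₀ : ℝ → State m} {u : ℝ → ℝ → State m} {W : ℝ × ℝ → ℝ}
    (h : SatisfiesEntropyInequality Λ T η q u₀ u) (hW : IsLipschitzTest Λ T W)
    (hW0 : ∀ p, 0 ≤ W p)
    (hη : AEStronglyMeasurable (fun p : ℝ × ℝ => η (u p.1 p.2)) (spaceTimeMeasure Λ T))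
    (hq : AEStronglyMeasurable (fun p : ℝ × ℝ => q (u p.1 p.2)) (spaceTimeMeasure Λ T))
    (hηM : ∀ᵐ p ∂(spaceTimeMeasure Λ T), ‖η (u p.1 p.2)‖ ≤ M)
    (hqM : ∀ᵐ p ∂(spaceTimeMeasure Λ T), ‖q (u p.1 p.2)‖ ≤ M)
    (hη₀ : AEStronglyMeasurable (fun x => η (u₀ x)) (volume.restrict Λ.cell))
    (hη₀M : ∀ᵐ x ∂(volume.restrict Λ.cell), ‖η (u₀ x)‖ ≤ M) :
    - ∫ x in Λ.cell, η (u₀ x) * W (0, x) ≤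
      ∫ p, (η (u p.1 p.2) * fderiv ℝ W p (1, 0)
        + q (u p.1 p.2) * fderiv ℝ W p (0, 1)) ∂(spaceTimeMeasure Λ T) := by
  have h1 := tendsto_weakForm_mollify hW hη hq hηM hqM
  have h2 := (tendsto_initial_mollify hW hη₀ hη₀M).neg
  have hin : ∀ a b : ℝ, inner ℝ a b = a * b := fun a b => by
    rw [real_inner_eq_re_inner]; simp [mul_comm]
  simp only [hin] at h1 h2
  refine le_of_tendsto_of_tendsto h2 h1 ?_
  filter_upwards [hW.eventually_isSpaceTimeTest_mollify] with n hn
  exact h _ hn fun t x _ => mollify_nonneg n hW0 _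

end Limits

/-! ### Taylor remainders and the relative entropy -/

section Taylor

variable {E V : Type*} [NormedAddCommGroup E] [NormedSpace ℝ E]
  [NormedAddCommGroup V] [NormedSpace ℝ V]

lemma norm_sub_sub_le_of_norm_deriv_deriv_le {g g' g'' : ℝ → V} {c : ℝ}
    (hg : ∀ s ∈ Icc (0 : ℝ) 1, HasDerivAt g (g' s) s)
    (hg' : ∀ s ∈ Icc (0 : ℝ) 1, HasDerivAt g' (g'' s) s)
    (hc : ∀ s ∈ Icc (0 : ℝ) 1, ‖g'' s‖ ≤ c) : ‖g 1 - g 0 - g' 0‖ ≤ c / 2 := by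
  have h1 : ∀ s ∈ Icc (0 : ℝ) 1, ‖g' s - g' 0‖ ≤ c * s := by
    refine image_norm_le_of_norm_deriv_right_le_deriv_boundary (f' := g'') (B' := fun _ => c)
      ?_ ?_ (by simp) (fun s => by simpa using (hasDerivAt_id s).const_mul c) ?_
    · exact fun s hs => ((hg' s hs).continuousAt.sub continuousAt_const).continuousWithinAt
    · exact fun s hs => ((hg' s (Ico_subset_Icc_self hs)).sub_const _).hasDerivWithinAt
    · exact fun s hs => hc s (Ico_subset_Icc_self hs)
  have h2 : ∀ s ∈ Icc (0 : ℝ) 1, ‖g s - g 0 - s • g' 0‖ ≤ c / 2 * s ^ 2 := by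
    refine image_norm_le_of_norm_deriv_right_le_deriv_boundary
      (f' := fun s => g' s - (1 : ℝ) • g' 0) (B' := fun s => c * s)
      ?_ ?_ (by simp) (fun s => ?_) ?_
    · exact fun s hs => (((hg s hs).continuousAt.sub continuousAt_const).sub
        (continuousAt_id.smul continuousAt_const)).continuousWithinAt
    · exact fun s hs => (((hg s (Ico_subset_Icc_self hs)).sub_const _).sub
        ((hasDerivAt_id s).smul_const _)).hasDerivWithinAt
    · have := ((hasDerivAt_id s).pow 2).const_mul (c / 2)
      refine this.congr_deriv ?_
      simp; ring
    · intro s hs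
      simpa using h1 s (Ico_subset_Icc_self hs)
  simpa using h2 1 ⟨zero_le_one, le_rfl⟩

/-- The first-order Taylor remainder `φ(z) - φ(z₀) - Dφ(z₀)(z - z₀)`. For `φ = η` it is the
relative entropy of `z` with respect to `z₀`. -/
noncomputable def taylorRemainder (φ : E → V) (z z₀ : E) : V :=
  φ z - φ z₀ - fderiv ℝ φ z₀ (z - z₀)

variable {U C : Set E} {φ : E → V}

lemma contDiffAt_of_mem (hU : IsOpen U) (hφ : ContDiffOn ℝ 2 φ U) {z : E} (hz : z ∈ U) :
    ContDiffAt ℝ 2 φ z := hφ.contDiffAt (hU.mem_nhds hz)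

lemma hasFDerivAt_fderiv (hU : IsOpen U) (hφ : ContDiffOn ℝ 2 φ U) {z : E} (hz : z ∈ U) :
    HasFDerivAt (fderiv ℝ φ) (fderiv ℝ (fderiv ℝ φ) z) z :=
  (((contDiffAt_of_mem hU hφ hz).fderiv_right (m := 1) (by norm_num)).differentiableAt
    (by simp)).hasFDerivAt

lemma hasFDerivAt_self (hU : IsOpen U) (hφ : ContDiffOn ℝ 2 φ U) {z : E} (hz : z ∈ U) :
    HasFDerivAt φ (fderiv ℝ φ z) z :=
  ((contDiffAt_of_mem hU hφ hz).differentiableAt (by simp)).hasFDerivAt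

lemma continuousOn_fderiv_fderiv (hU : IsOpen U) (hφ : ContDiffOn ℝ 2 φ U) :
    ContinuousOn (fderiv ℝ (fderiv ℝ φ)) U := fun _ hz =>
  (((contDiffAt_of_mem hU hφ hz).fderiv_right (m := 1) (by norm_num)).fderiv_right (m := 0)
    (by norm_num)).continuousAt.continuousWithinAt

/-- Taylor's formula with a reference value `b` for the second derivative. The value `b = 0` gives
upper bounds; nonzero values of `b` give two-sided bounds for the relative entropy. -/
lemma norm_taylorRemainder_sub_le (hU : IsOpen U) (hφ : ContDiffOn ℝ 2 φ U) (hCU : C ⊆ U)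
    (hC : Convex ℝ C) {z z₀ : E} (hz : z ∈ C) (hz₀ : z₀ ∈ C) {c : ℝ} (b : V)
    (hc : ∀ s ∈ C, ‖fderiv ℝ (fderiv ℝ φ) s (z - z₀) (z - z₀) - b‖ ≤ c) :
    ‖taylorRemainder φ z z₀ - (1 / 2 : ℝ) • b‖ ≤ c / 2 := by
  have hγ : ∀ s : ℝ, HasDerivAt (fun s : ℝ => z₀ + s • (z - z₀)) (z - z₀) s := fun s => by
    simpa using ((hasDerivAt_id s).smul_const (z - z₀)).const_add z₀
  have hmem : ∀ s ∈ Icc (0 : ℝ) 1, z₀ + s • (z - z₀) ∈ C := fun s hs =>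
    hC.add_smul_sub_mem hz₀ hz hs
  have hsq : ∀ s : ℝ, HasDerivAt (fun s : ℝ => (s ^ 2 / 2) • b) (s • b) s := fun s => by
    have := (((hasDerivAt_id s).pow 2).div_const 2).smul_const b
    refine this.congr_deriv ?_
    simp
  have := norm_sub_sub_le_of_norm_deriv_deriv_le
    (g := fun s => φ (z₀ + s • (z - z₀)) - (s ^ 2 / 2) • b)
    (g' := fun s => fderiv ℝ φ (z₀ + s • (z - z₀)) (z - z₀) - s • b)
    (g'' := fun s => fderiv ℝ (fderiv ℝ φ) (z₀ + s • (z - z₀)) (z - z₀) (z - z₀) - b) (c := c)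
    (fun s hs => ((hasFDerivAt_self hU hφ (hCU (hmem s hs))).comp_hasDerivAt s (hγ s)).sub
      (hsq s))
    (fun s hs => by
      have h1 := (hasFDerivAt_fderiv hU hφ (hCU (hmem s hs))).comp_hasDerivAt s (hγ s)
      have h2 := h1.clm_apply (hasDerivAt_const s (z - z₀))
      have h3 : HasDerivAt (fun s : ℝ => s • b) b s := by
        simpa using (hasDerivAt_id s).smul_const b
      exact (h2.sub h3).congr_deriv (by simp))
    (fun s hs => hc _ (hmem s hs))
  convert this using 2
  simp only [taylorRemainder, one_smul, zero_smul, add_zero, add_sub_cancel]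
  simp
  abel

lemma norm_taylorRemainder_le (hU : IsOpen U) (hφ : ContDiffOn ℝ 2 φ U) (hCU : C ⊆ U)
    (hC : Convex ℝ C) {z z₀ : E} (hz : z ∈ C) (hz₀ : z₀ ∈ C) {c : ℝ}
    (hc : ∀ s ∈ C, ‖fderiv ℝ (fderiv ℝ φ) s (z - z₀) (z - z₀)‖ ≤ c) :
    ‖taylorRemainder φ z z₀‖ ≤ c / 2 := by
  simpa using norm_taylorRemainder_sub_le hU hφ hCU hC hz hz₀ 0 (by simpa using hc)

end Taylor

section System

variable {m : ℕ}

/-- A conservation law with flux `f` and entropy pair `(η, q)` on `U`, for which the second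
derivatives of `f` and of `η` are bounded on the compact convex set of states `C`. This is the
situation at a fixed parameter `y`. -/
structure IsConvexEntropySystem (U C : Set (State m)) (f : State m → State m)
    (η q : State m → ℝ) (CF ηlow ηup : ℝ) : Prop where
  isOpen : IsOpen U
  isCompact : IsCompact C
  convex : Convex ℝ C
  subset : C ⊆ U
  flux : ContDiffOn ℝ 2 f U
  entropy : ContDiffOn ℝ 2 η U
  entropyFlux : ContDiffOn ℝ 2 q U
  compatible : ∀ z ∈ U, (fderiv ℝ η z).comp (fderiv ℝ f z) = fderiv ℝ q z
  flux_nonneg : 0 ≤ CF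
  low_pos : 0 < ηlow
  low_le_up : ηlow ≤ ηup
  flux_le : ∀ z ∈ C, ∀ v : State m, ‖fderiv ℝ (fderiv ℝ f) z v v‖ ≤ CF * ‖v‖ ^ 2
  le_entropy : ∀ z ∈ C, ∀ v : State m, ηlow * ‖v‖ ^ 2 ≤ fderiv ℝ (fderiv ℝ η) z v v
  entropy_le : ∀ z ∈ C, ∀ v : State m, fderiv ℝ (fderiv ℝ η) z v v ≤ ηup * ‖v‖ ^ 2

namespace IsConvexEntropySystem

variable {U C : Set (State m)} {f : State m → State m} {η q : State m → ℝ} {CF ηlow ηup : ℝ}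

lemma up_pos (h : IsConvexEntropySystem U C f η q CF ηlow ηup) : 0 < ηup :=
  h.low_pos.trans_le h.low_le_up

lemma norm_taylorRemainder_flux_le (h : IsConvexEntropySystem U C f η q CF ηlow ηup)
    {z z₀ : State m} (hz : z ∈ C) (hz₀ : z₀ ∈ C) :
    ‖taylorRemainder f z z₀‖ ≤ CF / 2 * ‖z - z₀‖ ^ 2 := by
  have := norm_taylorRemainder_le h.isOpen h.flux h.subset h.convex hz hz₀
    (fun s hs => h.flux_le s hs (z - z₀))
  linarith

lemma abs_taylorRemainder_entropy_sub_le (h : IsConvexEntropySystem U C f η q CF ηlow ηup)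
    {z z₀ : State m} (hz : z ∈ C) (hz₀ : z₀ ∈ C) :
    |taylorRemainder η z z₀ - (ηlow + ηup) / 4 * ‖z - z₀‖ ^ 2|
      ≤ (ηup - ηlow) / 4 * ‖z - z₀‖ ^ 2 := by
  have := norm_taylorRemainder_sub_le h.isOpen h.entropy h.subset h.convex hz hz₀
    (b := (ηlow + ηup) / 2 * ‖z - z₀‖ ^ 2) (c := (ηup - ηlow) / 2 * ‖z - z₀‖ ^ 2)
    (fun s hs => by
      have h1 := h.le_entropy s hs (z - z₀)
      have h2 := h.entropy_le s hs (z - z₀)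
      rw [Real.norm_eq_abs, abs_le]
      constructor <;> linarith)
  rw [Real.norm_eq_abs, smul_eq_mul] at this
  convert this using 1
  · congr 1; ring
  · ring

lemma le_taylorRemainder_entropy (h : IsConvexEntropySystem U C f η q CF ηlow ηup)
    {z z₀ : State m} (hz : z ∈ C) (hz₀ : z₀ ∈ C) :
    ηlow / 2 * ‖z - z₀‖ ^ 2 ≤ taylorRemainder η z z₀ := by
  have := (abs_le.1 (h.abs_taylorRemainder_entropy_sub_le hz hz₀)).1
  linarith

lemma taylorRemainder_entropy_le (h : IsConvexEntropySystem U C f η q CF ηlow ηup)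
    {z z₀ : State m} (hz : z ∈ C) (hz₀ : z₀ ∈ C) :
    taylorRemainder η z z₀ ≤ ηup / 2 * ‖z - z₀‖ ^ 2 := by
  have := (abs_le.1 (h.abs_taylorRemainder_entropy_sub_le hz hz₀)).2
  linarith

lemma fderiv_fderiv_symm (h : IsConvexEntropySystem U C f η q CF ηlow ηup)
    {z : State m} (hz : z ∈ U) (a b : State m) :
    fderiv ℝ (fderiv ℝ η) z a b = fderiv ℝ (fderiv ℝ η) z b a :=
  ((contDiffAt_of_mem h.isOpen h.entropy hz).isSymmSndFDerivAt (by simp)) a b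

/-- The Hessian of the entropy is bounded by `ηup` as a bilinear form: by symmetry and positivity,
`4 B(a,b) = B(a+b,a+b) - B(a-b,a-b) ≤ ηup ‖a+b‖²`. -/
lemma abs_fderiv_fderiv_entropy_le (h : IsConvexEntropySystem U C f η q CF ηlow ηup)
    {z : State m} (hz : z ∈ C) (a b : State m) :
    |fderiv ℝ (fderiv ℝ η) z a b| ≤ ηup * ‖a‖ * ‖b‖ := by
  set B := fderiv ℝ (fderiv ℝ η) z with hB
  have hunit : ∀ a b : State m, ‖a‖ = 1 → ‖b‖ = 1 → B a b ≤ ηup := by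
    intro a b ha hb
    have h1 := h.entropy_le z hz (a + b)
    have h2 := h.le_entropy z hz (a - b)
    have h3 : ‖a + b‖ ^ 2 ≤ 4 := by
      have := norm_add_le a b
      nlinarith [norm_nonneg (a + b)]
    have h4 := h.fderiv_fderiv_symm (h.subset hz) a b
    rw [← hB] at h1 h2 h4
    simp only [map_add, map_sub, add_apply,
      sub_apply] at h1 h2
    nlinarith [h.low_pos, h.up_pos, mul_nonneg h.low_pos.le (sq_nonneg ‖a - b‖),
      mul_le_mul_of_nonneg_left h3 h.up_pos.le]
  have hle : ∀ a b : State m, B a b ≤ ηup * ‖a‖ * ‖b‖ := by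
    intro a b
    rcases eq_or_ne a 0 with rfl | ha
    · simp
    rcases eq_or_ne b 0 with rfl | hb
    · simp
    have h1 := hunit ((‖a‖)⁻¹ • a) ((‖b‖)⁻¹ • b) (norm_smul_inv_norm ha) (norm_smul_inv_norm hb)
    simp only [map_smul, smul_apply, smul_eq_mul] at h1
    have ha' := norm_pos_iff.2 ha
    have hb' := norm_pos_iff.2 hb
    field_simp at h1
    linarith
  rw [abs_le]
  constructor
  · have := hle (-a) b
    simp only [map_neg, neg_apply, norm_neg] at this
    linarith
  · exact hle a b

/-- The compatibility of the entropy pair makes `D²η(z) Df(z)` a symmetric bilinear form. -/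
lemma entropy_flux_symm (h : IsConvexEntropySystem U C f η q CF ηlow ηup)
    {z : State m} (hz : z ∈ U) (a b : State m) :
    fderiv ℝ (fderiv ℝ η) z a (fderiv ℝ f z b) = fderiv ℝ (fderiv ℝ η) z b (fderiv ℝ f z a) := by
  -- differentiate `Dη Df = Dq`; the other two second derivatives are symmetric
  have key : ∀ a b : State m, fderiv ℝ (fderiv ℝ η) z a (fderiv ℝ f z b)
      + fderiv ℝ η z (fderiv ℝ (fderiv ℝ f) z a b) = fderiv ℝ (fderiv ℝ q) z a b := by
    intro a b
    have h1 := (hasFDerivAt_fderiv h.isOpen h.entropy hz).clm_comp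
      (hasFDerivAt_fderiv h.isOpen h.flux hz)
    have h2 : (fun z => (fderiv ℝ η z).comp (fderiv ℝ f z)) =ᶠ[𝓝 z] fderiv ℝ q := by
      filter_upwards [h.isOpen.mem_nhds hz] with z' hz' using h.compatible z' hz'
    have h3 := (h1.congr_of_eventuallyEq h2.symm).fderiv
    rw [h3]
    simp [add_comm]
  have hf := (contDiffAt_of_mem h.isOpen h.flux hz).isSymmSndFDerivAt (by simp) a b
  have hq := (contDiffAt_of_mem h.isOpen h.entropyFlux hz).isSymmSndFDerivAt (by simp) a b
  have h1 := key a b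
  have h2 := key b a
  rw [hf] at h1
  rw [hq] at h1
  linarith

/-- The relative entropy flux is dominated by the squared distance of the states. -/
lemma exists_relativeFlux_le (h : IsConvexEntropySystem U C f η q CF ηlow ηup) :
    ∃ K : ℝ, 0 ≤ K ∧ ∀ z ∈ C, ∀ z₀ ∈ C,
      |q z - q z₀ - fderiv ℝ η z₀ (f z - f z₀)| ≤ K * ‖z - z₀‖ ^ 2 := by
  obtain ⟨K₁, hK₁⟩ := h.isCompact.exists_bound_of_continuousOn
    (f := fderiv ℝ (fderiv ℝ q)) ((continuousOn_fderiv_fderiv h.isOpen h.entropyFlux).mono h.subset)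
  obtain ⟨K₂, hK₂⟩ := h.isCompact.exists_bound_of_continuousOn (f := fderiv ℝ η)
    (fun z hz => (hasFDerivAt_fderiv h.isOpen h.entropy
      (h.subset hz)).continuousAt.continuousWithinAt)
  refine ⟨|K₁| / 2 + |K₂| * (CF / 2), by have := h.flux_nonneg; positivity, fun z hz z₀ hz₀ => ?_⟩
  have h1 : ‖taylorRemainder q z z₀‖ ≤ |K₁| * ‖z - z₀‖ ^ 2 / 2 := by
    refine norm_taylorRemainder_le h.isOpen h.entropyFlux h.subset h.convex hz hz₀ fun s hs => ?_
    refine (ContinuousLinearMap.le_opNorm₂ _ _ _).trans ?_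
    rw [pow_two, mul_assoc]
    exact mul_le_mul_of_nonneg_right ((hK₁ s hs).trans (le_abs_self _)) (by positivity)
  have h2 : |fderiv ℝ η z₀ (taylorRemainder f z z₀)| ≤ |K₂| * (CF / 2 * ‖z - z₀‖ ^ 2) :=
    ((fderiv ℝ η z₀).le_opNorm _).trans (mul_le_mul ((hK₂ z₀ hz₀).trans (le_abs_self _))
      (h.norm_taylorRemainder_flux_le hz hz₀) (norm_nonneg _) (abs_nonneg _))
  -- the first-order terms cancel by compatibility
  have h3 : q z - q z₀ - fderiv ℝ η z₀ (f z - f z₀)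
      = taylorRemainder q z z₀ - fderiv ℝ η z₀ (taylorRemainder f z z₀) := by
    have := DFunLike.congr_fun (h.compatible z₀ (h.subset hz₀)) (z - z₀)
    simp only [ContinuousLinearMap.comp_apply] at this
    simp only [taylorRemainder, map_sub] at this ⊢
    linarith
  rw [h3]
  rw [Real.norm_eq_abs] at h1
  refine (abs_sub _ _).trans ?_
  linarith

end IsConvexEntropySystem

end System

/-! ### The relative entropy inequality -/

section IntegrationByParts

variable {Λ : SpatialDomain} {T : ℝ}

namespace IsLipschitzTest

variable {V : Type*} [NormedAddCommGroup V] [InnerProductSpace ℝ V] [FiniteDimensional ℝ V]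
  {W : ℝ × ℝ → V} {M : ℝ}

lemma exists_fderiv_eq_zero (hW : IsLipschitzTest Λ T W) :
    ∃ A : ℝ, ∀ p : ℝ × ℝ, p.2 ∈ Λ.cell → A < |p.2| → W p = 0 ∧ fderiv ℝ W p = 0 := by
  obtain ⟨A, hA⟩ := hW.exists_space_bound
  refine ⟨A, fun p hp hpA => ⟨hA p p.2 hp (by simp) hpA, ?_⟩⟩
  have hev : W =ᶠ[𝓝 p] fun _ => 0 := by
    have : ∀ᶠ q' in 𝓝 p, |q'.2 - p.2| < 1 :=
      (((continuous_snd.sub continuous_const).abs).tendsto p).eventually_lt_const (by simp)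
    exact this.mono fun q' hq' => hA q' p.2 hp hq'.le hpA
  simp [hev.fderiv_eq]

lemma integrable_inner_fderiv (hW : IsLipschitzTest Λ T W) {a : ℝ × ℝ → V}
    (ha : AEStronglyMeasurable a (spaceTimeMeasure Λ T))
    (haM : ∀ᵐ p ∂(spaceTimeMeasure Λ T), ‖a p‖ ≤ M) (e : ℝ × ℝ) :
    Integrable (fun p => inner ℝ (a p) (fderiv ℝ W p e)) (spaceTimeMeasure Λ T) := by
  let _ : MeasurableSpace V := borel V
  have _ : BorelSpace V := ⟨rfl⟩
  obtain ⟨L, hL⟩ := hW.lipschitz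
  obtain ⟨A, hA⟩ := hW.exists_fderiv_eq_zero
  refine (integrable_indicator_box A (M * (L * ‖e‖))).mono'
    (ha.inner (measurable_fderiv_apply_const ℝ W e).aestronglyMeasurable) ?_
  filter_upwards [haM, ae_spaceTimeMeasure_mem Λ T] with p h1 h3
  by_cases hp : |p.2| ≤ A
  · rw [indicator_of_mem (show p ∈ {p : ℝ × ℝ | |p.2| ≤ A} from hp)]
    exact (norm_inner_le_norm _ _).trans (mul_le_mul h1 (((fderiv ℝ W p).le_opNorm e).trans
      (mul_le_mul_of_nonneg_right (norm_fderiv_le_of_lipschitz ℝ hL) (norm_nonneg _)))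
      (norm_nonneg _) ((norm_nonneg _).trans h1))
  · rw [indicator_of_notMem (show p ∉ {p : ℝ × ℝ | |p.2| ≤ A} from hp)]
    simp [(hA p h3.2 (not_le.1 hp)).2]

lemma integrable_inner_initial (hW : IsLipschitzTest Λ T W) {c : ℝ → V}
    (hc : AEStronglyMeasurable c (volume.restrict Λ.cell))
    (hcM : ∀ᵐ x ∂(volume.restrict Λ.cell), ‖c x‖ ≤ M) (t : ℝ) :
    Integrable (fun x => inner ℝ (c x) (W (t, x))) (volume.restrict Λ.cell) := by
  obtain ⟨L, hL⟩ := hW.lipschitz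
  obtain ⟨A, hA⟩ := hW.exists_fderiv_eq_zero
  obtain ⟨B, hB⟩ := hW.exists_norm_le
  refine (integrable_indicator_cell A (M * B)).mono' (hc.inner ((hL.continuous.comp
      (by fun_prop : Continuous fun x : ℝ => (t, x))).aestronglyMeasurable)) ?_
  filter_upwards [hcM, ae_restrict_mem Λ.measurableSet_cell] with x h1 h2
  by_cases hx : |x| ≤ A
  · rw [indicator_of_mem (show x ∈ {x : ℝ | |x| ≤ A} from hx)]
    exact (norm_inner_le_norm _ _).trans (mul_le_mul h1 (hB _)
      (norm_nonneg _) ((norm_nonneg _).trans h1))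
  · rw [indicator_of_notMem (show x ∉ {x : ℝ | |x| ≤ A} from hx),
      (hA (t, x) h2 (not_le.1 hx)).1, inner_zero_right, norm_zero]

variable {κ : ℝ × ℝ → ℝ}

lemma integrable_mul_fderiv (hκ : IsLipschitzTest Λ T κ) {a : ℝ × ℝ → ℝ}
    (ha : AEStronglyMeasurable a (spaceTimeMeasure Λ T))
    (haM : ∀ᵐ p ∂(spaceTimeMeasure Λ T), ‖a p‖ ≤ M) (e : ℝ × ℝ) :
    Integrable (fun p => a p * fderiv ℝ κ p e) (spaceTimeMeasure Λ T) := by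
  simpa [mul_comm] using hκ.integrable_inner_fderiv ha haM e

lemma integrable_mul_initial (hκ : IsLipschitzTest Λ T κ) {c : ℝ → ℝ}
    (hc : AEStronglyMeasurable c (volume.restrict Λ.cell))
    (hcM : ∀ᵐ x ∂(volume.restrict Λ.cell), ‖c x‖ ≤ M) (t : ℝ) :
    Integrable (fun x => c x * κ (t, x)) (volume.restrict Λ.cell) := by
  simpa [mul_comm] using hκ.integrable_inner_initial hc hcM t

lemma integrable_fderiv (hκ : IsLipschitzTest Λ T κ) (e : ℝ × ℝ) :
    Integrable (fun p => fderiv ℝ κ p e) (spaceTimeMeasure Λ T) := by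
  simpa using hκ.integrable_mul_fderiv (a := fun _ => 1) (M := 1)
    aestronglyMeasurable_const (by simp) e

/-- Integration by parts in time. -/
lemma integral_fderiv_time (hκ : IsLipschitzTest Λ T κ) (hT : 0 < T) :
    ∫ p, fderiv ℝ κ p (1, 0) ∂(spaceTimeMeasure Λ T) = - ∫ x in Λ.cell, κ (0, x) := by
  obtain ⟨L, hL⟩ := hκ.lipschitz
  obtain ⟨a, b, hb, hab⟩ := hκ.time
  rw [spaceTimeMeasure, integral_prod_symm _ (hκ.integrable_fderiv (1, 0)), ← integral_neg]
  refine integral_congr_ae ?_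
  have h1 : ∀ᵐ x : ℝ, ∀ᵐ t : ℝ, DifferentiableAt ℝ κ (t, x) := by
    have h2 : ∀ᵐ p ∂((volume : Measure ℝ).prod volume), DifferentiableAt ℝ κ (p.2, p.1) :=
      (Measure.measurePreserving_swap (μ := (volume : Measure ℝ)) (ν := (volume :
        Measure ℝ))).quasiMeasurePreserving.ae hL.ae_differentiableAt
    exact Measure.ae_ae_of_ae_prod h2
  filter_upwards [ae_restrict_of_ae h1] with x hx
  have hac : AbsolutelyContinuousOnInterval (fun s => κ (s, x)) 0 T :=
    ((hL.comp (LipschitzWith.id.prodMk (LipschitzWith.const x))).lipschitzOnWith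
      (s := uIcc 0 T)).absolutelyContinuousOnInterval
  have h3 := hac.integral_deriv_eq_sub
  rw [hab T x (fun h => by linarith [h.2]), zero_sub, intervalIntegral.integral_of_le hT.le,
    integral_Ioc_eq_integral_Ioo] at h3
  rw [← h3]
  refine integral_congr_ae ?_
  filter_upwards [ae_restrict_of_ae hx] with t ht
  exact (deriv_left_eq_fderiv ht).deriv.symm

/-- Integration by parts in space; there are no boundary terms. -/
lemma integral_fderiv_space (hκ : IsLipschitzTest Λ T κ) :
    ∫ p, fderiv ℝ κ p (0, 1) ∂(spaceTimeMeasure Λ T) = 0 := by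
  obtain ⟨L, hL⟩ := hκ.lipschitz
  rw [spaceTimeMeasure, integral_prod _ (hκ.integrable_fderiv (0, 1))]
  refine integral_eq_zero_of_ae ?_
  have h1 : ∀ᵐ t : ℝ, ∀ᵐ x : ℝ, DifferentiableAt ℝ κ (t, x) :=
    Measure.ae_ae_of_ae_prod hL.ae_differentiableAt
  filter_upwards [ae_restrict_of_ae h1] with t ht
  have hac : ∀ a b, AbsolutelyContinuousOnInterval (fun z => κ (t, z)) a b := fun a b =>
    ((hL.comp ((LipschitzWith.const t).prodMk LipschitzWith.id)).lipschitzOnWith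
      (s := uIcc a b)).absolutelyContinuousOnInterval
  have h2 : ∫ x in Λ.cell, fderiv ℝ κ (t, x) (0, 1)
      = ∫ x in Λ.cell, deriv (fun z => κ (t, z)) x := by
    refine integral_congr_ae ?_
    filter_upwards [ae_restrict_of_ae ht] with x hx
    exact (deriv_right_eq_fderiv hx).deriv.symm
  rw [h2, Pi.zero_apply]
  cases Λ with
  | line =>
    obtain ⟨A, hA⟩ := hκ.space
    have hA' : ∀ z, z ∉ Icc (-A) A → κ (t, z) = 0 := fun z hz =>
      hA t z (not_le.1 fun h => hz (abs_le.1 h))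
    have h3 := (hac (-|A| - 1) (|A| + 1)).integral_deriv_eq_sub
    have hA1 := le_abs_self A
    have hA2 := abs_nonneg A
    rw [hA' _ (fun h => by linarith [h.2]), hA' _ (fun h => by linarith [h.1]), sub_self,
      intervalIntegral.integral_of_le (by linarith)] at h3
    rw [← h3, SpatialDomain.cell, setIntegral_univ]
    symm
    refine setIntegral_eq_integral_of_forall_compl_eq_zero fun z hz => ?_
    have hev : (fun z => κ (t, z)) =ᶠ[𝓝 z] fun _ => 0 := by
      have hz' : A < |z| := by
        by_contra hcon
        have := abs_le.1 (not_lt.1 hcon)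
        exact hz ⟨by linarith [this.1], by linarith [this.2]⟩
      filter_upwards [(continuous_abs.tendsto z).eventually_const_lt hz'] with z' h
      exact hA t z' h
    rw [hev.deriv_eq, deriv_const]
  | periodic =>
    have h3 := (hac 0 1).integral_deriv_eq_sub
    have h4 := hκ.space t 0
    simp only [zero_add] at h4
    rw [h4, sub_self, intervalIntegral.integral_of_le zero_le_one] at h3
    rw [SpatialDomain.cell, integral_Icc_eq_integral_Ioc, h3]

end IsLipschitzTest

end IntegrationByParts

section Composition

variable {V : Type*} [NormedAddCommGroup V]

lemma aestronglyMeasurable_comp_of_continuousOn {α : Type*} [MeasurableSpace α] {μ : Measure α}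
    {E : Type*} [NormedAddCommGroup E] [MeasurableSpace E] [BorelSpace E]
    [SecondCountableTopology V] {C : Set E} (hC : IsClosed C) {g : E → V} (hg : ContinuousOn g C)
    {u : α → E} (hu : AEStronglyMeasurable u μ) (huC : ∀ᵐ a ∂μ, u a ∈ C) :
    AEStronglyMeasurable (fun a => g (u a)) μ := by
  classical
  let _ : MeasurableSpace V := borel V
  have _ : BorelSpace V := ⟨rfl⟩
  have h1 : Measurable (C.piecewise g fun _ => 0) :=
    hg.measurable_piecewise continuousOn_const hC.measurableSet
  refine ((h1.comp_aemeasurable hu.aemeasurable).aestronglyMeasurable).congr ?_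
  filter_upwards [huC] with a ha
  simp [ha]

variable [NormedSpace ℝ V] {Λ : SpatialDomain} {T : ℝ} {m : ℕ}

/-- A Lipschitz space-time function with values in the set of states `C`. -/
structure IsLipschitzField (Λ : SpatialDomain) (C : Set (State m)) (v : ℝ × ℝ → State m) :
    Prop where
  lipschitz : ∃ L : ℝ≥0, LipschitzWith L v
  mem : ∀ p, v p ∈ C
  compatible : ∀ t, Λ.Compatible fun x => v (t, x)

/-- Multiplication of a scalar Lipschitz test function by a `C¹` function of a Lipschitz field. -/
lemma IsLipschitzTest.smul_comp {κ : ℝ × ℝ → ℝ} (hκ : IsLipschitzTest Λ T κ) {C : Set (State m)}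
    {U : Set (State m)} (hU : IsOpen U) (hC : IsCompact C) (hCU : C ⊆ U) {h : State m → V}
    (hh : ContDiffOn ℝ 1 h U)
    {v : ℝ × ℝ → State m} (hv : IsLipschitzField Λ C v) :
    IsLipschitzTest Λ T fun p => κ p • h (v p) := by
  obtain ⟨L, hL⟩ := hκ.lipschitz
  obtain ⟨B, hB⟩ := hκ.exists_norm_le
  obtain ⟨Lv, hLv⟩ := hv.lipschitz
  have hloc : LocallyLipschitzOn C h := fun z hz => by
    obtain ⟨K, s, hs, hK⟩ := (hh.contDiffAt (hU.mem_nhds (hCU hz))).exists_lipschitzOnWith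
    exact ⟨K, s, mem_nhdsWithin_of_mem_nhds hs, hK⟩
  obtain ⟨K, hK⟩ := hloc.exists_lipschitzOnWith_of_compact hC
  obtain ⟨H, hH⟩ := hC.exists_bound_of_continuousOn (hh.continuousOn.mono hCU)
  have hcomp : LipschitzWith (K * Lv) fun p => h (v p) := by
    rw [← lipschitzOnWith_univ]
    exact hK.comp (hLv.lipschitzOnWith (s := univ)) fun p _ => hv.mem p
  refine ⟨⟨L * H.toNNReal + B.toNNReal * (K * Lv), LipschitzWith.of_dist_le_mul fun p p' => ?_⟩,
    ?_, ?_⟩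
  · have h1 : κ p • h (v p) - κ p' • h (v p')
        = (κ p - κ p') • h (v p) + κ p' • (h (v p) - h (v p')) := by
      rw [sub_smul, smul_sub]; abel
    rw [dist_eq_norm, h1]
    refine (norm_add_le _ _).trans ?_
    rw [norm_smul, norm_smul, ← dist_eq_norm, ← dist_eq_norm]
    have h2 := hL.dist_le_mul p p'
    have h3 := hcomp.dist_le_mul p p'
    have h4 : ‖h (v p)‖ ≤ H.toNNReal := (hH _ (hv.mem p)).trans (Real.le_coe_toNNReal H)
    have h5 : ‖κ p'‖ ≤ B.toNNReal := (hB p').trans (Real.le_coe_toNNReal B)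
    calc _ ≤ (L * dist p p') * H.toNNReal + B.toNNReal * ((K * Lv : ℝ≥0) * dist p p') :=
          add_le_add (mul_le_mul h2 h4 (norm_nonneg _) (by positivity))
            (mul_le_mul h5 h3 dist_nonneg (NNReal.coe_nonneg _))
      _ = _ := by push_cast; ring
  · obtain ⟨a, b, hb, hab⟩ := hκ.time
    exact ⟨a, b, hb, fun t x ht => by rw [hab t x ht, zero_smul]⟩
  · cases Λ with
    | line =>
      obtain ⟨A, hA⟩ := hκ.space
      exact ⟨A, fun t x hx => by rw [hA t x hx, zero_smul]⟩
    | periodic =>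
      intro t x
      have h1 := hκ.space t x
      have h2 := hv.compatible t x
      simp only at h1 h2 ⊢
      rw [h1, h2]

end Composition

section RelativeEntropy

variable {m : ℕ} {U C : Set (State m)} {f : State m → State m} {η q : State m → ℝ}
  {CF ηlow ηup : ℝ}

/-- The gradient `∇η(z)`, the vector of entropy variables. -/
noncomputable def entropyVariable (η : State m → ℝ) (z : State m) : State m :=
  WithLp.toLp 2 fun i => fderiv ℝ η z (EuclideanSpace.single i 1)

lemma inner_entropyVariable (η : State m → ℝ) (z a : State m) :
    inner ℝ a (entropyVariable η z) = fderiv ℝ η z a := by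
  have h1 : a = ∑ i, a i • EuclideanSpace.single i (1 : ℝ) := by
    have := (EuclideanSpace.basisFun (Fin m) ℝ).sum_repr a
    simpa using this.symm
  conv_rhs => rw [h1]
  simp [entropyVariable, PiLp.inner_apply, mul_comm]

namespace IsConvexEntropySystem

lemma contDiffOn_entropyVariable (h : IsConvexEntropySystem U C f η q CF ηlow ηup) :
    ContDiffOn ℝ 1 (entropyVariable η) U := by
  have h1 : ContDiffOn ℝ 1 (fderiv ℝ η) U := h.entropy.fderiv_of_isOpen h.isOpen (by norm_num)
  refine contDiffOn_euclidean.2 fun i => ?_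
  exact h1.clm_apply contDiffOn_const

lemma contDiffOn_entropy_dual (h : IsConvexEntropySystem U C f η q CF ηlow ηup) :
    ContDiffOn ℝ 1 (fun z => fderiv ℝ η z z - η z) U :=
  ((h.entropy.fderiv_of_isOpen h.isOpen (by norm_num)).clm_apply contDiffOn_id).sub
    (h.entropy.of_le (by norm_num))

lemma contDiffOn_entropyFlux_dual (h : IsConvexEntropySystem U C f η q CF ηlow ηup) :
    ContDiffOn ℝ 1 (fun z => fderiv ℝ η z (f z) - q z) U :=
  ((h.entropy.fderiv_of_isOpen h.isOpen (by norm_num)).clm_apply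
    (h.flux.of_le (by norm_num))).sub (h.entropyFlux.of_le (by norm_num))

end IsConvexEntropySystem

lemma fderiv_smul_comp {V : Type*} [NormedAddCommGroup V] [NormedSpace ℝ V] {κ : ℝ × ℝ → ℝ}
    {v : ℝ × ℝ → State m} {p : ℝ × ℝ} (hκ : DifferentiableAt ℝ κ p)
    (hv : DifferentiableAt ℝ v p) {g : State m → V} {g' : State m →L[ℝ] V}
    (hg : HasFDerivAt g g' (v p)) (e : ℝ × ℝ) :
    fderiv ℝ (fun p => κ p • g (v p)) p e
      = fderiv ℝ κ p e • g (v p) + κ p • g' (fderiv ℝ v p e) := by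
  have h1 : HasFDerivAt (fun p => g (v p)) (g'.comp (fderiv ℝ v p)) p :=
    hg.comp p hv.hasFDerivAt
  have h2 : HasFDerivAt (fun p => κ p • g (v p)) _ p := hκ.hasFDerivAt.smul h1
  rw [h2.fderiv]
  simp [add_comm]

/-- The residual `∂ₜ v + ∂ₓ f(v)` of a space-time function, at the points where it is
differentiable. -/
noncomputable def fieldResidual (f : State m → State m) (v : ℝ × ℝ → State m) (p : ℝ × ℝ) :
    State m :=
  fderiv ℝ v p (1, 0) + fderiv ℝ f (v p) (fderiv ℝ v p (0, 1))

/-- The integrand of the relative entropy inequality for the state `z` and the field `v`, with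
weight `κ`. -/
noncomputable def relativeEntropyDensity (f : State m → State m) (η q : State m → ℝ)
    (v : ℝ × ℝ → State m) (κ : ℝ × ℝ → ℝ) (z : State m) (p : ℝ × ℝ) : ℝ :=
  taylorRemainder η z (v p) * fderiv ℝ κ p (1, 0)
    + (q z - q (v p) - fderiv ℝ η (v p) (f z - f (v p))) * fderiv ℝ κ p (0, 1)
    - κ p * (fderiv ℝ (fderiv ℝ η) (v p) (fieldResidual f v p) (z - v p)
      + fderiv ℝ (fderiv ℝ η) (v p) (fderiv ℝ v p (0, 1)) (taylorRemainder f z (v p)))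

/-- The pointwise identity behind the relative entropy inequality: the integrand of the entropy
inequality, minus that of the weak formulation tested with `κ ∇η(v)`, plus two exact derivatives. -/
lemma relativeEntropy_identity (h : IsConvexEntropySystem U C f η q CF ηlow ηup)
    {κ : ℝ × ℝ → ℝ} {v : ℝ × ℝ → State m} {p : ℝ × ℝ} (hκ : DifferentiableAt ℝ κ p)
    (hv : DifferentiableAt ℝ v p) (hvU : v p ∈ U) (z : State m) :
    (η z * fderiv ℝ κ p (1, 0) + q z * fderiv ℝ κ p (0, 1))
      - (inner ℝ z (fderiv ℝ (fun p => κ p • entropyVariable η (v p)) p (1, 0))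
        + inner ℝ (f z) (fderiv ℝ (fun p => κ p • entropyVariable η (v p)) p (0, 1)))
      + fderiv ℝ (fun p => κ p • (fderiv ℝ η (v p) (v p) - η (v p))) p (1, 0)
      + fderiv ℝ (fun p => κ p • (fderiv ℝ η (v p) (f (v p)) - q (v p))) p (0, 1)
    = relativeEntropyDensity f η q v κ z p := by
  have hη1 := hasFDerivAt_self h.isOpen h.entropy hvU
  have hη2 := hasFDerivAt_fderiv h.isOpen h.entropy hvU
  have hf1 := hasFDerivAt_self h.isOpen h.flux hvU
  have hq1 := hasFDerivAt_self h.isOpen h.entropyFlux hvU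
  have hG : HasFDerivAt (entropyVariable η) (fderiv ℝ (entropyVariable η) (v p)) (v p) :=
    ((h.contDiffOn_entropyVariable.contDiffAt (h.isOpen.mem_nhds hvU)).differentiableAt
      (by simp)).hasFDerivAt
  have hGin : ∀ a b : State m, inner ℝ a (fderiv ℝ (entropyVariable η) (v p) b)
      = fderiv ℝ (fderiv ℝ η) (v p) b a := by
    intro a b
    have h1 := (hasFDerivAt_const a (v p)).inner ℝ hG
    have h2 := hη2.clm_apply (hasFDerivAt_const a (v p))
    simp only [inner_entropyVariable] at h1
    have := DFunLike.congr_fun (h1.unique h2) b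
    simpa using this
  rw [fderiv_smul_comp hκ hv hG, fderiv_smul_comp hκ hv hG,
    fderiv_smul_comp (g := fun z => fderiv ℝ η z z - η z) hκ hv
      ((hη2.clm_apply (hasFDerivAt_id (v p))).sub hη1),
    fderiv_smul_comp (g := fun z => fderiv ℝ η z (f z) - q z) hκ hv
      ((hη2.clm_apply hf1).sub hq1)]
  have hcomp := DFunLike.congr_fun (h.compatible (v p) hvU) (fderiv ℝ v p (0, 1))
  have hs1 := h.fderiv_fderiv_symm hvU (fderiv ℝ f (v p) (fderiv ℝ v p (0, 1))) (z - v p)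
  have hs2 := h.entropy_flux_symm hvU (z - v p) (fderiv ℝ v p (0, 1))
  simp only [inner_add_right, inner_smul_right, hGin, inner_entropyVariable, taylorRemainder,
    fieldResidual, map_add, map_sub, add_apply, sub_apply, ContinuousLinearMap.comp_apply,
    ContinuousLinearMap.flip_apply, smul_eq_mul, ContinuousLinearMap.coe_id', id_eq,
    relativeEntropyDensity] at hcomp hs1 hs2 ⊢
  rw [← hcomp]
  linear_combination (κ p) * hs1 + (κ p) * hs2

variable {Λ : SpatialDomain} {T : ℝ}

/-- Entropy admissible solutions at a fixed parameter, with values in the set of states `C`. -/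
structure IsEntropySolutionIn (Λ : SpatialDomain) (T : ℝ) (C : Set (State m))
    (f : State m → State m) (η q : State m → ℝ) (u₀ : ℝ → State m) (u : ℝ → ℝ → State m) :
    Prop where
  measurable : AEStronglyMeasurable (fun p : ℝ × ℝ => u p.1 p.2) (spaceTimeMeasure Λ T)
  mem : ∀ᵐ p ∂(spaceTimeMeasure Λ T), u p.1 p.2 ∈ C
  measurable_initial : AEStronglyMeasurable u₀ (volume.restrict Λ.cell)
  mem_initial : ∀ᵐ x ∂(volume.restrict Λ.cell), u₀ x ∈ C
  weak : IsWeakSolution Λ T f u₀ u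
  entropy : SatisfiesEntropyInequality Λ T η q u₀ u

/-- The relative entropy inequality between an entropy admissible solution and a Lipschitz
field: the entropy inequality with test function `κ`, minus the weak formulation with test function
`κ ∇η(v)`, which is merely Lipschitz. -/
lemma relativeEntropy_inequality (h : IsConvexEntropySystem U C f η q CF ηlow ηup)
    {u₀ : ℝ → State m} {u : ℝ → ℝ → State m} (hu : IsEntropySolutionIn Λ T C f η q u₀ u)
    (hT : 0 < T) {v : ℝ × ℝ → State m} (hv : IsLipschitzField Λ C v)
    {κ : ℝ × ℝ → ℝ} (hκ : IsLipschitzTest Λ T κ) (hκ0 : ∀ p, 0 ≤ κ p) :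
    Integrable (fun p : ℝ × ℝ => relativeEntropyDensity f η q v κ (u p.1 p.2) p)
      (spaceTimeMeasure Λ T) ∧
    - ∫ x in Λ.cell, taylorRemainder η (u₀ x) (v (0, x)) * κ (0, x) ≤
      ∫ p, relativeEntropyDensity f η q v κ (u p.1 p.2) p ∂(spaceTimeMeasure Λ T) := by
  obtain ⟨Lκ, hLκ⟩ := hκ.lipschitz
  obtain ⟨Lv, hLv⟩ := hv.lipschitz
  have hcf := h.flux.continuousOn.mono h.subset
  have hcη := h.entropy.continuousOn.mono h.subset
  have hcq := h.entropyFlux.continuousOn.mono h.subset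
  obtain ⟨M₁, hM₁⟩ := h.isCompact.exists_bound_of_continuousOn (f := fun z : State m => z)
    continuousOn_id
  obtain ⟨M₂, hM₂⟩ := h.isCompact.exists_bound_of_continuousOn hcf
  obtain ⟨M₃, hM₃⟩ := h.isCompact.exists_bound_of_continuousOn hcη
  obtain ⟨M₄, hM₄⟩ := h.isCompact.exists_bound_of_continuousOn hcq
  set M := max (max M₁ M₂) (max M₃ M₄)
  have hW := hκ.smul_comp h.isOpen h.isCompact h.subset h.contDiffOn_entropyVariable hv
  have hΨ₁ := hκ.smul_comp h.isOpen h.isCompact h.subset h.contDiffOn_entropy_dual hv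
  have hΨ₂ := hκ.smul_comp h.isOpen h.isCompact h.subset h.contDiffOn_entropyFlux_dual hv
  have hmf := aestronglyMeasurable_comp_of_continuousOn h.isCompact.isClosed hcf
    hu.measurable hu.mem
  have hmη := aestronglyMeasurable_comp_of_continuousOn h.isCompact.isClosed hcη
    hu.measurable hu.mem
  have hmq := aestronglyMeasurable_comp_of_continuousOn h.isCompact.isClosed hcq
    hu.measurable hu.mem
  have hmη₀ := aestronglyMeasurable_comp_of_continuousOn h.isCompact.isClosed hcη
    hu.measurable_initial hu.mem_initial
  have b₁ : ∀ᵐ p ∂(spaceTimeMeasure Λ T), ‖u p.1 p.2‖ ≤ M := hu.mem.mono fun p hp =>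
    (hM₁ _ hp).trans ((le_max_left _ _).trans (le_max_left _ _))
  have b₂ : ∀ᵐ p ∂(spaceTimeMeasure Λ T), ‖f (u p.1 p.2)‖ ≤ M := hu.mem.mono fun p hp =>
    (hM₂ _ hp).trans ((le_max_right _ _).trans (le_max_left _ _))
  have b₃ : ∀ᵐ p ∂(spaceTimeMeasure Λ T), ‖η (u p.1 p.2)‖ ≤ M := hu.mem.mono fun p hp =>
    (hM₃ _ hp).trans ((le_max_left _ _).trans (le_max_right _ _))
  have b₄ : ∀ᵐ p ∂(spaceTimeMeasure Λ T), ‖q (u p.1 p.2)‖ ≤ M := hu.mem.mono fun p hp =>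
    (hM₄ _ hp).trans ((le_max_right _ _).trans (le_max_right _ _))
  have b₅ : ∀ᵐ x ∂(volume.restrict Λ.cell), ‖u₀ x‖ ≤ M := hu.mem_initial.mono fun p hp =>
    (hM₁ _ hp).trans ((le_max_left _ _).trans (le_max_left _ _))
  have b₆ : ∀ᵐ x ∂(volume.restrict Λ.cell), ‖η (u₀ x)‖ ≤ M := hu.mem_initial.mono fun p hp =>
    (hM₃ _ hp).trans ((le_max_left _ _).trans (le_max_right _ _))
  -- the entropy inequality, the weak formulation and the integrals of the two exact derivatives
  have e1 := hu.entropy.le_integral_lipschitz hκ hκ0 hmη hmq b₃ b₄ hmη₀ b₆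
  have e2 := hu.weak.integral_lipschitz hW hu.measurable hmf b₁ b₂ hu.measurable_initial b₅
  have e3 := hΨ₁.integral_fderiv_time hT
  have e4 := hΨ₂.integral_fderiv_space
  have i1 : Integrable (fun p : ℝ × ℝ => η (u p.1 p.2) * fderiv ℝ κ p (1, 0)
      + q (u p.1 p.2) * fderiv ℝ κ p (0, 1)) (spaceTimeMeasure Λ T) :=
    (hκ.integrable_mul_fderiv hmη b₃ (1, 0)).add (hκ.integrable_mul_fderiv hmq b₄ (0, 1))
  have i2 : Integrable (fun p : ℝ × ℝ =>
      inner ℝ (u p.1 p.2) (fderiv ℝ (fun p => κ p • entropyVariable η (v p)) p (1, 0))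
        + inner ℝ (f (u p.1 p.2)) (fderiv ℝ (fun p => κ p • entropyVariable η (v p)) p (0, 1)))
      (spaceTimeMeasure Λ T) :=
    (hW.integrable_inner_fderiv hu.measurable b₁ (1, 0)).add
      (hW.integrable_inner_fderiv hmf b₂ (0, 1))
  have i3 := hΨ₁.integrable_fderiv (1, 0)
  have i4 := hΨ₂.integrable_fderiv (0, 1)
  have i12 := i1.sub i2
  have i123 := i12.add i3
  simp only [Pi.sub_def, Pi.add_def] at i12 i123
  have hae : (fun p : ℝ × ℝ => relativeEntropyDensity f η q v κ (u p.1 p.2) p)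
      =ᵐ[spaceTimeMeasure Λ T]
      fun p => (η (u p.1 p.2) * fderiv ℝ κ p (1, 0) + q (u p.1 p.2) * fderiv ℝ κ p (0, 1))
      - (inner ℝ (u p.1 p.2) (fderiv ℝ (fun p => κ p • entropyVariable η (v p)) p (1, 0))
        + inner ℝ (f (u p.1 p.2)) (fderiv ℝ (fun p => κ p • entropyVariable η (v p)) p (0, 1)))
      + fderiv ℝ (fun p => κ p • (fderiv ℝ η (v p) (v p) - η (v p))) p (1, 0)
      + fderiv ℝ (fun p => κ p • (fderiv ℝ η (v p) (f (v p)) - q (v p))) p (0, 1) := by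
    filter_upwards [ae_spaceTimeMeasure_of_ae hLκ.ae_differentiableAt,
      ae_spaceTimeMeasure_of_ae hLv.ae_differentiableAt] with p h1 h2
    exact (relativeEntropy_identity h h1 h2 (h.subset (hv.mem p)) (u p.1 p.2)).symm
  refine ⟨(i123.add i4).congr hae.symm, ?_⟩
  rw [integral_congr_ae hae, integral_add i123 i4, integral_add i12 i3,
    integral_sub i1 i2, e2, e3, e4]
  have j1 := hκ.integrable_mul_initial hmη₀ b₆ 0
  have j2 := hW.integrable_inner_initial hu.measurable_initial b₅ 0
  have j3 : Integrable (fun x => κ (0, x) • (fderiv ℝ η (v (0, x)) (v (0, x)) - η (v (0, x))))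
      (volume.restrict Λ.cell) := by
    simpa using hΨ₁.integrable_mul_initial (c := fun _ => 1) (M := 1) aestronglyMeasurable_const
      (by simp) 0
  have j12 := j1.sub j2
  simp only [Pi.sub_def] at j12
  have e5 : ∫ x in Λ.cell, taylorRemainder η (u₀ x) (v (0, x)) * κ (0, x)
      = ∫ x in Λ.cell, (η (u₀ x) * κ (0, x)
        - inner ℝ (u₀ x) (κ (0, x) • entropyVariable η (v (0, x)))
        + κ (0, x) • (fderiv ℝ η (v (0, x)) (v (0, x)) - η (v (0, x)))) := by
    refine integral_congr_ae (Eventually.of_forall fun x => ?_)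
    simp only [taylorRemainder, inner_smul_right, inner_entropyVariable, map_sub, smul_eq_mul]
    ring
  rw [e5, integral_add j12 j3, integral_sub j1 j2]
  linarith

end RelativeEntropy

/-! ### Weights in space and time -/

section Weights

/-- The spatial weight: `1` in the periodic case, and on the line a Lipschitz approximation of the
indicator function of the cone `|x| + c t < R`. -/
noncomputable def coneWeight : SpatialDomain → ℝ → ℝ → ℝ × ℝ → ℝ
  | .line, c, R => fun p => max 0 (min 1 (R - c * p.1 - |p.2|))
  | .periodic, _, _ => fun _ => 1

lemma coneWeight_nonneg (Λ : SpatialDomain) (c R : ℝ) (p : ℝ × ℝ) : 0 ≤ coneWeight Λ c R p := by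
  cases Λ <;> simp [coneWeight]

lemma coneWeight_le_one (Λ : SpatialDomain) (c R : ℝ) (p : ℝ × ℝ) : coneWeight Λ c R p ≤ 1 := by
  cases Λ <;> simp [coneWeight]

lemma coneWeight_mono (Λ : SpatialDomain) (c : ℝ) (p : ℝ × ℝ) :
    Monotone fun R => coneWeight Λ c R p := by
  intro R R' h
  cases Λ
  · simp only [coneWeight]
    gcongr
  · simp [coneWeight]

lemma coneWeight_eq_one (Λ : SpatialDomain) (c : ℝ) (p : ℝ × ℝ) {R : ℝ}
    (hR : 1 + c * p.1 + |p.2| ≤ R) : coneWeight Λ c R p = 1 := by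
  cases Λ
  · simp only [coneWeight]
    rw [min_eq_left (by linarith)]
    simp
  · simp [coneWeight]

lemma exists_lipschitzWith_coneWeight (Λ : SpatialDomain) (c R : ℝ) :
    ∃ L : ℝ≥0, LipschitzWith L (coneWeight Λ c R) := by
  cases Λ
  · have h1 : LipschitzWith (|c|.toNNReal + 1) fun p : ℝ × ℝ => R - c * p.1 - |p.2| := by
      refine LipschitzWith.of_dist_le_mul fun p p' => ?_
      have h2 : dist p.1 p'.1 ≤ dist p p' := le_max_left _ _
      have h3 : dist p.2 p'.2 ≤ dist p p' := le_max_right _ _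
      rw [Real.dist_eq] at h2 h3 ⊢
      have h4 : R - c * p.1 - |p.2| - (R - c * p'.1 - |p'.2|)
          = -(c * (p.1 - p'.1)) - (|p.2| - |p'.2|) := by ring
      rw [h4]
      refine (abs_sub _ _).trans ?_
      rw [abs_neg, abs_mul]
      push_cast
      rw [Real.coe_toNNReal _ (abs_nonneg c), add_mul, one_mul]
      exact add_le_add (mul_le_mul_of_nonneg_left h2 (abs_nonneg c))
        ((abs_abs_sub_abs_le _ _).trans h3)
    exact ⟨_, (LipschitzWith.const (0 : ℝ)).max ((LipschitzWith.const (1 : ℝ)).min h1)⟩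
  · exact ⟨0, LipschitzWith.const 1⟩

/-- The weight decreases along all directions that are not faster than `c`. -/
lemma fderiv_coneWeight_le {Λ : SpatialDomain} {c R : ℝ} (hc : 0 ≤ c) {p : ℝ × ℝ}
    (hp : DifferentiableAt ℝ (coneWeight Λ c R) p) :
    fderiv ℝ (coneWeight Λ c R) p (1, 0) + c * |fderiv ℝ (coneWeight Λ c R) p (0, 1)| ≤ 0 := by
  cases Λ with
  | periodic =>
    have : coneWeight .periodic c R = fun _ => 1 := rfl
    simp [this]
  | line =>
    have key : ∀ ε : ℝ, |ε| = 1 → fderiv ℝ (coneWeight .line c R) p (1, 0)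
        - c * ε * fderiv ℝ (coneWeight .line c R) p (0, 1) ≤ 0 := by
      intro ε hε
      have d1 : HasDerivAt (fun h : ℝ => coneWeight .line c R (p + h • (1, 0)))
          (fderiv ℝ (coneWeight .line c R) p (1, 0)) 0 := hp.hasFDerivAt.hasLineDerivAt _
      have d2 : HasDerivAt (fun h : ℝ => coneWeight .line c R (p + h • (0, c * ε)))
          (fderiv ℝ (coneWeight .line c R) p (0, c * ε)) 0 := hp.hasFDerivAt.hasLineDerivAt _
      have d3 := (d1.sub d2).tendsto_slope_zero_right
      have h4 : fderiv ℝ (coneWeight .line c R) p (0, c * ε)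
          = c * ε * fderiv ℝ (coneWeight .line c R) p (0, 1) := by
        simpa using (fderiv ℝ (coneWeight .line c R) p).map_smul (c * ε) (0, 1)
      rw [h4] at d3
      refine le_of_tendsto d3 ?_
      filter_upwards [self_mem_nhdsWithin] with h hh
      have hh' : (0 : ℝ) < h := hh
      refine smul_nonpos_of_nonneg_of_nonpos (inv_nonneg.2 hh'.le) ?_
      simp only [coneWeight, Pi.sub_apply, zero_add, zero_mul, add_zero, sub_self, sub_zero,
        Prod.fst_add, Prod.snd_add, Prod.smul_fst, Prod.smul_snd, smul_eq_mul, mul_one, mul_zero]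
      rw [sub_nonpos]
      have h5 : |p.2 + h * (c * ε)| ≤ |p.2| + c * h := by
        refine (abs_add_le _ _).trans (le_of_eq ?_)
        rw [abs_mul, abs_mul, hε, abs_of_pos hh', abs_of_nonneg hc]; ring
      refine max_le_max le_rfl (min_le_min le_rfl ?_)
      nlinarith
    have h1 := key 1 (by simp)
    have h2 := key (-1) (by simp)
    rcases abs_cases (fderiv ℝ (coneWeight .line c R) p (0, 1)) with ⟨h, -⟩ | ⟨h, -⟩ <;> rw [h] <;>
      linarith

/-- A Lipschitz function of time that is `1` on `[0,s]`, vanishes outside of `[-1,s+h]` and is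
affine on `[s,s+h]`. -/
noncomputable def timeCutoff (s h t : ℝ) : ℝ := max 0 (min (1 + t) (min 1 ((s + h - t) / h)))

variable {s h : ℝ}

lemma timeCutoff_nonneg (t : ℝ) : 0 ≤ timeCutoff s h t := le_max_left _ _

lemma timeCutoff_le_one (t : ℝ) : timeCutoff s h t ≤ 1 :=
  max_le zero_le_one ((min_le_right _ _).trans (min_le_left _ _))

lemma timeCutoff_eq_zero (hh : 0 < h) {t : ℝ} (ht : t ∉ Icc (-1) (s + h)) :
    timeCutoff s h t = 0 := by
  refine max_eq_left ?_
  by_cases h1 : t < -1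
  · exact (min_le_left _ _).trans (by linarith)
  · refine (min_le_right _ _).trans ((min_le_right _ _).trans
      (div_nonpos_of_nonpos_of_nonneg ?_ hh.le))
    by_contra h2
    exact ht ⟨not_lt.1 h1, by linarith⟩

lemma timeCutoff_eq_one (hh : 0 < h) {t : ℝ} (ht : t ∈ Icc 0 s) : timeCutoff s h t = 1 := by
  have h1 : 1 ≤ (s + h - t) / h := by
    rw [le_div_iff₀ hh]; linarith [ht.2]
  rw [timeCutoff, min_eq_left h1, min_eq_right (by linarith [ht.1])]
  simp

lemma timeCutoff_eq_div (hh : 0 < h) {t : ℝ} (ht0 : 0 ≤ t) (ht : t ∈ Icc s (s + h)) :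
    timeCutoff s h t = (s + h - t) / h := by
  have h1 : (s + h - t) / h ≤ 1 := by
    rw [div_le_iff₀ hh]; linarith [ht.1]
  have h2 : 0 ≤ (s + h - t) / h := div_nonneg (by linarith [ht.2]) hh.le
  rw [timeCutoff, min_eq_right h1, min_eq_right (by linarith), max_eq_right h2]

lemma hasDerivAt_timeCutoff_of_lt (hh : 0 < h) {t : ℝ} (ht : t ∈ Ioo 0 s) :
    HasDerivAt (timeCutoff s h) 0 t := by
  refine (hasDerivAt_const t (1 : ℝ)).congr_of_eventuallyEq ?_
  filter_upwards [Ioo_mem_nhds ht.1 ht.2] with t' ht'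
  exact timeCutoff_eq_one hh (Ioo_subset_Icc_self ht')

lemma hasDerivAt_timeCutoff_of_mem (hs : 0 < s) (hh : 0 < h) {t : ℝ} (ht : t ∈ Ioo s (s + h)) :
    HasDerivAt (timeCutoff s h) (-(1 / h)) t := by
  have h1 : HasDerivAt (fun t => (s + h - t) / h) (-(1 / h)) t := by
    have := ((hasDerivAt_id t).const_sub (s + h)).div_const h
    refine this.congr_deriv ?_
    ring
  refine h1.congr_of_eventuallyEq ?_
  filter_upwards [Ioo_mem_nhds ht.1 ht.2] with t' ht'
  exact timeCutoff_eq_div hh (hs.le.trans ht'.1.le) (Ioo_subset_Icc_self ht')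

lemma hasDerivAt_timeCutoff_of_gt (hh : 0 < h) {t : ℝ} (ht : s + h < t) :
    HasDerivAt (timeCutoff s h) 0 t := by
  refine (hasDerivAt_const t (0 : ℝ)).congr_of_eventuallyEq ?_
  filter_upwards [Ioi_mem_nhds ht] with t' ht'
  exact timeCutoff_eq_zero hh fun h1 => not_lt.2 h1.2 ht'

lemma exists_lipschitzWith_timeCutoff (hh : 0 < h) :
    ∃ L : ℝ≥0, LipschitzWith L (timeCutoff s h) := by
  have h1 : LipschitzWith 1 fun t : ℝ => 1 + t := by
    refine LipschitzWith.of_dist_le_mul fun t t' => ?_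
    simp [Real.dist_eq]
  have h2 : LipschitzWith (1 / h).toNNReal fun t : ℝ => (s + h - t) / h := by
    refine LipschitzWith.of_dist_le_mul fun t t' => ?_
    rw [Real.dist_eq, Real.dist_eq, Real.coe_toNNReal _ (by positivity), ← sub_div, abs_div,
      abs_of_pos hh, show s + h - t - (s + h - t') = -(t - t') by ring, abs_neg]
    exact le_of_eq (by ring)
  exact ⟨_, (LipschitzWith.const (0 : ℝ)).max (h1.min ((LipschitzWith.const (1 : ℝ)).min h2))⟩

/-- The product of the cut-off in time and of the spatial weight is a test function. -/
lemma isLipschitzTest_timeCutoff_mul_coneWeight (Λ : SpatialDomain) {T c : ℝ} (hc : 0 ≤ c) (R : ℝ)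
    (hh : 0 < h) (hT : s + h < T) :
    IsLipschitzTest Λ T fun p => timeCutoff s h p.1 * coneWeight Λ c R p := by
  obtain ⟨L₁, hL₁⟩ := exists_lipschitzWith_timeCutoff (s := s) hh
  obtain ⟨L₂, hL₂⟩ := exists_lipschitzWith_coneWeight Λ c R
  refine ⟨⟨L₁ + L₂, LipschitzWith.of_dist_le_mul fun p p' => ?_⟩,
    ⟨-1, s + h, hT, fun t x ht => by simp [timeCutoff_eq_zero hh ht]⟩, ?_⟩
  · have h1 := hL₁.dist_le_mul p.1 p'.1
    have h2 := hL₂.dist_le_mul p p'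
    have h3 : dist p.1 p'.1 ≤ dist p p' := le_max_left _ _
    rw [Real.dist_eq] at h1 h2 ⊢
    have h4 : timeCutoff s h p.1 * coneWeight Λ c R p - timeCutoff s h p'.1 * coneWeight Λ c R p'
        = (timeCutoff s h p.1 - timeCutoff s h p'.1) * coneWeight Λ c R p
          + timeCutoff s h p'.1 * (coneWeight Λ c R p - coneWeight Λ c R p') := by ring
    rw [h4]
    refine (abs_add_le _ _).trans ?_
    rw [abs_mul, abs_mul, abs_of_nonneg (coneWeight_nonneg Λ c R p),
      abs_of_nonneg (timeCutoff_nonneg p'.1)]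
    push_cast
    rw [add_mul]
    refine add_le_add ?_ ?_
    · refine (mul_le_of_le_one_right (abs_nonneg _) (coneWeight_le_one Λ c R p)).trans
        (h1.trans (mul_le_mul_of_nonneg_left h3 L₁.2))
    · exact (mul_le_of_le_one_left (abs_nonneg _) (timeCutoff_le_one _)).trans h2
  · cases Λ with
    | line =>
      refine ⟨|R| + c, fun t x hx => ?_⟩
      by_cases ht : t < -1
      · rw [timeCutoff_eq_zero hh (fun h1 => by linarith [h1.1]), zero_mul]
      · have h1 : R - c * t - |x| ≤ 0 := by
          have := le_abs_self R
          nlinarith [not_lt.1 ht]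
        have : coneWeight .line c R (t, x) = 0 := by
          simp only [coneWeight]
          exact max_eq_left ((min_le_right _ _).trans h1)
        rw [this, mul_zero]
    | periodic =>
      intro t x
      simp [coneWeight]

end Weights

/-! ### A Gronwall inequality for integrable functions -/

section Gronwall

lemma lipschitzOnWith_exp_neg {D : Set ℝ} {g : ℝ → ℝ} {L : ℝ≥0} (hg : LipschitzOnWith L g D)
    (h0 : ∀ t ∈ D, 0 ≤ g t) : LipschitzOnWith L (fun t => Real.exp (-g t)) D := by
  have h1 : LipschitzOnWith 1 Real.exp (Iic 0) := by
    refine Convex.lipschitzOnWith_of_nnnorm_deriv_le (fun x _ => Real.differentiableAt_exp)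
      (fun x hx => ?_) (convex_Iic 0)
    rw [← NNReal.coe_le_coe]
    simpa using hx
  have h2 := h1.comp hg.neg (fun t ht => by simpa using h0 t ht)
  simpa [Function.comp_def] using h2

/-- Gronwall's inequality for an integrable function that satisfies the integral inequality
almost everywhere. -/
lemma gronwall_of_ae {d γ : ℝ → ℝ} {A G s : ℝ} (hs : 0 ≤ s) (hd : IntervalIntegrable d volume 0 s)
    (hγm : Measurable γ) (hγ0 : ∀ t, 0 ≤ γ t) (hγG : ∀ t, γ t ≤ G)
    (h : ∀ᵐ t, t ∈ Ioo 0 s → d t ≤ A + ∫ r in 0..t, γ r * d r) :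
    A + ∫ r in 0..s, γ r * d r ≤ A * Real.exp (∫ r in 0..s, γ r) := by
  have hG : 0 ≤ G := (hγ0 0).trans (hγG 0)
  have hγi : ∀ a b, IntervalIntegrable γ volume a b := fun a b =>
    (intervalIntegrable_const (c := G)).mono_fun hγm.aestronglyMeasurable
      (Eventually.of_forall fun t => by
        simpa [abs_of_nonneg (hγ0 t), abs_of_nonneg hG] using hγG t)
  have hγd : IntervalIntegrable (fun r => γ r * d r) volume 0 s := by
    refine (hd.norm.const_mul G).mono_fun
      (hγm.aestronglyMeasurable.mul hd.aestronglyMeasurable_restrict_uIoc)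
      (Eventually.of_forall fun t => ?_)
    simp only [norm_mul, Real.norm_eq_abs, abs_of_nonneg (hγ0 t), abs_abs, abs_of_nonneg hG]
    exact mul_le_mul_of_nonneg_right (hγG t) (abs_nonneg _)
  set Γ : ℝ → ℝ := fun t => ∫ r in 0..t, γ r with hΓ
  set H : ℝ → ℝ := fun t => ∫ r in 0..t, γ r * d r with hH
  have hΓL : LipschitzOnWith G.toNNReal Γ (uIcc 0 s) := by
    refine LipschitzWith.lipschitzOnWith (LipschitzWith.of_dist_le_mul fun t t' => ?_)
    rw [Real.dist_eq, hΓ]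
    simp only
    rw [intervalIntegral.integral_interval_sub_left (hγi _ _) (hγi _ _), Real.coe_toNNReal _ hG,
      Real.dist_eq]
    refine intervalIntegral.norm_integral_le_of_norm_le_const (f := γ) fun r _ => ?_
    rw [Real.norm_eq_abs, abs_of_nonneg (hγ0 r)]
    exact hγG r
  have hΓ0 : ∀ t ∈ uIcc 0 s, 0 ≤ Γ t := fun t ht => by
    rw [uIcc_of_le hs] at ht
    exact intervalIntegral.integral_nonneg ht.1 fun r _ => hγ0 r
  have hE : AbsolutelyContinuousOnInterval (fun t => Real.exp (-Γ t)) 0 s :=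
    (lipschitzOnWith_exp_neg hΓL hΓ0).absolutelyContinuousOnInterval
  have hHac : AbsolutelyContinuousOnInterval H 0 s :=
    hγd.absolutelyContinuousOnInterval_intervalIntegral (by simp)
  have hAH : AbsolutelyContinuousOnInterval (fun t => A + H t) 0 s :=
    ((LipschitzWith.const A).lipschitzOnWith.absolutelyContinuousOnInterval).add hHac
  -- `(A + H) exp(-Γ)` is absolutely continuous and its derivative is nonpositive almost everywhere
  have hP := hAH.fun_mul hE
  have h1 := hP.integral_deriv_eq_sub
  have h2 : ∫ t in 0..s, deriv (fun t => (A + H t) * Real.exp (-Γ t)) t ≤ ∫ t in 0..s, (0 : ℝ) := by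
    refine intervalIntegral.integral_mono_ae_restrict hs hP.intervalIntegrable_deriv
      intervalIntegrable_const ?_
    rw [Filter.EventuallyLE, ae_restrict_iff' measurableSet_Icc]
    filter_upwards [h, compl_mem_ae_iff.2 (measure_singleton (0 : ℝ)),
      compl_mem_ae_iff.2 (measure_singleton s), hγd.ae_hasDerivAt_integral,
      (hγi 0 s).ae_hasDerivAt_integral] with t ht hn1 hn2 dH dΓ hts
    have hu : t ∈ uIcc 0 s := by rwa [uIcc_of_le hs]
    have e1 : HasDerivAt H (γ t * d t) t := dH hu 0 (by simp)
    have e2 : HasDerivAt Γ (γ t) t := dΓ hu 0 (by simp)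
    have e3 := ((e1.const_add A).mul e2.neg.exp).deriv
    have e4 := ht ⟨lt_of_le_of_ne hts.1 (Ne.symm hn1), lt_of_le_of_ne hts.2 hn2⟩
    have e5 : deriv (fun t => (A + H t) * Real.exp (-Γ t)) t
        = γ t * Real.exp (-Γ t) * (d t - (A + H t)) := by
      refine e3.trans ?_
      simp only [Pi.neg_apply]
      ring
    rw [e5]
    exact mul_nonpos_of_nonneg_of_nonpos (mul_nonneg (hγ0 t) (Real.exp_nonneg _)) (by linarith)
  rw [h1] at h2
  have hH0 : H 0 = 0 := by simp [hH]
  have hΓ00 : Γ 0 = 0 := by simp [hΓ]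
  simp only [hH0, hΓ00, intervalIntegral.integral_zero, neg_zero, Real.exp_zero, add_zero,
    mul_one, Real.exp_neg] at h2
  have h3 := Real.exp_pos (Γ s)
  rw [sub_nonpos, ← div_eq_mul_inv, div_le_iff₀ h3] at h2
  exact h2

/-- Passage from an inequality for the averages over short time intervals to an inequality
almost everywhere, by Lebesgue's differentiation theorem. -/
lemma ae_le_of_average_le {a β : ℝ → ℝ} {a₀ T : ℝ} (ha : IntegrableOn a (Ioo 0 T))
    (hβ : IntegrableOn β (Ioo 0 T))
    (h : ∀ s δ, 0 < s → 0 < δ → s + δ < T →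
      1 / δ * ∫ t in s..(s + δ), a t ≤ a₀ + ∫ t in 0..(s + δ), β t) :
    ∀ᵐ s, s ∈ Ioo 0 T → a s ≤ a₀ + ∫ t in 0..s, β t := by
  have hint : ∀ {g : ℝ → ℝ}, IntegrableOn g (Ioo 0 T) → ∀ {x y}, 0 ≤ x → 0 ≤ y → x < T → y < T →
      IntervalIntegrable g volume x y := by
    intro g hg x y hx hy hxT hyT
    rw [intervalIntegrable_iff]
    refine ((integrableOn_Icc_iff_integrableOn_Ioo (by simp) (by simp)).2 hg).mono_set
      fun z hz => ?_
    rcases mem_uIoc.1 hz with hz | hz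
    · exact ⟨hx.trans hz.1.le, hz.2.trans hyT.le⟩
    · exact ⟨hy.trans hz.1.le, hz.2.trans hxT.le⟩
  have ha' : LocallyIntegrable ((Ioo 0 T).indicator a) :=
    ((integrable_indicator_iff measurableSet_Ioo).2 ha).locallyIntegrable
  have hβ' : LocallyIntegrable ((Ioo 0 T).indicator β) :=
    ((integrable_indicator_iff measurableSet_Ioo).2 hβ).locallyIntegrable
  filter_upwards [LocallyIntegrable.ae_hasDerivAt_integral ha',
    LocallyIntegrable.ae_hasDerivAt_integral hβ'] with s hs hsβ hsT
  have heq : ∀ {g : ℝ → ℝ} {x y : ℝ}, 0 ≤ x → x ≤ y → y < T →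
      ∫ t in x..y, (Ioo 0 T).indicator g t = ∫ t in x..y, g t := by
    intro g x y hx hxy hy
    rw [intervalIntegral.integral_of_le hxy, intervalIntegral.integral_of_le hxy]
    refine setIntegral_congr_fun measurableSet_Ioc fun z hz => ?_
    exact indicator_of_mem (s := Ioo 0 T) ⟨hx.trans_lt hz.1, hz.2.trans_lt hy⟩ _
  have h1 := (hs s).tendsto_slope_zero_right
  have h2 : Tendsto (fun δ => ∫ t in 0..(s + δ), (Ioo 0 T).indicator β t) (𝓝[>] 0)
      (𝓝 (∫ t in 0..s, (Ioo 0 T).indicator β t)) := by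
    have hc := (hsβ 0).continuousAt
    have : Tendsto (fun δ : ℝ => s + δ) (𝓝[>] 0) (𝓝 s) := by
      have : Tendsto (fun δ : ℝ => s + δ) (𝓝 0) (𝓝 (s + 0)) :=
        (continuous_const.add continuous_id).tendsto 0
      rw [add_zero] at this
      exact this.mono_left nhdsWithin_le_nhds
    exact hc.tendsto.comp this
  rw [heq le_rfl hsT.1.le hsT.2] at h2
  rw [indicator_of_mem hsT] at h1
  refine le_of_tendsto_of_tendsto h1 (h2.const_add a₀) ?_
  have hsmall : ∀ᶠ δ in 𝓝[>] (0 : ℝ), δ < T - s :=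
    nhdsWithin_le_nhds (eventually_lt_nhds (by linarith [hsT.2]))
  filter_upwards [self_mem_nhdsWithin, hsmall] with δ hδ hδT
  have hδ' : (0 : ℝ) < δ := hδ
  have h3 := h s δ hsT.1 hδ' (by linarith)
  rw [heq hsT.1.le (by linarith) (by linarith), heq le_rfl (by linarith [hsT.1]) (by linarith)]
  simpa using h3

end Gronwall

/-! ### Stability at almost every time -/

section Stability

variable {m : ℕ} {U C : Set (State m)} {f : State m → State m} {η q : State m → ℝ}
  {CF ηlow ηup : ℝ} {Λ : SpatialDomain} {T : ℝ} {u₀ : ℝ → State m} {u : ℝ → ℝ → State m}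
  {v : ℝ × ℝ → State m}

lemma IsLipschitzField.continuous (hv : IsLipschitzField Λ C v) : Continuous v := by
  obtain ⟨L, hL⟩ := hv.lipschitz
  exact hL.continuous

namespace IsConvexEntropySystem

lemma continuous_comp_field {V : Type*} [NormedAddCommGroup V] {g : State m → V}
    (hg : ContinuousOn g C) (hv : IsLipschitzField Λ C v) : Continuous fun p => g (v p) :=
  hg.comp_continuous hv.continuous hv.mem

lemma continuousOn_fderiv {V : Type*} [NormedAddCommGroup V] [NormedSpace ℝ V] {g : State m → V}
    (h : IsConvexEntropySystem U C f η q CF ηlow ηup) (hg : ContDiffOn ℝ 2 g U) :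
    ContinuousOn (fderiv ℝ g) C := fun _ hz =>
  (hasFDerivAt_fderiv h.isOpen hg (h.subset hz)).continuousAt.continuousWithinAt

lemma measurable_fieldResidual (h : IsConvexEntropySystem U C f η q CF ηlow ηup)
    (hv : IsLipschitzField Λ C v) : Measurable (fieldResidual f v) := by
  have h1 : Measurable fun p => fderiv ℝ f (v p) :=
    (continuous_comp_field (h.continuousOn_fderiv h.flux) hv).measurable
  have h2 : Measurable fun p => fderiv ℝ v p (0, 1) := measurable_fderiv_apply_const ℝ v _
  have h3 : Continuous fun x : (State m →L[ℝ] State m) × State m => x.1 x.2 :=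
    isBoundedBilinearMap_apply.continuous
  exact (measurable_fderiv_apply_const ℝ v _).add (h3.measurable2 h1 h2)

lemma exists_norm_fieldResidual_le (h : IsConvexEntropySystem U C f η q CF ηlow ηup)
    (hv : IsLipschitzField Λ C v) : ∃ M : ℝ, ∀ p, ‖fieldResidual f v p‖ ≤ M := by
  obtain ⟨L, hL⟩ := hv.lipschitz
  obtain ⟨M, hM⟩ := h.isCompact.exists_bound_of_continuousOn (f := fderiv ℝ f)
    (h.continuousOn_fderiv h.flux)
  refine ⟨L + M * L, fun p => (norm_add_le _ _).trans (add_le_add ?_ ?_)⟩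
  · exact IsLipschitzTest.norm_fderiv_apply_le hL p _ (by simp [Prod.norm_def])
  · exact ((fderiv ℝ f (v p)).le_opNorm _).trans (mul_le_mul (hM _ (hv.mem p))
      (IsLipschitzTest.norm_fderiv_apply_le hL p _ (by simp [Prod.norm_def])) (norm_nonneg _)
      ((norm_nonneg _).trans (hM _ (hv.mem p))))

lemma exists_norm_sub_le (h : IsConvexEntropySystem U C f η q CF ηlow ηup) :
    ∃ M : ℝ, ∀ z ∈ C, ∀ z₀ ∈ C, ‖z - z₀‖ ≤ M := by
  obtain ⟨M, hM⟩ := h.isCompact.isBounded.exists_norm_le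
  exact ⟨M + M, fun z hz z₀ hz₀ => (norm_sub_le _ _).trans (add_le_add (hM z hz) (hM z₀ hz₀))⟩

/-- Upper bound for the integrand of the relative entropy inequality. The terms with derivatives of
the spatial weight are absorbed because the weight decreases along all directions of speed at
most `c`, and `c` bounds the ratio of the relative entropy flux and the relative entropy. -/
lemma relativeEntropyDensity_le (h : IsConvexEntropySystem U C f η q CF ηlow ηup)
    {θ χ : ℝ × ℝ → ℝ} {p : ℝ × ℝ} {θ' c ℓ : ℝ} {z : State m} (hz : z ∈ C) (hvp : v p ∈ C)
    (hθ : HasDerivAt (fun t => θ (t, p.2)) θ' p.1) (hθx : ∀ t x y, θ (t, x) = θ (t, y))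
    (hθd : DifferentiableAt ℝ θ p) (hθ0 : 0 ≤ θ p)
    (hχ : DifferentiableAt ℝ χ p) (hχ0 : 0 ≤ χ p)
    (hχc : fderiv ℝ χ p (1, 0) + c * |fderiv ℝ χ p (0, 1)| ≤ 0)
    (hQ : |q z - q (v p) - fderiv ℝ η (v p) (f z - f (v p))| ≤ c * (ηlow / 2 * ‖z - v p‖ ^ 2))
    (hc : 0 ≤ c) (hℓ : ‖fderiv ℝ v p (0, 1)‖ ≤ ℓ) :
    relativeEntropyDensity f η q v (fun p => θ p * χ p) z p
      ≤ θ' * (χ p * taylorRemainder η z (v p))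
        + θ p * (χ p * (1 / 2 * ‖fieldResidual f v p‖ ^ 2
          + 1 / 2 * (ηup * CF * ℓ + ηup ^ 2) * ‖z - v p‖ ^ 2)) := by
  obtain ⟨t, x⟩ := p
  have d1 : fderiv ℝ θ (t, x) (1, 0) = θ' := (deriv_left_eq_fderiv hθd).unique hθ
  have d2 : fderiv ℝ θ (t, x) (0, 1) = 0 := by
    refine (deriv_right_eq_fderiv hθd).unique ?_
    have : (fun z => θ (t, z)) = fun _ => θ (t, x) := funext fun z => hθx _ _ _
    rw [this]
    exact hasDerivAt_const _ _
  have d3 : ∀ e, fderiv ℝ (fun p => θ p * χ p) (t, x) e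
      = θ (t, x) * fderiv ℝ χ (t, x) e + χ (t, x) * fderiv ℝ θ (t, x) e := fun e => by
    have h1 : HasFDerivAt (fun p => θ p * χ p) _ (t, x) := hθd.hasFDerivAt.mul hχ.hasFDerivAt
    rw [h1.fderiv]
    simp
  set w := z - v (t, x) with hw
  set r := taylorRemainder η z (v (t, x)) with hr
  set Q := q z - q (v (t, x)) - fderiv ℝ η (v (t, x)) (f z - f (v (t, x))) with hQdef
  have hrlow : ηlow / 2 * ‖w‖ ^ 2 ≤ r := h.le_taylorRemainder_entropy hz hvp
  have hr0 : 0 ≤ r := le_trans (by have := h.low_pos; positivity) hrlow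
  -- the terms that contain derivatives of the weight
  have hflux : r * fderiv ℝ χ (t, x) (1, 0) + Q * fderiv ℝ χ (t, x) (0, 1) ≤ 0 := by
    have h1 : Q * fderiv ℝ χ (t, x) (0, 1) ≤ (c * r) * |fderiv ℝ χ (t, x) (0, 1)| := by
      refine (le_abs_self _).trans ?_
      rw [abs_mul]
      exact mul_le_mul_of_nonneg_right (hQ.trans (mul_le_mul_of_nonneg_left hrlow hc))
        (abs_nonneg _)
    nlinarith [mul_nonneg hr0 (neg_nonneg.2 hχc)]
  -- the residual term; Young's inequality produces `ηup²` in the exponent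
  have hR : -fderiv ℝ (fderiv ℝ η) (v (t, x)) (fieldResidual f v (t, x)) w
      ≤ 1 / 2 * ‖fieldResidual f v (t, x)‖ ^ 2 + 1 / 2 * ηup ^ 2 * ‖w‖ ^ 2 := by
    have h1 := h.abs_fderiv_fderiv_entropy_le hvp (fieldResidual f v (t, x)) w
    have h2 := (abs_le.1 h1).1
    nlinarith [sq_nonneg (‖fieldResidual f v (t, x)‖ - ηup * ‖w‖)]
  -- the term with the relative flux
  have hF : -fderiv ℝ (fderiv ℝ η) (v (t, x)) (fderiv ℝ v (t, x) (0, 1))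
      (taylorRemainder f z (v (t, x))) ≤ 1 / 2 * (ηup * CF * ℓ) * ‖w‖ ^ 2 := by
    have h1 := h.abs_fderiv_fderiv_entropy_le hvp (fderiv ℝ v (t, x) (0, 1))
      (taylorRemainder f z (v (t, x)))
    have h2 := (abs_le.1 h1).1
    have h3 := h.norm_taylorRemainder_flux_le hz hvp
    have h4 : ηup * ‖fderiv ℝ v (t, x) (0, 1)‖ * ‖taylorRemainder f z (v (t, x))‖
        ≤ ηup * ℓ * (CF / 2 * ‖w‖ ^ 2) :=
      mul_le_mul (mul_le_mul_of_nonneg_left hℓ h.up_pos.le) h3 (norm_nonneg _)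
        (mul_nonneg h.up_pos.le ((norm_nonneg _).trans hℓ))
    linarith
  have hκ0 : 0 ≤ θ (t, x) * χ (t, x) := mul_nonneg hθ0 hχ0
  simp only [relativeEntropyDensity, d3, d1, d2, mul_zero, add_zero, ← hw, ← hr, ← hQdef]
  have e1 := mul_nonneg hθ0 (neg_nonneg.2 hflux)
  have e2 := mul_le_mul_of_nonneg_left (add_le_add hR hF) hκ0
  nlinarith

end IsConvexEntropySystem

lemma measurable_coneWeight (c R : ℝ) : Measurable (coneWeight Λ c R) := by
  obtain ⟨L, hL⟩ := exists_lipschitzWith_coneWeight Λ c R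
  exact hL.continuous.measurable

lemma coneWeight_eq_zero {c R : ℝ} (hc : 0 ≤ c) {p : ℝ × ℝ} (hp0 : 0 ≤ p.1) (hp : p.2 ∈ Λ.cell)
    (hR : max 1 |R| < |p.2|) : coneWeight Λ c R p = 0 := by
  cases Λ with
  | line =>
    simp only [coneWeight]
    refine max_eq_left ((min_le_right _ _).trans ?_)
    have h1 := (le_max_right 1 |R|).trans_lt hR
    have h2 := le_abs_self R
    have h3 := mul_nonneg hc hp0
    linarith
  | periodic =>
    refine absurd ((le_max_left 1 |R|).trans_lt hR) (not_lt.2 (abs_le.2 ⟨?_, hp.2⟩))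
    linarith [hp.1]

lemma integrable_coneWeight_mul {c R M : ℝ} (hc : 0 ≤ c) {F : ℝ × ℝ → ℝ}
    (hF : AEStronglyMeasurable F (spaceTimeMeasure Λ T))
    (hFM : ∀ᵐ p ∂(spaceTimeMeasure Λ T), ‖F p‖ ≤ M) :
    Integrable (fun p => coneWeight Λ c R p * F p) (spaceTimeMeasure Λ T) := by
  refine (integrable_indicator_box (max 1 |R|) M).mono'
    ((measurable_coneWeight c R).aestronglyMeasurable.mul hF) ?_
  filter_upwards [hFM, ae_spaceTimeMeasure_mem Λ T] with p h1 h2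
  by_cases hp : |p.2| ≤ max 1 |R|
  · rw [indicator_of_mem (show p ∈ {p : ℝ × ℝ | |p.2| ≤ max 1 |R|} from hp), norm_mul,
      Real.norm_of_nonneg (coneWeight_nonneg Λ c R p)]
    exact (mul_le_of_le_one_left (norm_nonneg _) (coneWeight_le_one Λ c R p)).trans h1
  · rw [indicator_of_notMem (show p ∉ {p : ℝ × ℝ | |p.2| ≤ max 1 |R|} from hp),
      coneWeight_eq_zero hc h2.1.1.le h2.2 (not_le.1 hp), zero_mul, norm_zero]

lemma integrable_coneWeight_mul_cell {c R M : ℝ} (hc : 0 ≤ c) {F : ℝ → ℝ}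
    (hF : AEStronglyMeasurable F (volume.restrict Λ.cell))
    (hFM : ∀ᵐ x ∂(volume.restrict Λ.cell), ‖F x‖ ≤ M) :
    Integrable (fun x => coneWeight Λ c R (0, x) * F x) (volume.restrict Λ.cell) := by
  refine (integrable_indicator_cell (max 1 |R|) M).mono' (((measurable_coneWeight c R).comp
    (measurable_const.prodMk measurable_id)).aestronglyMeasurable.mul hF) ?_
  filter_upwards [hFM, ae_restrict_mem Λ.measurableSet_cell] with x h1 h2
  by_cases hp : |x| ≤ max 1 |R|
  · rw [indicator_of_mem (show x ∈ {x : ℝ | |x| ≤ max 1 |R|} from hp), norm_mul]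
    rw [Real.norm_of_nonneg (coneWeight_nonneg Λ c R (0, x))]
    exact (mul_le_of_le_one_left (norm_nonneg _) (coneWeight_le_one Λ c R (0, x))).trans h1
  · rw [indicator_of_notMem (show x ∉ {x : ℝ | |x| ≤ max 1 |R|} from hp)]
    simp [coneWeight_eq_zero (Λ := Λ) (p := (0, x)) hc le_rfl h2 (not_le.1 hp)]

end Stability

section AlmostEveryTime

variable {m : ℕ} {U C : Set (State m)} {f : State m → State m} {η q : State m → ℝ}
  {CF ηlow ηup : ℝ} {Λ : SpatialDomain} {T : ℝ} {u₀ : ℝ → State m} {u : ℝ → ℝ → State m}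
  {v : ℝ × ℝ → State m}

lemma ae_fst_of_ae {P : ℝ → Prop} (h : ∀ᵐ t : ℝ, P t) :
    ∀ᵐ p ∂(spaceTimeMeasure Λ T), P p.1 :=
  (Measure.quasiMeasurePreserving_fst (μ := volume.restrict (Ioo 0 T))
    (ν := volume.restrict Λ.cell)).ae (ae_restrict_of_ae h)

/-- The derivative of the time cutoff at the times at which it is differentiable. -/
noncomputable def timeCutoffDeriv (s δ : ℝ) : ℝ → ℝ := (Ioo s (s + δ)).indicator fun _ => -(1 / δ)

section Cutoff

variable {s δ : ℝ} {K : ℝ × ℝ → ℝ}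

lemma hasDerivAt_timeCutoff (hs : 0 < s) (hδ : 0 < δ) {t : ℝ} (ht : 0 < t) (hts : t ≠ s)
    (htδ : t ≠ s + δ) : HasDerivAt (timeCutoff s δ) (timeCutoffDeriv s δ t) t := by
  rcases lt_trichotomy t s with h8 | h8 | h8
  · rw [timeCutoffDeriv, indicator_of_notMem fun h9 => not_lt.2 h9.1.le h8]
    exact hasDerivAt_timeCutoff_of_lt hδ ⟨ht, h8⟩
  · exact absurd h8 hts
  rcases lt_trichotomy t (s + δ) with h9 | h9 | h9
  · rw [timeCutoffDeriv, indicator_of_mem (show t ∈ Ioo s (s + δ) from ⟨h8, h9⟩)]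
    exact hasDerivAt_timeCutoff_of_mem hs hδ ⟨h8, h9⟩
  · exact absurd h9 htδ
  · rw [timeCutoffDeriv, indicator_of_notMem fun h10 => not_lt.2 h10.2.le h9]
    exact hasDerivAt_timeCutoff_of_gt hδ h9

lemma integrable_timeCutoffDeriv_mul (hδ : 0 < δ) (hK : Integrable K (spaceTimeMeasure Λ T)) :
    Integrable (fun p : ℝ × ℝ => timeCutoffDeriv s δ p.1 * K p) (spaceTimeMeasure Λ T) := by
  have hm : Measurable (timeCutoffDeriv s δ) := measurable_const.indicator measurableSet_Ioo
  refine hK.bdd_mul (c := 1 / δ) (hm.comp measurable_fst).aestronglyMeasurable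
    (Eventually.of_forall fun p => (norm_indicator_le_norm_self _ _).trans ?_)
  rw [norm_neg, Real.norm_of_nonneg (by positivity)]

lemma integrable_timeCutoff_mul (hδ : 0 < δ) (hK : Integrable K (spaceTimeMeasure Λ T)) :
    Integrable (fun p : ℝ × ℝ => timeCutoff s δ p.1 * K p) (spaceTimeMeasure Λ T) := by
  obtain ⟨L, hL⟩ := exists_lipschitzWith_timeCutoff (s := s) hδ
  refine hK.bdd_mul (c := 1) (hL.continuous.comp continuous_fst).aestronglyMeasurable
    (Eventually.of_forall fun p => ?_)
  rw [Real.norm_of_nonneg (timeCutoff_nonneg _)]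
  exact timeCutoff_le_one _

lemma integral_deriv_timeCutoff_mul (hs : 0 < s) (hδ : 0 < δ) (hsT : s + δ < T)
    (hK : Integrable K (spaceTimeMeasure Λ T)) :
    ∫ p, timeCutoffDeriv s δ p.1 * K p ∂(spaceTimeMeasure Λ T)
      = -(1 / δ * ∫ t in s..(s + δ), ∫ x in Λ.cell, K (t, x)) := by
  rw [spaceTimeMeasure, integral_prod _ (integrable_timeCutoffDeriv_mul hδ hK)]
  simp only [integral_const_mul]
  have h3 : ∀ t, timeCutoffDeriv s δ t * ∫ x in Λ.cell, K (t, x)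
      = (Ioo s (s + δ)).indicator (fun t => -(1 / δ) * ∫ x in Λ.cell, K (t, x)) t := fun t => by
    by_cases ht : t ∈ Ioo s (s + δ) <;> simp [timeCutoffDeriv, ht]
  simp only [h3]
  rw [setIntegral_indicator measurableSet_Ioo, integral_const_mul,
    intervalIntegral.integral_of_le (by linarith), integral_Ioc_eq_integral_Ioo,
    inter_eq_right.2 (Ioo_subset_Ioo hs.le hsT.le), neg_mul]

lemma integral_timeCutoff_mul_le (hs : 0 < s) (hδ : 0 < δ) (hsT : s + δ < T)
    (hK : Integrable K (spaceTimeMeasure Λ T)) (hK0 : ∀ p, 0 ≤ K p) :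
    ∫ p, timeCutoff s δ p.1 * K p ∂(spaceTimeMeasure Λ T)
      ≤ ∫ t in 0..(s + δ), ∫ x in Λ.cell, K (t, x) := by
  have hi := (integrable_timeCutoff_mul (s := s) hδ hK).integral_prod_left
  rw [spaceTimeMeasure, integral_prod _ (integrable_timeCutoff_mul hδ hK)]
  simp only [integral_const_mul] at hi ⊢
  have h4 : ∫ t in 0..(s + δ), ∫ x in Λ.cell, K (t, x)
      = ∫ t in Ioo 0 T, (Ioo 0 (s + δ)).indicator (fun t => ∫ x in Λ.cell, K (t, x)) t := by
    rw [setIntegral_indicator measurableSet_Ioo, intervalIntegral.integral_of_le (by linarith),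
      integral_Ioc_eq_integral_Ioo, inter_eq_right.2 (Ioo_subset_Ioo le_rfl hsT.le)]
  rw [h4]
  refine integral_mono_ae hi (hK.integral_prod_left.indicator measurableSet_Ioo) ?_
  filter_upwards [ae_restrict_mem measurableSet_Ioo,
    ae_restrict_of_ae (compl_mem_ae_iff.2 (measure_singleton (s + δ)))] with t ht hne
  have hβ0 : 0 ≤ ∫ x in Λ.cell, K (t, x) := integral_nonneg fun x => hK0 _
  by_cases ht' : t < s + δ
  · rw [indicator_of_mem (show t ∈ Ioo 0 (s + δ) from ⟨ht.1, ht'⟩)]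
    exact mul_le_of_le_one_left hβ0 (timeCutoff_le_one t)
  · rw [indicator_of_notMem fun h5 => ht' h5.2, timeCutoff_eq_zero hδ fun h5 =>
      ht' (lt_of_le_of_ne h5.2 hne), zero_mul]

end Cutoff

namespace IsEntropySolutionIn

lemma measurable_norm_sub_sq (hu : IsEntropySolutionIn Λ T C f η q u₀ u)
    (hv : IsLipschitzField Λ C v) :
    AEStronglyMeasurable (fun p : ℝ × ℝ => ‖u p.1 p.2 - v p‖ ^ 2) (spaceTimeMeasure Λ T) :=
  ((hu.measurable.sub hv.continuous.aestronglyMeasurable).norm.pow 2)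

lemma measurable_relativeEntropy (h : IsConvexEntropySystem U C f η q CF ηlow ηup)
    (hu : IsEntropySolutionIn Λ T C f η q u₀ u) (hv : IsLipschitzField Λ C v) :
    AEStronglyMeasurable (fun p : ℝ × ℝ => taylorRemainder η (u p.1 p.2) (v p))
      (spaceTimeMeasure Λ T) := by
  have hcη := h.entropy.continuousOn.mono h.subset
  have h1 := aestronglyMeasurable_comp_of_continuousOn h.isCompact.isClosed hcη
    hu.measurable hu.mem
  have h2 := (IsConvexEntropySystem.continuous_comp_field hcη hv).aestronglyMeasurable
    (μ := spaceTimeMeasure Λ T)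
  have h3 := (IsConvexEntropySystem.continuous_comp_field
    (h.continuousOn_fderiv h.entropy) hv).aestronglyMeasurable (μ := spaceTimeMeasure Λ T)
  have h4 : Continuous fun x : (State m →L[ℝ] ℝ) × State m => x.1 x.2 :=
    isBoundedBilinearMap_apply.continuous
  exact (h1.sub h2).sub (h4.comp_aestronglyMeasurable
    (h3.prodMk (hu.measurable.sub hv.continuous.aestronglyMeasurable)))

/-- The relative entropy estimate for almost every time, weighted in space. -/
lemma ae_relativeEntropy_le (h : IsConvexEntropySystem U C f η q CF ηlow ηup)
    (hu : IsEntropySolutionIn Λ T C f η q u₀ u) (hv : IsLipschitzField Λ C v) (hT : 0 < T)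
    {ℓ : ℝ → ℝ} {B : ℝ} (hℓm : Measurable ℓ) (hℓ0 : ∀ t, 0 ≤ ℓ t) (hℓB : ∀ t, ℓ t ≤ B)
    (hℓ : ∀ᵐ p ∂(spaceTimeMeasure Λ T), ‖fderiv ℝ v p (0, 1)‖ ≤ ℓ p.1)
    {c : ℝ} (hc : 0 ≤ c) (hQ : ∀ z ∈ C, ∀ z₀ ∈ C,
      |q z - q z₀ - fderiv ℝ η z₀ (f z - f z₀)| ≤ c * (ηlow / 2 * ‖z - z₀‖ ^ 2)) (R : ℝ) :
    Integrable (fun p => coneWeight Λ c R p * taylorRemainder η (u p.1 p.2) (v p))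
      (spaceTimeMeasure Λ T) ∧
    Integrable (fun p => coneWeight Λ c R p * (1 / 2 * ‖fieldResidual f v p‖ ^ 2
      + 1 / 2 * (ηup * CF * ℓ p.1 + ηup ^ 2) * ‖u p.1 p.2 - v p‖ ^ 2)) (spaceTimeMeasure Λ T) ∧
    ∀ᵐ s, s ∈ Ioo 0 T →
      ∫ x in Λ.cell, coneWeight Λ c R (s, x) * taylorRemainder η (u s x) (v (s, x))
        ≤ (∫ x in Λ.cell, coneWeight Λ c R (0, x) * taylorRemainder η (u₀ x) (v (0, x)))
          + ∫ t in 0..s, ∫ x in Λ.cell, coneWeight Λ c R (t, x)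
            * (1 / 2 * ‖fieldResidual f v (t, x)‖ ^ 2
              + 1 / 2 * (ηup * CF * ℓ t + ηup ^ 2) * ‖u t x - v (t, x)‖ ^ 2) := by
  obtain ⟨M, hM⟩ := h.exists_norm_sub_le
  obtain ⟨MR, hMR⟩ := h.exists_norm_fieldResidual_le hv
  have hCF := h.flux_nonneg
  have hup := h.up_pos
  set χ := coneWeight Λ c R with hχdef
  set r : ℝ × ℝ → ℝ := fun p => taylorRemainder η (u p.1 p.2) (v p) with hr
  set b : ℝ × ℝ → ℝ := fun p => 1 / 2 * ‖fieldResidual f v p‖ ^ 2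
      + 1 / 2 * (ηup * CF * ℓ p.1 + ηup ^ 2) * ‖u p.1 p.2 - v p‖ ^ 2 with hb
  have hb0 : ∀ p, 0 ≤ b p := fun p => by have := hℓ0 p.1; simp only [hb]; positivity
  have ir : Integrable (fun p => χ p * r p) (spaceTimeMeasure Λ T) := by
    refine integrable_coneWeight_mul (M := ηup / 2 * M ^ 2) hc
      (hu.measurable_relativeEntropy h hv) ?_
    filter_upwards [hu.mem] with p hp
    have h1 := h.le_taylorRemainder_entropy hp (hv.mem p)
    have h2 := h.taylorRemainder_entropy_le hp (hv.mem p)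
    rw [Real.norm_of_nonneg (le_trans (by have := h.low_pos; positivity) h1)]
    refine h2.trans ?_
    have := hM _ hp _ (hv.mem p)
    gcongr
  have ib : Integrable (fun p => χ p * b p) (spaceTimeMeasure Λ T) := by
    refine integrable_coneWeight_mul (M := 1 / 2 * MR ^ 2
      + 1 / 2 * (ηup * CF * B + ηup ^ 2) * M ^ 2) hc ?_ ?_
    · have h1 := ((h.measurable_fieldResidual hv).norm.pow_const 2).const_mul (1 / 2)
      have h2 : Measurable fun p : ℝ × ℝ => 1 / 2 * (ηup * CF * ℓ p.1 + ηup ^ 2) :=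
        (((hℓm.comp measurable_fst).const_mul _).add_const _).const_mul _
      exact h1.aestronglyMeasurable.add
        (h2.aestronglyMeasurable.mul (hu.measurable_norm_sub_sq hv))
    · filter_upwards [hu.mem] with p hp
      rw [Real.norm_of_nonneg (hb0 p)]
      have h1 := hM _ hp _ (hv.mem p)
      have h2 := hMR p
      have h3 := hℓB p.1
      have h4 := hℓ0 p.1
      have h5 := h4.trans h3
      simp only [hb]
      gcongr
  refine ⟨ir, ib, ?_⟩
  have hmain : ∀ s δ, 0 < s → 0 < δ → s + δ < T →
      1 / δ * ∫ t in s..(s + δ), ∫ x in Λ.cell, χ (t, x) * r (t, x)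
        ≤ (∫ x in Λ.cell, χ (0, x) * taylorRemainder η (u₀ x) (v (0, x)))
          + ∫ t in 0..(s + δ), ∫ x in Λ.cell, χ (t, x) * b (t, x) := by
    intro s δ hs hδ hsT
    obtain ⟨Lχ, hLχ⟩ := exists_lipschitzWith_coneWeight Λ c R
    set θ' := timeCutoffDeriv s δ with hθ'
    obtain ⟨hDi, hD⟩ := relativeEntropy_inequality h hu hT hv
      (isLipschitzTest_timeCutoff_mul_coneWeight Λ hc R hδ hsT)
      (fun p => mul_nonneg (timeCutoff_nonneg _) (coneWeight_nonneg Λ c R p))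
    have i1 := integrable_timeCutoffDeriv_mul (s := s) hδ ir
    have i2 := integrable_timeCutoff_mul (s := s) hδ ib
    have h1 : ∫ p, relativeEntropyDensity f η q v
          (fun p => timeCutoff s δ p.1 * coneWeight Λ c R p) (u p.1 p.2) p ∂(spaceTimeMeasure Λ T)
        ≤ ∫ p, (θ' p.1 * (χ p * r p) + timeCutoff s δ p.1 * (χ p * b p))
          ∂(spaceTimeMeasure Λ T) := by
      refine integral_mono_ae hDi (i1.add i2) ?_
      filter_upwards [hu.mem, hℓ, ae_spaceTimeMeasure_mem Λ T,
        ae_fst_of_ae (compl_mem_ae_iff.2 (measure_singleton s)),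
        ae_fst_of_ae (compl_mem_ae_iff.2 (measure_singleton (s + δ))),
        ae_spaceTimeMeasure_of_ae hLχ.ae_differentiableAt] with p h2 h3 h4 h5 h6 h7
      have hd := hasDerivAt_timeCutoff hs hδ h4.1.1 h5 h6
      exact h.relativeEntropyDensity_le (θ := fun p => timeCutoff s δ p.1) h2 (hv.mem p) hd
        (fun _ _ _ => rfl) (hd.differentiableAt.comp p differentiableAt_fst)
        (timeCutoff_nonneg _) h7 (coneWeight_nonneg Λ c R p) (fderiv_coneWeight_le hc h7)
        (hQ _ h2 _ (hv.mem p)) hc h3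
    have h2 := integral_deriv_timeCutoff_mul hs hδ hsT ir
    have h3 := integral_timeCutoff_mul_le hs hδ hsT ib
      fun p => mul_nonneg (coneWeight_nonneg Λ c R p) (hb0 p)
    rw [integral_add i1 i2, h2] at h1
    have h4 : ∫ x in Λ.cell, taylorRemainder η (u₀ x) (v (0, x))
          * (timeCutoff s δ (0, x).1 * coneWeight Λ c R (0, x))
        = ∫ x in Λ.cell, χ (0, x) * taylorRemainder η (u₀ x) (v (0, x)) := by
      simp only [timeCutoff_eq_one hδ (show (0 : ℝ) ∈ Icc 0 s from ⟨le_rfl, hs.le⟩), one_mul,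
        mul_comm]
      rfl
    rw [h4] at hD
    linarith
  exact ae_le_of_average_le ir.integral_prod_left ib.integral_prod_left hmain

end IsEntropySolutionIn

end AlmostEveryTime

section AlmostEveryTime

variable {m : ℕ} {U C : Set (State m)} {f : State m → State m} {η q : State m → ℝ}
  {CF ηlow ηup : ℝ} {Λ : SpatialDomain} {T : ℝ} {u₀ : ℝ → State m} {u : ℝ → ℝ → State m}
  {v : ℝ × ℝ → State m}

lemma ae_ae_of_ae_spaceTimeMeasure {P : ℝ × ℝ → Prop} (h : ∀ᵐ p ∂(spaceTimeMeasure Λ T), P p) :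
    ∀ᵐ t, t ∈ Ioo 0 T → ∀ᵐ x ∂(volume.restrict Λ.cell), P (t, x) :=
  (ae_restrict_iff' measurableSet_Ioo).1 (Measure.ae_ae_of_ae_prod h)

lemma ae_integrable_section {F : ℝ × ℝ → ℝ} (h : Integrable F (spaceTimeMeasure Λ T)) :
    ∀ᵐ t, t ∈ Ioo 0 T → Integrable (fun x => F (t, x)) (volume.restrict Λ.cell) :=
  (ae_restrict_iff' measurableSet_Ioo).1 h.prod_right_ae

lemma intervalIntegrable_of_integrableOn_Ioo {g : ℝ → ℝ} (hg : IntegrableOn g (Ioo 0 T)) {s : ℝ}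
    (hs : 0 ≤ s) (hsT : s ≤ T) : IntervalIntegrable g volume 0 s := by
  rw [intervalIntegrable_iff_integrableOn_Ioo_of_le hs]
  exact hg.mono_set (Ioo_subset_Ioo le_rfl hsT)

lemma ofReal_integral_le_lintegral {α : Type*} [MeasurableSpace α] {μ : Measure α} {g : α → ℝ} :
    ENNReal.ofReal (∫ a, g a ∂μ) ≤ ∫⁻ a, ‖g a‖ₑ ∂μ :=
  (Real.ofReal_le_enorm _).trans (enorm_integral_le_lintegral_enorm g)

lemma enorm_mul_norm_sq_le {V : Type*} [NormedAddCommGroup V] {χ : ℝ} (h0 : 0 ≤ χ) (h1 : χ ≤ 1)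
    (z : V) : ‖χ * ‖z‖ ^ 2‖ₑ ≤ ‖z‖ₑ ^ 2 := by
  rw [enorm_mul, enorm_pow, enorm_norm]
  refine mul_le_of_le_one_left (by simp) ?_
  rw [Real.enorm_of_nonneg h0]
  exact ENNReal.ofReal_le_one.2 h1

namespace IsEntropySolutionIn

/-- The weighted stability estimate for almost every time. Two-sided bounds of the relative entropy
by the squared distance and Gronwall's inequality turn the relative entropy estimate into it. -/
lemma ae_weighted_stability (h : IsConvexEntropySystem U C f η q CF ηlow ηup)
    (hu : IsEntropySolutionIn Λ T C f η q u₀ u) (hv : IsLipschitzField Λ C v) (hT : 0 < T)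
    {ℓ : ℝ → ℝ} {B : ℝ} (hℓm : Measurable ℓ) (hℓ0 : ∀ t, 0 ≤ ℓ t) (hℓB : ∀ t, ℓ t ≤ B)
    (hℓ : ∀ᵐ p ∂(spaceTimeMeasure Λ T), ‖fderiv ℝ v p (0, 1)‖ ≤ ℓ p.1)
    {c : ℝ} (hc : 0 ≤ c) (hQ : ∀ z ∈ C, ∀ z₀ ∈ C,
      |q z - q z₀ - fderiv ℝ η z₀ (f z - f z₀)| ≤ c * (ηlow / 2 * ‖z - z₀‖ ^ 2)) (R : ℝ) :
    ∀ᵐ s, s ∈ Ioo 0 T →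
      Integrable (fun x => coneWeight Λ c R (s, x) * ‖u s x - v (s, x)‖ ^ 2)
        (volume.restrict Λ.cell) ∧
      ∫ x in Λ.cell, coneWeight Λ c R (s, x) * ‖u s x - v (s, x)‖ ^ 2
        ≤ ηlow⁻¹ * (ηup * (∫ x in Λ.cell, coneWeight Λ c R (0, x) * ‖u₀ x - v (0, x)‖ ^ 2)
            + ∫ t in 0..s, ∫ x in Λ.cell, coneWeight Λ c R (t, x) * ‖fieldResidual f v (t, x)‖ ^ 2)
          * Real.exp (∫ t in 0..s, ηlow⁻¹ * (ηup * CF * ℓ t + ηup ^ 2)) := by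
  obtain ⟨ir, ib, hmain⟩ := hu.ae_relativeEntropy_le h hv hT hℓm hℓ0 hℓB hℓ hc hQ R
  obtain ⟨M, hM⟩ := h.exists_norm_sub_le
  obtain ⟨MR, hMR⟩ := h.exists_norm_fieldResidual_le hv
  have hCF := h.flux_nonneg
  have hup := h.up_pos
  have hlow := h.low_pos
  set χ := coneWeight Λ c R with hχdef
  have hχ0 : ∀ p, 0 ≤ χ p := coneWeight_nonneg Λ c R
  set g : ℝ → ℝ := fun t => ηup * CF * ℓ t + ηup ^ 2 with hg
  have hg0 : ∀ t, 0 ≤ g t := fun t => by have := hℓ0 t; simp only [hg]; positivity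
  have hgB : ∀ t, g t ≤ ηup * CF * B + ηup ^ 2 := fun t => by
    have := hℓB t; simp only [hg]; gcongr
  have hgm : Measurable g := (hℓm.const_mul _).add_const _
  have iw : Integrable (fun p : ℝ × ℝ => χ p * ‖u p.1 p.2 - v p‖ ^ 2) (spaceTimeMeasure Λ T) := by
    refine integrable_coneWeight_mul (M := M ^ 2) hc (hu.measurable_norm_sub_sq hv) ?_
    filter_upwards [hu.mem] with p hp
    rw [Real.norm_of_nonneg (by positivity)]
    have := hM _ hp _ (hv.mem p)
    gcongr
  have iR : Integrable (fun p : ℝ × ℝ => χ p * ‖fieldResidual f v p‖ ^ 2)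
      (spaceTimeMeasure Λ T) := by
    refine integrable_coneWeight_mul (M := MR ^ 2) hc
      ((h.measurable_fieldResidual hv).norm.pow_const 2).aestronglyMeasurable
      (Eventually.of_forall fun p => ?_)
    rw [Real.norm_of_nonneg (by positivity)]
    have := hMR p
    gcongr
  set d : ℝ → ℝ := fun t => ∫ x in Λ.cell, χ (t, x) * ‖u t x - v (t, x)‖ ^ 2 with hd
  set ρ : ℝ → ℝ := fun t => ∫ x in Λ.cell, χ (t, x) * ‖fieldResidual f v (t, x)‖ ^ 2 with hρ
  set d₀ : ℝ := ∫ x in Λ.cell, χ (0, x) * ‖u₀ x - v (0, x)‖ ^ 2 with hd₀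
  have hρ0 : ∀ t, 0 ≤ ρ t := fun t =>
    integral_nonneg fun x => mul_nonneg (hχ0 _) (by positivity)
  have idd : IntegrableOn d (Ioo 0 T) := iw.integral_prod_left
  have iρ : IntegrableOn ρ (Ioo 0 T) := iR.integral_prod_left
  have igd : IntegrableOn (fun t => g t * d t) (Ioo 0 T) :=
    idd.bdd_mul (c := ηup * CF * B + ηup ^ 2) hgm.aestronglyMeasurable
      (Eventually.of_forall fun t => by
        rw [Real.norm_of_nonneg (hg0 t)]
        exact hgB t)
  -- upper bound for the initial relative entropy
  have h0 : ∫ x in Λ.cell, χ (0, x) * taylorRemainder η (u₀ x) (v (0, x)) ≤ ηup / 2 * d₀ := by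
    rw [hd₀, ← integral_const_mul]
    have i0 : Integrable (fun x => χ (0, x) * ‖u₀ x - v (0, x)‖ ^ 2) (volume.restrict Λ.cell) := by
      refine integrable_coneWeight_mul_cell (M := M ^ 2) hc
        (F := fun x => ‖u₀ x - v (0, x)‖ ^ 2) ?_ ?_
      · exact (hu.measurable_initial.sub (hv.continuous.comp
          (by fun_prop : Continuous fun x : ℝ => ((0 : ℝ), x))).aestronglyMeasurable).norm.pow 2
      · filter_upwards [hu.mem_initial] with x hx
        rw [Real.norm_of_nonneg (by positivity)]
        have := hM _ hx _ (hv.mem (0, x))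
        gcongr
    refine integral_mono_of_nonneg ?_ (i0.const_mul _) ?_
    · filter_upwards [hu.mem_initial] with x hx
      exact mul_nonneg (hχ0 _) (le_trans (by positivity)
        (h.le_taylorRemainder_entropy hx (hv.mem (0, x))))
    · filter_upwards [hu.mem_initial] with x hx
      have := mul_le_mul_of_nonneg_left (h.taylorRemainder_entropy_le hx (hv.mem (0, x)))
        (hχ0 (0, x))
      linarith
  have hβ : ∀ᵐ t, t ∈ Ioo 0 T → (∫ x in Λ.cell, χ (t, x) * (1 / 2 * ‖fieldResidual f v (t, x)‖ ^ 2
      + 1 / 2 * g t * ‖u t x - v (t, x)‖ ^ 2)) = 1 / 2 * ρ t + 1 / 2 * (g t * d t) := by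
    filter_upwards [ae_integrable_section iw, ae_integrable_section iR] with t h1 h2 ht
    rw [hρ, hd]
    simp only
    rw [← integral_const_mul, ← integral_const_mul, ← integral_const_mul,
      ← integral_add ((h2 ht).const_mul _) (((h1 ht).const_mul _).const_mul _)]
    refine integral_congr_ae (Eventually.of_forall fun x => ?_)
    simp only
    ring
  have hβ' : ∀ s ∈ Ioo 0 T, (∫ t in 0..s, ∫ x in Λ.cell, χ (t, x)
      * (1 / 2 * ‖fieldResidual f v (t, x)‖ ^ 2 + 1 / 2 * g t * ‖u t x - v (t, x)‖ ^ 2))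
      = 1 / 2 * (∫ t in 0..s, ρ t) + 1 / 2 * ∫ t in 0..s, g t * d t := by
    intro s hs
    rw [← intervalIntegral.integral_const_mul, ← intervalIntegral.integral_const_mul,
      ← intervalIntegral.integral_add
        ((intervalIntegrable_of_integrableOn_Ioo iρ hs.1.le hs.2.le).const_mul _)
        ((intervalIntegrable_of_integrableOn_Ioo igd hs.1.le hs.2.le).const_mul _)]
    refine intervalIntegral.integral_congr_ae ?_
    filter_upwards [hβ] with t ht hts
    rw [uIoc_of_le hs.1.le] at hts
    exact ht ⟨hts.1, hts.2.trans_lt hs.2⟩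
  set A : ℝ → ℝ := fun s => ηlow⁻¹ * (ηup * d₀ + ∫ t in 0..s, ρ t) with hA
  have hstep : ∀ᵐ s, s ∈ Ioo 0 T → d s ≤ A s + ∫ t in 0..s, (ηlow⁻¹ * g t) * d t := by
    filter_upwards [hmain, ae_integrable_section ir,
      ae_ae_of_ae_spaceTimeMeasure hu.mem] with s h1 h2 h3 hs
    -- lower bound for the relative entropy at the time `s`
    have h4 : ηlow / 2 * d s
        ≤ ∫ x in Λ.cell, χ (s, x) * taylorRemainder η (u s x) (v (s, x)) := by
      rw [hd]
      simp only
      rw [← integral_const_mul]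
      refine integral_mono_of_nonneg (Eventually.of_forall fun x => mul_nonneg (by positivity)
        (mul_nonneg (hχ0 _) (by positivity))) (h2 hs) ?_
      filter_upwards [h3 hs] with x hx
      have := mul_le_mul_of_nonneg_left (h.le_taylorRemainder_entropy hx (hv.mem (s, x)))
        (hχ0 (s, x))
      linarith
    have h5 := h1 hs
    rw [hβ' s hs] at h5
    have h6 : ηlow * d s ≤ ηup * d₀ + (∫ t in 0..s, ρ t) + ∫ t in 0..s, g t * d t := by linarith
    have h7 : ∫ t in 0..s, (ηlow⁻¹ * g t) * d t = ηlow⁻¹ * ∫ t in 0..s, g t * d t := by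
      rw [← intervalIntegral.integral_const_mul]
      simp only [mul_assoc]
    rw [h7, hA]
    simp only
    rw [← mul_add, ← div_eq_inv_mul, le_div_iff₀ hlow]
    linarith
  filter_upwards [hstep, ae_integrable_section iw] with s hs h2 hsT
  refine ⟨h2 hsT, ?_⟩
  have hG : ∀ t, ηlow⁻¹ * g t ≤ ηlow⁻¹ * (ηup * CF * B + ηup ^ 2) := fun t =>
    mul_le_mul_of_nonneg_left (hgB t) (inv_nonneg.2 hlow.le)
  refine (hs hsT).trans (gronwall_of_ae hsT.1.le
    (intervalIntegrable_of_integrableOn_Ioo idd hsT.1.le hsT.2.le)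
    (hgm.const_mul _) (fun t => mul_nonneg (inv_nonneg.2 hlow.le) (hg0 t)) hG ?_)
  filter_upwards [hstep] with t ht hts
  refine (ht ⟨hts.1, hts.2.trans hsT.2⟩).trans (add_le_add ?_ le_rfl)
  refine mul_le_mul_of_nonneg_left (add_le_add le_rfl ?_) (inv_nonneg.2 hlow.le)
  refine intervalIntegral.integral_mono_interval le_rfl hts.1.le hts.2.le
    (Eventually.of_forall hρ0) (intervalIntegrable_of_integrableOn_Ioo iρ hsT.1.le hsT.2.le)

/-- The stability estimate for almost every time, in terms of extended nonnegative integrals. -/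
lemma ae_stability (h : IsConvexEntropySystem U C f η q CF ηlow ηup)
    (hu : IsEntropySolutionIn Λ T C f η q u₀ u) (hv : IsLipschitzField Λ C v) (hT : 0 < T)
    {ℓ : ℝ → ℝ} {B : ℝ} (hℓm : Measurable ℓ) (hℓ0 : ∀ t, 0 ≤ ℓ t) (hℓB : ∀ t, ℓ t ≤ B)
    (hℓ : ∀ᵐ p ∂(spaceTimeMeasure Λ T), ‖fderiv ℝ v p (0, 1)‖ ≤ ℓ p.1) {τ : ℝ} (hτ : τ ≤ T) :
    ∀ᵐ s, s ∈ Ioo 0 τ → ∫⁻ x in Λ.cell, ‖u s x - v (s, x)‖ₑ ^ 2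
      ≤ (ENNReal.ofReal ηlow)⁻¹ * (ENNReal.ofReal ηup * (∫⁻ x in Λ.cell, ‖u₀ x - v (0, x)‖ₑ ^ 2)
          + ∫⁻ t in Ioo 0 τ, ∫⁻ x in Λ.cell, ‖fieldResidual f v (t, x)‖ₑ ^ 2)
        * ENNReal.ofReal (Real.exp (∫ t in 0..τ, ηlow⁻¹ * (ηup * CF * ℓ t + ηup ^ 2))) := by
  obtain ⟨K, hK0, hK⟩ := h.exists_relativeFlux_le
  have hCF := h.flux_nonneg
  have hup := h.up_pos
  have hlow := h.low_pos
  -- the speed of the cone: the relative entropy is at least `ηlow / 2 ‖u - v‖²`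
  set c : ℝ := K * (2 / ηlow) with hcdef
  have hc : 0 ≤ c := by positivity
  have hQ : ∀ z ∈ C, ∀ z₀ ∈ C,
      |q z - q z₀ - fderiv ℝ η z₀ (f z - f z₀)| ≤ c * (ηlow / 2 * ‖z - z₀‖ ^ 2) := by
    intro z hz z₀ hz₀
    refine (hK z hz z₀ hz₀).trans (le_of_eq ?_)
    rw [hcdef]
    field_simp
  set E := (ENNReal.ofReal ηlow)⁻¹ * (ENNReal.ofReal ηup
      * (∫⁻ x in Λ.cell, ‖u₀ x - v (0, x)‖ₑ ^ 2)
          + ∫⁻ t in Ioo 0 τ, ∫⁻ x in Λ.cell, ‖fieldResidual f v (t, x)‖ₑ ^ 2)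
        * ENNReal.ofReal (Real.exp (∫ t in 0..τ, ηlow⁻¹ * (ηup * CF * ℓ t + ηup ^ 2))) with hE
  have hall : ∀ᵐ s, ∀ n : ℕ, s ∈ Ioo 0 T →
      Integrable (fun x => coneWeight Λ c n (s, x) * ‖u s x - v (s, x)‖ ^ 2)
        (volume.restrict Λ.cell) ∧
      ∫ x in Λ.cell, coneWeight Λ c n (s, x) * ‖u s x - v (s, x)‖ ^ 2
        ≤ ηlow⁻¹ * (ηup * (∫ x in Λ.cell, coneWeight Λ c n (0, x) * ‖u₀ x - v (0, x)‖ ^ 2)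
            + ∫ t in 0..s, ∫ x in Λ.cell, coneWeight Λ c n (t, x) * ‖fieldResidual f v (t, x)‖ ^ 2)
          * Real.exp (∫ t in 0..s, ηlow⁻¹ * (ηup * CF * ℓ t + ηup ^ 2)) :=
    ae_all_iff.2 fun n => hu.ae_weighted_stability h hv hT hℓm hℓ0 hℓB hℓ hc hQ n
  filter_upwards [hall] with s hs hsτ
  have hsT : s ∈ Ioo 0 T := ⟨hsτ.1, hsτ.2.trans_le hτ⟩
  have hbound : ∀ n : ℕ, ∫⁻ x in Λ.cell, ENNReal.ofReal (coneWeight Λ c n (s, x)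
      * ‖u s x - v (s, x)‖ ^ 2) ≤ E := by
    intro n
    obtain ⟨h1, h2⟩ := hs n hsT
    rw [← ofReal_integral_eq_lintegral_ofReal h1 (Eventually.of_forall fun x =>
      mul_nonneg (coneWeight_nonneg Λ c n _) (by positivity))]
    refine (ENNReal.ofReal_le_ofReal h2).trans ?_
    rw [ENNReal.ofReal_mul' (Real.exp_nonneg _), ENNReal.ofReal_mul (inv_nonneg.2 hlow.le),
      ENNReal.ofReal_inv_of_pos hlow, hE]
    refine mul_le_mul' (mul_le_mul' le_rfl (ENNReal.ofReal_add_le.trans (add_le_add ?_ ?_))) ?_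
    · rw [ENNReal.ofReal_mul hup.le]
      refine mul_le_mul' le_rfl (ofReal_integral_le_lintegral.trans (lintegral_mono fun x => ?_))
      exact enorm_mul_norm_sq_le (coneWeight_nonneg Λ c n _) (coneWeight_le_one Λ c n _) _
    · rw [intervalIntegral.integral_of_le hsτ.1.le]
      refine ofReal_integral_le_lintegral.trans ?_
      have hsub : Ioc 0 s ⊆ Ioo 0 τ := fun t ht => ⟨ht.1, ht.2.trans_lt hsτ.2⟩
      refine lintegral_mono' (Measure.restrict_mono hsub le_rfl) fun t => ?_
      refine (enorm_integral_le_lintegral_enorm _).trans (lintegral_mono fun x => ?_)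
      exact enorm_mul_norm_sq_le (coneWeight_nonneg Λ c n _) (coneWeight_le_one Λ c n _) _
    · refine ENNReal.ofReal_le_ofReal (Real.exp_le_exp.2 ?_)
      have hgi : IntervalIntegrable (fun t => ηlow⁻¹ * (ηup * CF * ℓ t + ηup ^ 2)) volume 0 τ := by
        have hℓi : IntervalIntegrable ℓ volume 0 τ :=
          (intervalIntegrable_const (c := B)).mono_fun hℓm.aestronglyMeasurable
            (Eventually.of_forall fun t => by
              simp only [Real.norm_of_nonneg (hℓ0 t)]
              exact (hℓB t).trans (le_abs_self B))
        exact ((hℓi.const_mul _).add intervalIntegrable_const).const_mul _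
      refine intervalIntegral.integral_mono_interval le_rfl hsτ.1.le hsτ.2.le
        (Eventually.of_forall fun t => ?_) hgi
      have := hℓ0 t
      simp only [Pi.zero_apply]
      positivity
  -- let the radius of the cone tend to infinity
  have hlim : ∀ x, ⨆ n : ℕ, ENNReal.ofReal (coneWeight Λ c n (s, x) * ‖u s x - v (s, x)‖ ^ 2)
      = ‖u s x - v (s, x)‖ₑ ^ 2 := by
    intro x
    have hsq : ENNReal.ofReal (‖u s x - v (s, x)‖ ^ 2) = ‖u s x - v (s, x)‖ₑ ^ 2 := by
      rw [ENNReal.ofReal_pow (norm_nonneg _), ofReal_norm]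
    refine le_antisymm (iSup_le fun n => ?_) ?_
    · rw [← hsq]
      exact ENNReal.ofReal_le_ofReal
        (mul_le_of_le_one_left (by positivity) (coneWeight_le_one Λ c n _))
    · obtain ⟨n, hn⟩ := exists_nat_ge (1 + c * s + |x|)
      refine le_iSup_of_le n ?_
      rw [coneWeight_eq_one Λ c (s, x) hn, one_mul, hsq]
  simp only [← hlim]
  rw [lintegral_iSup']
  · exact iSup_le hbound
  · intro n
    exact (hs n hsT).1.aestronglyMeasurable.aemeasurable.ennreal_ofReal
  · refine Eventually.of_forall fun x n n' hn => ENNReal.ofReal_le_ofReal ?_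
    exact mul_le_mul_of_nonneg_right (coneWeight_mono Λ c _ (Nat.cast_le.2 hn)) (by positivity)

end IsEntropySolutionIn

end AlmostEveryTime

/-! ### Values at fixed times -/

section Duality

variable {m : ℕ} {Λ : SpatialDomain} {ψ : ℝ → State m}

lemma IsSpaceTest.exists_bound (hψ : IsSpaceTest Λ ψ) :
    ∃ A, ∀ x ∈ Λ.cell, A < |x| → ψ x = 0 := by
  cases Λ with
  | line =>
    obtain ⟨A, hA⟩ := hψ.2.isCompact.isBounded.exists_norm_le
    refine ⟨A, fun x _ hx => by_contra fun h => ?_⟩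
    exact not_lt.2 (hA x (subset_tsupport _ h)) hx
  | periodic =>
    refine ⟨1, fun x hx h1 => absurd h1 (not_lt.2 (abs_le.2 ⟨?_, hx.2⟩))⟩
    linarith [hx.1]

lemma exists_norm_le_of_compatible {V : Type*} [NormedAddCommGroup V] {g : ℝ → V}
    (hg : Continuous g) (h : match Λ with
      | .line => HasCompactSupport g
      | .periodic => Function.Periodic g 1) : ∃ M, ∀ x, ‖g x‖ ≤ M := by
  cases Λ with
  | line => exact h.exists_bound_of_continuous hg
  | periodic =>
    obtain ⟨M, hM⟩ := isCompact_Icc.exists_bound_of_continuousOn (s := Icc (0 : ℝ) 1)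
      hg.continuousOn
    refine ⟨M, fun x => ?_⟩
    obtain ⟨y, hy, hxy⟩ := h.exists_mem_Ico₀ zero_lt_one x
    rw [hxy]
    exact hM y (Ico_subset_Icc_self hy)

lemma IsSpaceTest.exists_norm_le (hψ : IsSpaceTest Λ ψ) : ∃ M, ∀ x, ‖ψ x‖ ≤ M := by
  refine exists_norm_le_of_compatible (Λ := Λ) hψ.1.continuous ?_
  have := hψ.2
  cases Λ <;> exact this

lemma IsSpaceTest.exists_norm_deriv_le (hψ : IsSpaceTest Λ ψ) : ∃ M, ∀ x, ‖deriv ψ x‖ ≤ M := by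
  refine exists_norm_le_of_compatible (Λ := Λ) (hψ.1.continuous_deriv (by simp)) ?_
  have := hψ.2
  cases Λ with
  | line => exact this.deriv
  | periodic =>
    intro x
    have h1 : (fun z => ψ (z + 1)) = ψ := funext this
    rw [← deriv_comp_add_const, h1]

lemma integrableOn_box {g : ℝ → State m} (hg : LocallyIntegrableOn g Λ.cell) (A : ℝ) :
    IntegrableOn ({x : ℝ | |x| ≤ A}.indicator g) Λ.cell := by
  have hm : MeasurableSet {x : ℝ | |x| ≤ A} :=
    (isClosed_le continuous_abs continuous_const).measurableSet
  have hcl : IsClosed Λ.cell := by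
    cases Λ
    · exact isClosed_univ
    · exact isClosed_Icc
  rw [IntegrableOn, integrable_indicator_iff hm, IntegrableOn, Measure.restrict_restrict hm]
  have h1 : {x : ℝ | |x| ≤ A} = Icc (-A) A := by
    ext x; exact abs_le (a := x) (b := A)
  rw [h1]
  exact hg.integrableOn_compact_subset inter_subset_right (isCompact_Icc.inter_right hcl)

lemma integrable_inner_of_bounded {g : ℝ → State m} (hg : LocallyIntegrableOn g Λ.cell)
    {φ : ℝ → State m} (hφ : AEStronglyMeasurable φ (volume.restrict Λ.cell)) {M A : ℝ}
    (hM : ∀ x, ‖φ x‖ ≤ M) (hA : ∀ x ∈ Λ.cell, A < |x| → φ x = 0) :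
    Integrable (fun x => inner ℝ (g x) (φ x)) (volume.restrict Λ.cell) := by
  refine ((integrableOn_box hg A).norm.const_mul M).mono'
    (hg.aestronglyMeasurable.inner hφ) ?_
  filter_upwards [ae_restrict_mem Λ.measurableSet_cell] with x hx
  by_cases hxA : |x| ≤ A
  · rw [indicator_of_mem (show x ∈ {x : ℝ | |x| ≤ A} from hxA), mul_comm]
    exact (norm_inner_le_norm _ _).trans (mul_le_mul_of_nonneg_left (hM x) (norm_nonneg _))
  · rw [hA x hx (not_le.1 hxA), inner_zero_right, norm_zero]
    have := (norm_nonneg (φ x)).trans (hM x)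
    positivity

/-- The representative in the cell of a point of the domain; it makes functions on the cell
periodic. -/
noncomputable def SpatialDomain.representative : SpatialDomain → ℝ → ℝ
  | .line, x => x
  | .periodic, x => Int.fract x

lemma SpatialDomain.measurable_representative (Λ : SpatialDomain) :
    Measurable Λ.representative := by
  cases Λ
  · exact measurable_id
  · exact measurable_fract

lemma SpatialDomain.ae_representative_eq (Λ : SpatialDomain) :
    ∀ᵐ x ∂(volume.restrict Λ.cell), Λ.representative x = x := by
  cases Λ
  · exact Eventually.of_forall fun x => rfl
  · filter_upwards [ae_restrict_mem measurableSet_Icc,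
      ae_restrict_of_ae (compl_mem_ae_iff.2 (measure_singleton (1 : ℝ)))] with x hx h1
    exact Int.fract_eq_self.2 ⟨hx.1, lt_of_le_of_ne hx.2 h1⟩

/-- The truncation of `g`, extended periodically in the periodic case. -/
noncomputable def truncation (Λ : SpatialDomain) (g : ℝ → State m) (k : ℕ) (x : ℝ) : State m :=
  {z | ‖g z‖ ≤ k ∧ |z| ≤ k}.indicator g (Λ.representative x)

variable {g : ℝ → State m}

lemma measurable_truncation (hg : Measurable g) (k : ℕ) : Measurable (truncation Λ g k) :=
  (hg.indicator ((measurableSet_le hg.norm measurable_const).inter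
    (measurableSet_le measurable_id.norm measurable_const))).comp Λ.measurable_representative

lemma norm_truncation_le (k : ℕ) (x : ℝ) : ‖truncation Λ g k x‖ ≤ k := by
  rw [truncation]
  by_cases h : Λ.representative x ∈ {z | ‖g z‖ ≤ k ∧ |z| ≤ k}
  · rw [indicator_of_mem h]; exact h.1
  · rw [indicator_of_notMem h, norm_zero]; exact k.cast_nonneg

lemma isSpaceTest_mollify_truncation (hg : Measurable g) (k n : ℕ) :
    IsSpaceTest Λ (mollify n (truncation Λ g k)) := by
  have hloc : LocallyIntegrable (truncation Λ g k) :=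
    (locallyIntegrable_const (k : ℝ)).mono (measurable_truncation hg k).aestronglyMeasurable
      (Eventually.of_forall fun x => by simpa using norm_truncation_le k x)
  refine ⟨contDiff_mollify n hloc, ?_⟩
  cases Λ with
  | line =>
    refine HasCompactSupport.intro (isCompact_Icc (a := -((k : ℝ) + 1)) (b := k + 1)) fun x hx => ?_
    refine mollify_eq_zero n fun z hz => indicator_of_notMem (fun hzk => hx ?_) _
    have h1 : 1 / ((n : ℝ) + 1) ≤ 1 := by
      rw [div_le_one (by positivity)]; linarith [n.cast_nonneg (α := ℝ)]
    have h2 : |z| ≤ k := hzk.2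
    have h3 : |z - x| < 1 := by
      rw [← Real.dist_eq]; exact hz.trans_le h1
    rw [abs_le] at h2
    rw [abs_lt] at h3
    exact ⟨by linarith, by linarith⟩
  | periodic =>
    intro x
    refine mollify_add_period n (fun p => ?_) x
    simp [truncation, SpatialDomain.representative]

lemma mollify_truncation_eq_zero (k n : ℕ) {x : ℝ} (hx : x ∈ Λ.cell)
    (hk : (k : ℝ) + 1 < |x|) : mollify n (truncation Λ g k) x = 0 := by
  cases Λ with
  | line =>
    refine mollify_eq_zero n fun z hz => indicator_of_notMem (fun hzk => not_le.2 hk ?_) _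
    have h1 : 1 / ((n : ℝ) + 1) ≤ 1 := by
      rw [div_le_one (by positivity)]; linarith [n.cast_nonneg (α := ℝ)]
    have h2 : |z| ≤ k := hzk.2
    have h3 : |z - x| < 1 := by
      rw [← Real.dist_eq]; exact hz.trans_le h1
    have h4 := abs_sub_abs_le_abs_sub x z
    rw [abs_sub_comm] at h4
    linarith
  | periodic =>
    have : |x| ≤ 1 := abs_le.2 ⟨by linarith [hx.1], hx.2⟩
    linarith [k.cast_nonneg (α := ℝ)]

/-- A locally integrable function `g` with `∫ g·ψ ≤ (b + ‖ψ‖²) / 2` for all test functions `ψ`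
satisfies `‖g‖² ≤ b` in `L²`. The choice `ψ = g` is approximated by mollified truncations. -/
lemma lintegral_enorm_sq_le_of_measurable (hgm : Measurable g) (hg : LocallyIntegrableOn g Λ.cell)
    {b : ℝ} (h : ∀ ψ : ℝ → State m, IsSpaceTest Λ ψ →
      ∫ x in Λ.cell, inner ℝ (g x) (ψ x) ≤ b / 2 + (∫ x in Λ.cell, ‖ψ x‖ ^ 2) / 2) :
    ∫⁻ x in Λ.cell, ‖g x‖ₑ ^ 2 ≤ ENNReal.ofReal b := by
  -- the bound for the truncations of `g`
  have hk : ∀ k : ℕ, ∫⁻ x in Λ.cell, ‖truncation Λ g k x‖ₑ ^ 2 ≤ ENNReal.ofReal b := by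
    intro k
    set G := truncation Λ g k with hG
    have hGm : Measurable G := measurable_truncation hgm k
    have hloc : LocallyIntegrable G :=
      (locallyIntegrable_const (k : ℝ)).mono hGm.aestronglyMeasurable
        (Eventually.of_forall fun x => by simpa using norm_truncation_le k x)
    have hψ := fun n => isSpaceTest_mollify_truncation (Λ := Λ) hgm k n
    have hψM : ∀ n x, ‖mollify n G x‖ ≤ k := fun n x =>
      norm_mollify_le n (norm_truncation_le k) x
    have hψA : ∀ n, ∀ x ∈ Λ.cell, (k : ℝ) + 1 < |x| → mollify n G x = 0 := fun n x hx hxk =>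
      mollify_truncation_eq_zero k n hx hxk
    have hae : ∀ᵐ x ∂(volume.restrict Λ.cell), Tendsto (fun n => mollify n G x) atTop (𝓝 (G x)) :=
      ae_restrict_of_ae (ae_tendsto_mollify hloc)
    have t1 : Tendsto (fun n => ∫ x in Λ.cell, inner ℝ (g x) (mollify n G x)) atTop
        (𝓝 (∫ x in Λ.cell, inner ℝ (g x) (G x))) := by
      refine tendsto_integral_of_dominated_convergence _ (fun n =>
        hgm.aestronglyMeasurable.inner (hψ n).1.continuous.aestronglyMeasurable)
        ((integrableOn_box hg ((k : ℝ) + 1)).norm.const_mul k) (fun n => ?_) ?_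
      · filter_upwards [ae_restrict_mem Λ.measurableSet_cell] with x hx
        by_cases hxA : |x| ≤ (k : ℝ) + 1
        · rw [indicator_of_mem (show x ∈ {x : ℝ | |x| ≤ (k : ℝ) + 1} from hxA), mul_comm]
          exact (norm_inner_le_norm _ _).trans
            (mul_le_mul_of_nonneg_left (hψM n x) (norm_nonneg _))
        · rw [hψA n x hx (not_le.1 hxA), inner_zero_right, norm_zero]
          positivity
      · filter_upwards [hae] with x hx
        exact tendsto_const_nhds.inner hx
    have hb2 : ∀ n, ∀ᵐ x ∂(volume.restrict Λ.cell), ‖‖mollify n G x‖ ^ 2‖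
        ≤ {x : ℝ | |x| ≤ (k : ℝ) + 1}.indicator (fun _ => (k : ℝ) ^ 2) x := fun n => by
      filter_upwards [ae_restrict_mem Λ.measurableSet_cell] with x hx
      by_cases hxA : |x| ≤ (k : ℝ) + 1
      · rw [indicator_of_mem (show x ∈ {x : ℝ | |x| ≤ (k : ℝ) + 1} from hxA),
          Real.norm_of_nonneg (by positivity)]
        have := hψM n x
        gcongr
      · rw [indicator_of_notMem (show x ∉ {x : ℝ | |x| ≤ (k : ℝ) + 1} from hxA),
          hψA n x hx (not_le.1 hxA)]
        simp
    have t2 : Tendsto (fun n => ∫ x in Λ.cell, ‖mollify n G x‖ ^ 2) atTop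
        (𝓝 (∫ x in Λ.cell, ‖G x‖ ^ 2)) := by
      refine tendsto_integral_of_dominated_convergence _ (fun n =>
        ((hψ n).1.continuous.norm.pow 2).aestronglyMeasurable)
        (integrable_indicator_cell ((k : ℝ) + 1) ((k : ℝ) ^ 2)) hb2 ?_
      filter_upwards [hae] with x hx
      exact (hx.norm).pow 2
    -- with `ψ` replaced by the truncation `G`, for which `g · G = ‖G‖²`
    have h1 : ∫ x in Λ.cell, inner ℝ (g x) (G x) ≤ b / 2 + (∫ x in Λ.cell, ‖G x‖ ^ 2) / 2 :=
      le_of_tendsto_of_tendsto' t1 ((t2.div_const 2).const_add _) fun n => h _ (hψ n)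
    have h2 : ∫ x in Λ.cell, inner ℝ (g x) (G x) = ∫ x in Λ.cell, ‖G x‖ ^ 2 := by
      refine integral_congr_ae ?_
      filter_upwards [Λ.ae_representative_eq] with x hx
      rw [hG, truncation, hx]
      by_cases hxk : x ∈ {z | ‖g z‖ ≤ k ∧ |z| ≤ k}
      · rw [indicator_of_mem hxk, real_inner_self_eq_norm_sq]
      · rw [indicator_of_notMem hxk]; simp
    have hGi : Integrable (fun x => ‖G x‖ ^ 2) (volume.restrict Λ.cell) := by
      refine (integrable_indicator_cell ((k : ℝ) + 1) ((k : ℝ) ^ 2)).mono'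
        (hGm.norm.pow_const 2).aestronglyMeasurable ?_
      have hb3 := ae_all_iff.2 hb2
      filter_upwards [hb3, hae] with x h3 h4
      exact le_of_tendsto ((h4.norm.pow 2).norm) (Eventually.of_forall h3)
    have h3 : ∫ x in Λ.cell, ‖G x‖ ^ 2 ≤ b := by linarith
    have h4 : ∀ x, ‖G x‖ₑ ^ 2 = ENNReal.ofReal (‖G x‖ ^ 2) := fun x => by
      rw [ENNReal.ofReal_pow (norm_nonneg _), ofReal_norm]
    simp only [h4]
    rw [← ofReal_integral_eq_lintegral_ofReal hGi (Eventually.of_forall fun x => by positivity)]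
    exact ENNReal.ofReal_le_ofReal h3
  have hsup : ∫⁻ x in Λ.cell, ‖g x‖ₑ ^ 2
      = ∫⁻ x in Λ.cell, ⨆ k : ℕ, ‖truncation Λ g k x‖ₑ ^ 2 := by
    refine lintegral_congr_ae ?_
    filter_upwards [Λ.ae_representative_eq] with x hx
    refine le_antisymm ?_ (iSup_le fun k => ?_)
    · obtain ⟨k, hk⟩ := exists_nat_ge (max ‖g x‖ |x|)
      refine le_iSup_of_le k ?_
      rw [truncation, hx, indicator_of_mem
        (show x ∈ {z | ‖g z‖ ≤ k ∧ |z| ≤ k} from max_le_iff.1 hk)]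
    · rw [truncation, hx]
      gcongr
      exact enorm_indicator_le_enorm_self _ _
  rw [hsup, lintegral_iSup (fun k => (measurable_truncation hgm k).enorm.pow_const 2)]
  · exact iSup_le hk
  · intro k k' hkk x
    have hc : (k : ℝ) ≤ k' := Nat.cast_le.2 hkk
    simp only [truncation]
    gcongr
    by_cases hx : Λ.representative x ∈ {z | ‖g z‖ ≤ k ∧ |z| ≤ k}
    · rw [indicator_of_mem hx, indicator_of_mem
        (show Λ.representative x ∈ {z | ‖g z‖ ≤ k' ∧ |z| ≤ k'} from
          ⟨hx.1.trans hc, hx.2.trans hc⟩)]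
    · rw [indicator_of_notMem hx]; simp

lemma lintegral_enorm_sq_le (hg : LocallyIntegrableOn g Λ.cell)
    {b : ℝ} (h : ∀ ψ : ℝ → State m, IsSpaceTest Λ ψ →
      ∫ x in Λ.cell, inner ℝ (g x) (ψ x) ≤ b / 2 + (∫ x in Λ.cell, ‖ψ x‖ ^ 2) / 2) :
    ∫⁻ x in Λ.cell, ‖g x‖ₑ ^ 2 ≤ ENNReal.ofReal b := by
  have hm := hg.aestronglyMeasurable
  have heq := hm.ae_eq_mk
  have h1 : ∫⁻ x in Λ.cell, ‖g x‖ₑ ^ 2 = ∫⁻ x in Λ.cell, ‖hm.mk g x‖ₑ ^ 2 := by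
    refine lintegral_congr_ae ?_
    filter_upwards [heq] with x hx
    rw [hx]
  rw [h1]
  refine lintegral_enorm_sq_le_of_measurable hm.stronglyMeasurable_mk.measurable ?_
    fun ψ hψ => ?_
  · intro x hx
    obtain ⟨s, hs, hsi⟩ := hg x hx
    refine ⟨s ∩ Λ.cell, inter_mem hs self_mem_nhdsWithin, ?_⟩
    exact (hsi.mono_set inter_subset_left).congr_fun_ae
      (ae_restrict_of_ae_restrict_of_subset inter_subset_right heq)
  · refine le_trans (le_of_eq (integral_congr_ae ?_)) (h ψ hψ)
    filter_upwards [heq] with x hx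
    rw [hx]

end Duality

section FixedTime

variable {m : ℕ} {U C : Set (State m)} {f : State m → State m} {η q : State m → ℝ}
  {CF ηlow ηup : ℝ} {Λ : SpatialDomain} {T : ℝ} {u₀ : ℝ → State m} {u : ℝ → ℝ → State m}
  {v : ℝ × ℝ → State m} {ψ : ℝ → State m}

lemma IsLipschitzField.continuous_integral_inner (hC : IsCompact C) (hv : IsLipschitzField Λ C v)
    (hψ : IsSpaceTest Λ ψ) :
    Continuous fun t => ∫ x in Λ.cell, inner ℝ (v (t, x)) (ψ x) := by
  obtain ⟨A, hA⟩ := hψ.exists_bound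
  obtain ⟨M, hM⟩ := hψ.exists_norm_le
  obtain ⟨M', hM'⟩ := hC.isBounded.exists_norm_le
  refine continuous_of_dominated (bound := {x : ℝ | |x| ≤ A}.indicator fun _ => M' * M)
    (fun t => ?_) (fun t => ?_) (integrable_indicator_cell A (M' * M))
    (Eventually.of_forall fun x => ?_)
  · exact ((hv.continuous.comp (by fun_prop : Continuous fun x : ℝ => (t, x))).inner
      hψ.1.continuous).aestronglyMeasurable
  · filter_upwards [ae_restrict_mem Λ.measurableSet_cell] with x hx
    by_cases hxA : |x| ≤ A
    · rw [indicator_of_mem (show x ∈ {x : ℝ | |x| ≤ A} from hxA)]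
      have h1 := hM' _ (hv.mem (t, x))
      exact (norm_inner_le_norm _ _).trans
        (mul_le_mul h1 (hM x) (norm_nonneg _) ((norm_nonneg _).trans h1))
    · rw [indicator_of_notMem (show x ∉ {x : ℝ | |x| ≤ A} from hxA), hA x hx (not_le.1 hxA)]
      simp
  · exact (hv.continuous.comp (by fun_prop : Continuous fun t : ℝ => (t, x))).inner
      continuous_const

lemma IsLipschitzField.locallyIntegrableOn (hv : IsLipschitzField Λ C v) (t : ℝ) :
    LocallyIntegrableOn (fun x => v (t, x)) Λ.cell :=
  (hv.continuous.comp
    (by fun_prop : Continuous fun x : ℝ => (t, x))).locallyIntegrable.locallyIntegrableOn _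

lemma integral_inner_le_of_lintegral_le {g : ℝ → State m} (hg : LocallyIntegrableOn g Λ.cell)
    (hψ : IsSpaceTest Λ ψ) {b : ℝ} (hb : 0 ≤ b)
    (h : ∫⁻ x in Λ.cell, ‖g x‖ₑ ^ 2 ≤ ENNReal.ofReal b) :
    ∫ x in Λ.cell, inner ℝ (g x) (ψ x) ≤ b / 2 + (∫ x in Λ.cell, ‖ψ x‖ ^ 2) / 2 := by
  obtain ⟨A, hA⟩ := hψ.exists_bound
  obtain ⟨M, hM⟩ := hψ.exists_norm_le
  have hψc := hψ.1.continuous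
  have e1 : ∀ x, ‖g x‖ₑ ^ 2 = ENNReal.ofReal (‖g x‖ ^ 2) := fun x => by
    rw [ENNReal.ofReal_pow (norm_nonneg _), ofReal_norm]
  simp only [e1] at h
  have hgm : AEStronglyMeasurable (fun x => ‖g x‖ ^ 2) (volume.restrict Λ.cell) :=
    hg.aestronglyMeasurable.norm.pow 2
  have ig : Integrable (fun x => ‖g x‖ ^ 2) (volume.restrict Λ.cell) := by
    refine ⟨hgm, ?_⟩
    rw [hasFiniteIntegral_iff_ofReal (Eventually.of_forall fun x => by positivity)]
    exact h.trans_lt ENNReal.ofReal_lt_top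
  have iψ : Integrable (fun x => ‖ψ x‖ ^ 2) (volume.restrict Λ.cell) := by
    have := integrable_inner_of_bounded (Λ := Λ) (g := ψ)
      (hψc.locallyIntegrable.locallyIntegrableOn _) hψc.aestronglyMeasurable hM hA
    simpa only [real_inner_self_eq_norm_sq] using this
  have hgb : ∫ x in Λ.cell, ‖g x‖ ^ 2 ≤ b := by
    rw [← ofReal_integral_eq_lintegral_ofReal ig (Eventually.of_forall fun x => by positivity)] at h
    exact (ENNReal.ofReal_le_ofReal_iff hb).1 h
  have h1 : ∫ x in Λ.cell, inner ℝ (g x) (ψ x)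
      ≤ ∫ x in Λ.cell, (‖g x‖ ^ 2 / 2 + ‖ψ x‖ ^ 2 / 2) := by
    refine integral_mono (integrable_inner_of_bounded hg hψc.aestronglyMeasurable hM hA)
      ((ig.div_const 2).add (iψ.div_const 2)) fun x => ?_
    have := real_inner_le_norm (g x) (ψ x)
    simp only
    nlinarith [sq_nonneg (‖g x‖ - ‖ψ x‖)]
  rw [integral_add (ig.div_const 2) (iψ.div_const 2), integral_div, integral_div] at h1
  linarith

/-- The `L²` distance is lower semicontinuous along functions which are continuous in time in the
sense of distributions; a bound for almost every time thus holds for every time. -/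
lemma lintegral_sub_field_le_of_ae (hC : IsCompact C) (hv : IsLipschitzField Λ C v) {τ : ℝ}
    (hτ : 0 < τ) (hloc : ∀ t ∈ Icc 0 τ, LocallyIntegrableOn (u t) Λ.cell)
    (hcont : ∀ ψ : ℝ → State m, IsSpaceTest Λ ψ →
      ContinuousOn (fun t => ∫ x in Λ.cell, inner ℝ (u t x) (ψ x)) (Icc 0 τ))
    {E : ℝ≥0∞} (h : ∀ᵐ s : ℝ, s ∈ Ioo 0 τ → ∫⁻ x in Λ.cell, ‖u s x - v (s, x)‖ₑ ^ 2 ≤ E)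
    {t : ℝ} (ht : t ∈ Icc 0 τ) : ∫⁻ x in Λ.cell, ‖u t x - v (t, x)‖ₑ ^ 2 ≤ E := by
  rcases eq_or_ne E ⊤ with rfl | hE
  · exact le_top
  rw [← ENNReal.ofReal_toReal hE] at h ⊢
  set b := E.toReal
  have hg : ∀ s ∈ Icc 0 τ, LocallyIntegrableOn (fun x => u s x - v (s, x)) Λ.cell :=
    fun s hs => (hloc s hs).sub (hv.locallyIntegrableOn s)
  refine lintegral_enorm_sq_le (hg t ht) fun ψ hψ => ?_
  obtain ⟨A, hA⟩ := hψ.exists_bound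
  obtain ⟨M, hM⟩ := hψ.exists_norm_le
  have hGc : ContinuousOn (fun s => ∫ x in Λ.cell, inner ℝ (u s x - v (s, x)) (ψ x))
      (Icc 0 τ) := by
    refine ((hcont ψ hψ).sub (hv.continuous_integral_inner hC hψ).continuousOn).congr
      fun s hs => ?_
    simp only [inner_sub_left]
    exact integral_sub
      (integrable_inner_of_bounded (hloc s hs) hψ.1.continuous.aestronglyMeasurable hM hA)
      (integrable_inner_of_bounded (hv.locallyIntegrableOn s)
        hψ.1.continuous.aestronglyMeasurable hM hA)
  have hd := Measure.dense_of_ae h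
  -- times at which the bound holds are dense in `[0,τ]`
  have hcl : t ∈ closure (Ioo 0 τ ∩ {s : ℝ | s ∈ Ioo 0 τ →
      ∫⁻ x in Λ.cell, ‖u s x - v (s, x)‖ₑ ^ 2 ≤ ENNReal.ofReal b}) := by
    refine closure_minimal (hd.open_subset_closure_inter isOpen_Ioo) isClosed_closure ?_
    rw [closure_Ioo hτ.ne]
    exact ht
  refine ContinuousWithinAt.closure_le hcl ((hGc t ht).mono fun s hs => Ioo_subset_Icc_self hs.1)
    continuousWithinAt_const fun s hs => ?_
  exact integral_inner_le_of_lintegral_le (hg s (Ioo_subset_Icc_self hs.1)) hψ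
    ENNReal.toReal_nonneg (hs.2 hs.1)

lemma isLipschitzTest_timeCutoff_smul {s δ : ℝ} (hδ : 0 < δ) (hT : s + δ < T)
    (hψ : IsSpaceTest Λ ψ) : IsLipschitzTest Λ T fun p => timeCutoff s δ p.1 • ψ p.2 := by
  obtain ⟨L₁, hL₁⟩ := exists_lipschitzWith_timeCutoff (s := s) hδ
  obtain ⟨M, hM⟩ := hψ.exists_norm_le
  obtain ⟨M', hM'⟩ := hψ.exists_norm_deriv_le
  have hM0 : 0 ≤ M := (norm_nonneg _).trans (hM 0)
  have hM'0 : 0 ≤ M' := (norm_nonneg _).trans (hM' 0)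
  have hψL : LipschitzWith M'.toNNReal ψ :=
    lipschitzWith_of_nnnorm_deriv_le (hψ.1.differentiable (by simp)) fun x =>
      NNReal.coe_le_coe.1 (by simpa [Real.coe_toNNReal M' hM'0] using hM' x)
  refine ⟨⟨L₁ * M.toNNReal + M'.toNNReal, LipschitzWith.of_dist_le_mul fun p p' => ?_⟩,
    ⟨-1, s + δ, hT, fun t x ht => by simp [timeCutoff_eq_zero hδ ht]⟩, ?_⟩
  · have h1 := hL₁.dist_le_mul p.1 p'.1
    have h2 := hψL.dist_le_mul p.2 p'.2
    have h3 : dist p.1 p'.1 ≤ dist p p' := le_max_left _ _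
    have h3' : dist p.2 p'.2 ≤ dist p p' := le_max_right _ _
    rw [Real.dist_eq] at h1
    rw [dist_eq_norm] at h2 ⊢
    have h4 : timeCutoff s δ p.1 • ψ p.2 - timeCutoff s δ p'.1 • ψ p'.2
        = (timeCutoff s δ p.1 - timeCutoff s δ p'.1) • ψ p.2
          + timeCutoff s δ p'.1 • (ψ p.2 - ψ p'.2) := by
      rw [sub_smul, smul_sub]; abel
    rw [h4]
    refine (norm_add_le _ _).trans ?_
    rw [norm_smul, norm_smul, Real.norm_eq_abs, Real.norm_of_nonneg (timeCutoff_nonneg p'.1)]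
    push_cast
    rw [Real.coe_toNNReal M' hM'0] at h2 ⊢
    rw [Real.coe_toNNReal M hM0, add_mul]
    refine add_le_add ?_ ?_
    · have : |timeCutoff s δ p.1 - timeCutoff s δ p'.1| * ‖ψ p.2‖ ≤ (L₁ * dist p p') * M :=
        mul_le_mul (h1.trans (mul_le_mul_of_nonneg_left h3 L₁.2)) (hM _) (norm_nonneg _)
          (by positivity)
      refine this.trans (le_of_eq ?_)
      ring
    · exact (mul_le_of_le_one_left (norm_nonneg _) (timeCutoff_le_one _)).trans
        (h2.trans (mul_le_mul_of_nonneg_left h3' hM'0))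
  · have hs := hψ.2
    have hbd := hψ.exists_bound
    cases Λ with
    | line =>
      obtain ⟨A, hA⟩ := hbd
      exact ⟨A, fun t x hx => by simp [hA x (mem_univ x) hx]⟩
    | periodic =>
      intro t x
      simp only [hs x]

lemma ae_snd_of_ae_cell {P : ℝ → Prop} (h : ∀ᵐ x ∂(volume.restrict Λ.cell), P x) :
    ∀ᵐ p ∂(spaceTimeMeasure Λ T), P p.2 :=
  (Measure.quasiMeasurePreserving_snd (μ := volume.restrict (Ioo 0 T))
    (ν := volume.restrict Λ.cell)).ae h

lemma integrable_inner_spaceTime {a : ℝ × ℝ → State m} {φ : ℝ → State m} {Ma Mφ A : ℝ}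
    (ha : AEStronglyMeasurable a (spaceTimeMeasure Λ T))
    (haM : ∀ᵐ p ∂(spaceTimeMeasure Λ T), ‖a p‖ ≤ Ma) (hφ : Continuous φ)
    (hφM : ∀ x, ‖φ x‖ ≤ Mφ) (hφA : ∀ᵐ x ∂(volume.restrict Λ.cell), A < |x| → φ x = 0) :
    Integrable (fun p => inner ℝ (a p) (φ p.2)) (spaceTimeMeasure Λ T) := by
  refine (integrable_indicator_box A (Ma * Mφ)).mono'
    (ha.inner (hφ.comp continuous_snd).aestronglyMeasurable) ?_
  filter_upwards [haM, ae_snd_of_ae_cell hφA] with p h1 h2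
  by_cases hxA : |p.2| ≤ A
  · rw [indicator_of_mem (show p ∈ {p : ℝ × ℝ | |p.2| ≤ A} from hxA)]
    exact (norm_inner_le_norm _ _).trans
      (mul_le_mul h1 (hφM _) (norm_nonneg _) ((norm_nonneg _).trans h1))
  · rw [indicator_of_notMem (show p ∉ {p : ℝ × ℝ | |p.2| ≤ A} from hxA), h2 (not_le.1 hxA)]
    simp

namespace IsEntropySolutionIn

/-- The time-continuous representative attains the initial datum. -/
lemma ae_initial_eq (h : IsConvexEntropySystem U C f η q CF ηlow ηup)
    (hu : IsEntropySolutionIn Λ T C f η q u₀ u) (hT : 0 < T)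
    (hloc : LocallyIntegrableOn (u 0) Λ.cell)
    (hcont : ∀ ψ : ℝ → State m, IsSpaceTest Λ ψ →
      ContinuousOn (fun t => ∫ x in Λ.cell, inner ℝ (u t x) (ψ x)) (Icc 0 T)) :
    ∀ᵐ x ∂(volume.restrict Λ.cell), u 0 x = u₀ x := by
  have hcf := h.flux.continuousOn.mono h.subset
  obtain ⟨M₁, hM₁⟩ := h.isCompact.isBounded.exists_norm_le
  obtain ⟨M₂, hM₂⟩ := h.isCompact.exists_bound_of_continuousOn hcf
  have hfm := aestronglyMeasurable_comp_of_continuousOn h.isCompact.isClosed hcf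
    hu.measurable hu.mem
  have huM : ∀ᵐ p ∂(spaceTimeMeasure Λ T), ‖u p.1 p.2‖ ≤ max M₁ M₂ :=
    hu.mem.mono fun p hp => (hM₁ _ hp).trans (le_max_left _ _)
  have hfM : ∀ᵐ p ∂(spaceTimeMeasure Λ T), ‖f (u p.1 p.2)‖ ≤ max M₁ M₂ :=
    hu.mem.mono fun p hp => (hM₂ _ hp).trans (le_max_right _ _)
  have hu₀M : ∀ᵐ x ∂(volume.restrict Λ.cell), ‖u₀ x‖ ≤ max M₁ M₂ :=
    hu.mem_initial.mono fun x hx => (hM₁ _ hx).trans (le_max_left _ _)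
  have hloc₀ : LocallyIntegrableOn u₀ Λ.cell := by
    have h1 := (locallyIntegrable_const (μ := volume.restrict Λ.cell) (max M₁ M₂)).mono
      hu.measurable_initial (hu₀M.mono fun x hx => hx.trans (le_abs_self _))
    exact locallyIntegrableOn_of_locallyIntegrable_restrict h1
  -- test with the time cutoff times `ψ` and let the time tend to `0`; an inequality suffices, as
  -- `ψ` can be replaced by `-ψ`
  have key : ∀ ψ : ℝ → State m, IsSpaceTest Λ ψ →
      ∫ x in Λ.cell, inner ℝ (u 0 x) (ψ x) ≤ ∫ x in Λ.cell, inner ℝ (u₀ x) (ψ x) := by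
    intro ψ hψ
    obtain ⟨A, hA⟩ := hψ.exists_bound
    obtain ⟨M, hM⟩ := hψ.exists_norm_le
    obtain ⟨M', hM'⟩ := hψ.exists_norm_deriv_le
    have hψd : Continuous (deriv ψ) := hψ.1.continuous_deriv (by simp)
    have hA' : ∀ᵐ x ∂(volume.restrict Λ.cell), max A 1 < |x| → deriv ψ x = 0 := by
      filter_upwards [ae_restrict_mem Λ.measurableSet_cell] with x hx hxA
      cases Λ with
      | line =>
        have : ψ =ᶠ[𝓝 x] fun _ => 0 := by
          filter_upwards [continuous_abs.continuousAt.eventually_mem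
            (Ioi_mem_nhds ((le_max_left A 1).trans_lt hxA))] with z hz
          exact hA z (mem_univ z) hz
        rw [this.deriv_eq, deriv_const]
      | periodic =>
        have h1 : |x| ≤ 1 := abs_le.2 ⟨by linarith [hx.1], hx.2⟩
        exact absurd (h1.trans (le_max_right A 1)) (not_le.2 hxA)
    have iK := integrable_inner_spaceTime hu.measurable huM hψ.1.continuous hM
      ((ae_restrict_mem Λ.measurableSet_cell).mono hA)
    have iJ := integrable_inner_spaceTime hfm hfM hψd hM' hA'
    set K : ℝ × ℝ → ℝ := fun p => inner ℝ (u p.1 p.2) (ψ p.2) with hK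
    set J : ℝ × ℝ → ℝ := fun p => inner ℝ (f (u p.1 p.2)) (deriv ψ p.2) with hJ
    have hmain : ∀ s δ, 0 < s → 0 < δ → s + δ < T →
        1 / δ * ∫ t in s..(s + δ), ∫ x in Λ.cell, K (t, x)
          ≤ (∫ x in Λ.cell, inner ℝ (u₀ x) (ψ x))
            + ∫ t in 0..(s + δ), ∫ x in Λ.cell, ‖J (t, x)‖ := by
      intro s δ hs hδ hsT
      have hw := hu.weak.integral_lipschitz (isLipschitzTest_timeCutoff_smul hδ hsT hψ)
        hu.measurable hfm huM hfM hu.measurable_initial hu₀M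
      simp only [timeCutoff_eq_one hδ (show (0 : ℝ) ∈ Icc 0 s from ⟨le_rfl, hs.le⟩),
        one_smul] at hw
      have i1 := integrable_timeCutoffDeriv_mul (s := s) hδ iK
      have i2 := integrable_timeCutoff_mul (s := s) hδ iJ
      have i3 := integrable_timeCutoff_mul (s := s) hδ iJ.norm
      have h1 : ∫ p, (inner ℝ (u p.1 p.2)
            (fderiv ℝ (fun p : ℝ × ℝ => timeCutoff s δ p.1 • ψ p.2) p (1, 0))
          + inner ℝ (f (u p.1 p.2))
            (fderiv ℝ (fun p : ℝ × ℝ => timeCutoff s δ p.1 • ψ p.2) p (0, 1)))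
            ∂(spaceTimeMeasure Λ T)
          = ∫ p, (timeCutoffDeriv s δ p.1 * K p + timeCutoff s δ p.1 * J p)
            ∂(spaceTimeMeasure Λ T) := by
        refine integral_congr_ae ?_
        filter_upwards [ae_spaceTimeMeasure_mem Λ T,
          ae_fst_of_ae (compl_mem_ae_iff.2 (measure_singleton s)),
          ae_fst_of_ae (compl_mem_ae_iff.2 (measure_singleton (s + δ)))] with p h4 h5 h6
        have hd := (hasDerivAt_timeCutoff hs hδ h4.1.1 h5 h6).hasFDerivAt.comp p
          hasFDerivAt_fst
        have hd2 := ((hψ.1.differentiable (by simp)) p.2).hasDerivAt.hasFDerivAt.comp p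
          hasFDerivAt_snd
        have hd3 := hd.smul hd2
        have hd4 : HasFDerivAt (fun p : ℝ × ℝ => timeCutoff s δ p.1 • ψ p.2) _ p := hd3
        rw [hd4.fderiv]
        simp [hK, hJ, inner_smul_right]
      rw [h1, integral_add i1 i2, integral_deriv_timeCutoff_mul hs hδ hsT iK] at hw
      have h2 := integral_timeCutoff_mul_le hs hδ hsT iJ.norm fun p => norm_nonneg _
      have h3 : ∫ p, timeCutoff s δ p.1 * J p ∂(spaceTimeMeasure Λ T)
          ≤ ∫ p, timeCutoff s δ p.1 * ‖J p‖ ∂(spaceTimeMeasure Λ T) :=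
        integral_mono i2 i3 fun p =>
          mul_le_mul_of_nonneg_left (le_abs_self _) (timeCutoff_nonneg _)
      linarith
    have hae := ae_le_of_average_le iK.integral_prod_left iJ.norm.integral_prod_left hmain
    have hβ : ContinuousOn (fun s => ∫ t in 0..s, ∫ x in Λ.cell, ‖J (t, x)‖) (Icc 0 T) := by
      have h1 := intervalIntegral.continuousOn_primitive_interval'
        (intervalIntegrable_iff_integrableOn_Ioo_of_le hT.le |>.2 iJ.norm.integral_prod_left)
        (left_mem_uIcc)
      rwa [uIcc_of_le hT.le] at h1
    have hd := Measure.dense_of_ae hae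
    have hcl := closure_minimal (hd.open_subset_closure_inter isOpen_Ioo) isClosed_closure
      (by rw [closure_Ioo hT.ne]; exact left_mem_Icc.2 hT.le : (0 : ℝ) ∈ closure (Ioo 0 T))
    have h0 : (0 : ℝ) ∈ Icc 0 T := left_mem_Icc.2 hT.le
    have hle := ContinuousWithinAt.closure_le hcl
      ((hcont ψ hψ 0 h0).mono fun s hs => Ioo_subset_Icc_self hs.1)
      (((continuousOn_const (c := ∫ x in Λ.cell, inner ℝ (u₀ x) (ψ x))).add hβ 0 h0).mono
        fun s hs => Ioo_subset_Icc_self hs.1) fun s hs => hs.2 hs.1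
    simpa using hle
  -- the dual characterization of the `L²` norm with `b = 0`
  have h0 : ∫⁻ x in Λ.cell, ‖u 0 x - u₀ x‖ₑ ^ 2 ≤ ENNReal.ofReal 0 := by
    refine lintegral_enorm_sq_le (hloc.sub hloc₀) fun ψ hψ => ?_
    obtain ⟨A, hA⟩ := hψ.exists_bound
    obtain ⟨M, hM⟩ := hψ.exists_norm_le
    have h1 := key ψ hψ
    have h2 : ∫ x in Λ.cell, inner ℝ (u 0 x - u₀ x) (ψ x)
        = (∫ x in Λ.cell, inner ℝ (u 0 x) (ψ x)) - ∫ x in Λ.cell, inner ℝ (u₀ x) (ψ x) := by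
      simp only [inner_sub_left]
      exact integral_sub
        (integrable_inner_of_bounded hloc hψ.1.continuous.aestronglyMeasurable hM hA)
        (integrable_inner_of_bounded hloc₀ hψ.1.continuous.aestronglyMeasurable hM hA)
    have h3 : 0 ≤ ∫ x in Λ.cell, ‖ψ x‖ ^ 2 := integral_nonneg fun x => by positivity
    simp only [Pi.sub_apply]
    linarith
  rw [ENNReal.ofReal_zero, nonpos_iff_eq_zero, lintegral_eq_zero_iff'
    (show AEMeasurable (fun x => ‖u 0 x - u₀ x‖ₑ ^ 2) (volume.restrict Λ.cell) from
      (hloc.aestronglyMeasurable.sub hu.measurable_initial).enorm.pow_const 2)] at h0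
  filter_upwards [h0] with x hx
  have : ‖u 0 x - u₀ x‖ₑ = 0 := by simpa using hx
  rwa [enorm_eq_zero, sub_eq_zero] at this

/-- The stability estimate at every time, for a solution which is continuous in time in the sense
of distributions. -/
theorem stability (h : IsConvexEntropySystem U C f η q CF ηlow ηup)
    (hu : IsEntropySolutionIn Λ T C f η q u₀ u) (hv : IsLipschitzField Λ C v) (hT : 0 < T)
    (hloc : ∀ t ∈ Icc 0 T, LocallyIntegrableOn (u t) Λ.cell)
    (hcont : ∀ ψ : ℝ → State m, IsSpaceTest Λ ψ →
      ContinuousOn (fun t => ∫ x in Λ.cell, inner ℝ (u t x) (ψ x)) (Icc 0 T))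
    {ℓ : ℝ → ℝ} {B : ℝ} (hℓm : Measurable ℓ) (hℓ0 : ∀ t, 0 ≤ ℓ t) (hℓB : ∀ t, ℓ t ≤ B)
    (hℓ : ∀ᵐ p ∂(spaceTimeMeasure Λ T), ‖fderiv ℝ v p (0, 1)‖ ≤ ℓ p.1)
    {τ : ℝ} (hτ : τ ∈ Icc 0 T) :
    ∫⁻ x in Λ.cell, ‖u τ x - v (τ, x)‖ₑ ^ 2 ≤ (ENNReal.ofReal ηlow)⁻¹
      * (ENNReal.ofReal ηup * (∫⁻ x in Λ.cell, ‖u₀ x - v (0, x)‖ₑ ^ 2)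
        + ∫⁻ t in Ioo 0 τ, ∫⁻ x in Λ.cell, ‖fieldResidual f v (t, x)‖ₑ ^ 2)
      * ENNReal.ofReal (Real.exp (∫ t in 0..τ, ηlow⁻¹ * (ηup * CF * ℓ t + ηup ^ 2))) := by
  rcases hτ.1.eq_or_lt with rfl | hτ0
  -- at the time `0` the solution equals the initial datum, and `1 ≤ ηup / ηlow`
  · have h1 : ∫⁻ x in Λ.cell, ‖u 0 x - v (0, x)‖ₑ ^ 2
        = ∫⁻ x in Λ.cell, ‖u₀ x - v (0, x)‖ₑ ^ 2 := by
      refine lintegral_congr_ae ?_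
      filter_upwards [hu.ae_initial_eq h hT (hloc 0 hτ) hcont] with x hx
      rw [hx]
    have h2 : 1 ≤ (ENNReal.ofReal ηlow)⁻¹ * ENNReal.ofReal ηup := by
      rw [mul_comm, ← div_eq_mul_inv, ENNReal.le_div_iff_mul_le
        (Or.inl (by simpa using h.low_pos)) (Or.inl ENNReal.ofReal_ne_top), one_mul]
      exact ENNReal.ofReal_le_ofReal h.low_le_up
    simp only [Ioo_self, Measure.restrict_empty, lintegral_zero_measure, add_zero,
      intervalIntegral.integral_same, Real.exp_zero, ENNReal.ofReal_one, mul_one]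
    rw [h1, ← mul_assoc]
    exact le_mul_of_one_le_left' h2
  · exact lintegral_sub_field_le_of_ae h.isCompact hv hτ0
      (fun t ht => hloc t ⟨ht.1, ht.2.trans hτ.2⟩)
      (fun ψ hψ => (hcont ψ hψ).mono (Icc_subset_Icc_right hτ.2))
      (hu.ae_stability h hv hT hℓm hℓ0 hℓB hℓ hτ.2) (right_mem_Icc.2 hτ.1)

end IsEntropySolutionIn

end FixedTime

/-! ### The reconstruction as a Lipschitz field -/

section Reconstruction

variable {m N r : ℕ} {Λ : SpatialDomain} {T : ℝ} {w : ℝ → ℝ → State m}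

/-- The extension of a function of `(t,x) ∈ [0,T] × ℝ` to all times which is constant in time
outside `[0,T]`. -/
noncomputable def timeExtension {V : Type*} (T : ℝ) (w : ℝ → ℝ → V) (p : ℝ × ℝ) : V :=
  w (max 0 (min p.1 T)) p.2

lemma max_min_mem (hT : 0 < T) (t : ℝ) : max 0 (min t T) ∈ Icc 0 T :=
  ⟨le_max_left _ _, max_le hT.le (min_le_right _ _)⟩

lemma max_min_eq {t : ℝ} (ht : t ∈ Icc 0 T) : max 0 (min t T) = t := by
  rw [min_eq_left ht.2, max_eq_right ht.1]

lemma timeExtension_eq {V : Type*} {w : ℝ → ℝ → V} {t : ℝ} (ht : t ∈ Icc 0 T) (x : ℝ) :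
    timeExtension T w (t, x) = w t x := by
  simp only [timeExtension, max_min_eq ht]

namespace IsLipschitzReconstruction

lemma exists_lipschitzWith (hw : IsLipschitzReconstruction Λ T w) (hT : 0 < T) :
    ∃ L : ℝ≥0, LipschitzWith L (timeExtension T w) := by
  obtain ⟨L, hL⟩ := hw.1
  have hc : LipschitzWith 1 fun p : ℝ × ℝ => (max 0 (min p.1 T), p.2) := by
    have h1 : LipschitzWith 1 fun t : ℝ => max 0 (min t T) :=
      (LipschitzWith.id.min_const T).const_max 0
    have h2 := (h1.comp (LipschitzWith.prod_fst (α := ℝ) (β := ℝ))).prodMk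
      (LipschitzWith.prod_snd (α := ℝ) (β := ℝ))
    simpa using h2
  refine ⟨L, lipschitzOnWith_univ.1 ?_⟩
  have := hL.comp hc.lipschitzOnWith (s := univ) fun p _ => ⟨max_min_mem hT p.1, mem_univ _⟩
  rw [mul_one] at this
  exact this

end IsLipschitzReconstruction

lemma apply_fract_of_periodic {α : Type*} {g : ℝ → α} (hg : Function.Periodic g 1) (x : ℝ) :
    g (Int.fract x) = g x := by
  have := hg.sub_int_mul_eq (x := x) ⌊x⌋
  rwa [mul_one] at this

variable {node : Fin N → Fin (r + 1) → ℝ} {st : MultiIndex N r → ℝ → ℝ → State m}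

lemma timeExtension_stsReconstruction (y : Param N) (p : ℝ × ℝ) :
    timeExtension T (fun t x => stsReconstruction node st t x y) p
      = ∑ k, lagrangePoly node k y • timeExtension T (st k) p := rfl

lemma continuous_lagrangePoly (node : Fin N → Fin (r + 1) → ℝ) (k : MultiIndex N r) :
    Continuous (lagrangePoly node k) :=
  continuous_finsetProd _ fun i _ => (Polynomial.continuous _).comp (continuous_apply i)

lemma lagrangePoly_collocationPoint (hnode : ∀ i, Function.Injective (node i))
    (k k' : MultiIndex N r) :
    lagrangePoly node k (collocationPoint node k') = if k = k' then 1 else 0 := by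
  split_ifs with h
  · subst h
    exact Finset.prod_eq_one fun i _ => Lagrange.eval_basis_self (hnode i).injOn (Finset.mem_univ _)
  · obtain ⟨i, hi⟩ := Function.ne_iff.1 h
    exact Finset.prod_eq_zero (Finset.mem_univ i)
      (Lagrange.eval_basis_of_ne hi (Finset.mem_univ _))

lemma stsReconstruction_collocationPoint (hnode : ∀ i, Function.Injective (node i))
    (k : MultiIndex N r) (t x : ℝ) :
    stsReconstruction node st t x (collocationPoint node k) = st k t x := by
  simp [stsReconstruction, interpolant, lagrangePoly_collocationPoint hnode]

lemma compatible_stsReconstruction (hst : ∀ k, IsLipschitzReconstruction Λ T (st k))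
    (y : Param N) (t : ℝ) : Λ.Compatible fun x => stsReconstruction node st t x y := by
  cases Λ with
  | line => trivial
  | periodic =>
    intro x
    refine Finset.sum_congr rfl fun k _ => ?_
    have h : st k t (x + 1) = st k t x := (hst k).2 t x
    simp only [h]

lemma lipschitzWith_timeExtension_stsReconstruction {L : MultiIndex N r → ℝ≥0}
    (hL : ∀ k, LipschitzWith (L k) (timeExtension T (st k))) (y : Param N) :
    LipschitzWith (∑ k, ‖lagrangePoly node k y‖₊ * L k)
      (timeExtension T fun t x => stsReconstruction node st t x y) := by
  refine LipschitzWith.of_dist_le_mul fun p p' => ?_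
  rw [timeExtension_stsReconstruction, timeExtension_stsReconstruction, dist_eq_norm,
    ← Finset.sum_sub_distrib]
  push_cast
  rw [Finset.sum_mul]
  refine (norm_sum_le _ _).trans (Finset.sum_le_sum fun k _ => ?_)
  rw [← smul_sub, norm_smul, mul_assoc, ← dist_eq_norm]
  exact mul_le_mul_of_nonneg_left ((hL k).dist_le_mul p p') (norm_nonneg _)

lemma isLipschitzField_stsReconstruction (hT : 0 < T)
    (hst : ∀ k, IsLipschitzReconstruction Λ T (st k)) {C : Set (State m)} {y : Param N}
    (hC : ∀ t ∈ Icc 0 T, ∀ x ∈ Λ.cell, stsReconstruction node st t x y ∈ C) :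
    IsLipschitzField Λ C (timeExtension T fun t x => stsReconstruction node st t x y) := by
  choose L hL using fun k => (hst k).exists_lipschitzWith hT
  have hp := fun t => compatible_stsReconstruction (node := node) hst y (max 0 (min t T))
  refine ⟨⟨_, lipschitzWith_timeExtension_stsReconstruction hL y⟩, fun p => ?_, hp⟩
  have hC' := hC _ (max_min_mem hT p.1)
  cases Λ with
  | line => exact hC' _ (mem_univ _)
  | periodic =>
    have h1 := hC' (Int.fract p.2) ⟨Int.fract_nonneg _, (Int.fract_lt_one _).le⟩
    have h2 : Function.Periodic
      (fun x => stsReconstruction node st (max 0 (min p.1 T)) x y) 1 := hp p.1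
    rw [apply_fract_of_periodic h2] at h1
    exact h1

lemma hasDerivAt_time_of_timeExtension {w : ℝ → ℝ → State m} {t x : ℝ} (ht : t ∈ Ioo 0 T)
    (h : DifferentiableAt ℝ (timeExtension T w) (t, x)) :
    HasDerivAt (fun s => w s x) (fderiv ℝ (timeExtension T w) (t, x) (1, 0)) t := by
  refine (deriv_left_eq_fderiv h).congr_of_eventuallyEq ?_
  filter_upwards [isOpen_Ioo.mem_nhds ht] with s hs
  exact (timeExtension_eq (Ioo_subset_Icc_self hs) x).symm

lemma hasDerivAt_space_of_timeExtension {w : ℝ → ℝ → State m} {t x : ℝ} (ht : t ∈ Icc 0 T)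
    (h : DifferentiableAt ℝ (timeExtension T w) (t, x)) :
    HasDerivAt (w t) (fderiv ℝ (timeExtension T w) (t, x) (0, 1)) x := by
  have := deriv_right_eq_fderiv h
  simp only [timeExtension_eq ht] at this
  exact this

/-- Where the reconstructions are differentiable, the residual of the space-time-stochastic
reconstruction is the sum of the deterministic and the stochastic residual: the flux terms at the
collocation points cancel. -/
lemma fieldResidual_eq_add {F : State m → Param N → State m} {y : Param N}
    {t x : ℝ} (ht : t ∈ Ioo 0 T)
    (hd : ∀ k, DifferentiableAt ℝ (timeExtension T (st k)) (t, x))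
    (hF : DifferentiableAt ℝ (fun z => F z y) (stsReconstruction node st t x y)) :
    fieldResidual (fun z => F z y) (timeExtension T fun t x => stsReconstruction node st t x y)
        (t, x)
      = detResidual F node st t x y + stochResidual F node st t x y := by
  have ht' := Ioo_subset_Icc_self ht
  have h1 : HasFDerivAt (timeExtension T fun t x => stsReconstruction node st t x y)
      (∑ k, lagrangePoly node k y • fderiv ℝ (timeExtension T (st k)) (t, x)) (t, x) :=
    HasFDerivAt.fun_sum fun k _ => (hd k).hasFDerivAt.const_smul (lagrangePoly node k y)
  have h2 : ∑ k, lagrangePoly node k y • fderiv ℝ (timeExtension T (st k)) (t, x) (1, 0)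
      = ∑ k, lagrangePoly node k y • deriv (fun s => st k s x) t :=
    Finset.sum_congr rfl fun k _ => by
      rw [(hasDerivAt_time_of_timeExtension ht (hd k)).deriv]
  have h3 := hasDerivAt_space_of_timeExtension ht' h1.differentiableAt
  have h4 : deriv (fun z => F (stsReconstruction node st t z y) y) x
      = fderiv ℝ (fun z => F z y) (stsReconstruction node st t x y)
        (fderiv ℝ (timeExtension T fun t x => stsReconstruction node st t x y) (t, x) (0, 1)) :=
    (HasFDerivAt.comp_hasDerivAt (l := fun z => F z y)
      (f := fun z => stsReconstruction node st t z y) x hF.hasFDerivAt h3).deriv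
  rw [fieldResidual, timeExtension_eq ht', ← h4, h1.fderiv, sum_apply]
  simp only [FunLike.coe_smul, Pi.smul_apply]
  rw [h2, detResidual, stochResidual]
  simp only [spaceTimeResidual, smul_add, Finset.sum_add_distrib]
  abel

lemma ae_fieldResidual_eq_add (hT : 0 < T) (hst : ∀ k, IsLipschitzReconstruction Λ T (st k))
    {F : State m → Param N → State m} {U : Set (State m)} (hU : IsOpen U) {y : Param N}
    (hF : ContDiffOn ℝ 2 (fun z => F z y) U)
    (hC : ∀ t ∈ Icc 0 T, ∀ x ∈ Λ.cell, stsReconstruction node st t x y ∈ U) :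
    ∀ᵐ p ∂(spaceTimeMeasure Λ T),
      fieldResidual (fun z => F z y) (timeExtension T fun t x => stsReconstruction node st t x y) p
        = detResidual F node st p.1 p.2 y + stochResidual F node st p.1 p.2 y := by
  choose L hL using fun k => (hst k).exists_lipschitzWith hT
  filter_upwards [ae_spaceTimeMeasure_mem Λ T, ae_all_iff.2 fun k =>
    ae_spaceTimeMeasure_of_ae (Λ := Λ) (T := T) (hL k).ae_differentiableAt] with p hp hd
  exact fieldResidual_eq_add hp.1 hd ((hF.differentiableOn (by norm_num)).differentiableAt
    (hU.mem_nhds (hC _ (Ioo_subset_Icc_self hp.1) _ hp.2)))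

lemma enorm_add_sq_le {V : Type*} [NormedAddCommGroup V] (a b : V) :
    ‖a + b‖ₑ ^ 2 ≤ 2 * ‖a‖ₑ ^ 2 + 2 * ‖b‖ₑ ^ 2 := by
  have h : ‖a + b‖ ^ 2 ≤ 2 * ‖a‖ ^ 2 + 2 * ‖b‖ ^ 2 := by
    have := norm_add_le a b
    nlinarith [norm_nonneg (a + b), norm_nonneg a, norm_nonneg b, sq_nonneg (‖a‖ - ‖b‖)]
  have h' := ENNReal.ofReal_le_ofReal h
  rw [ENNReal.ofReal_add (by positivity) (by positivity), ENNReal.ofReal_mul zero_le_two,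
    ENNReal.ofReal_mul zero_le_two, ENNReal.ofReal_pow (norm_nonneg _),
    ENNReal.ofReal_pow (norm_nonneg _), ENNReal.ofReal_pow (norm_nonneg _), ofReal_norm,
    ofReal_norm, ofReal_norm] at h'
  simpa using h'

/-- The deterministic residual is jointly measurable in all variables at the times `t ∈ (0,T)`. -/
lemma exists_measurable_eq_detResidual (hT : 0 < T)
    (hst : ∀ k, IsLipschitzReconstruction Λ T (st k)) {F : State m → Param N → State m}
    {C : Set (State m)} (hF : ∀ k, ContinuousOn (fun z => F z (collocationPoint node k)) C)
    (hC : ∀ k, ∀ p, timeExtension T (st k) p ∈ C) :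
    ∃ D : Param N → ℝ → ℝ → State m, Measurable (fun a : Param N × (ℝ × ℝ) => D a.1 a.2.1 a.2.2) ∧
      ∀ y, ∀ t ∈ Ioo 0 T, ∀ x, D y t x = detResidual F node st t x y := by
  choose L hL using fun k => (hst k).exists_lipschitzWith hT
  refine ⟨fun y t x => ∑ k, lagrangePoly node k y •
    (deriv (fun s => timeExtension T (st k) (s, x)) t
      + deriv (fun z => F (timeExtension T (st k) (t, z)) (collocationPoint node k)) x), ?_, ?_⟩
  · refine Finset.measurable_sum _ fun k _ => ?_
    have hk := (hL k).continuous
    have h1 := measurable_deriv_with_param (f := fun x s => timeExtension T (st k) (s, x))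
      (hk.comp continuous_swap)
    have h2 := measurable_deriv_with_param
      (f := fun t z => F (timeExtension T (st k) (t, z)) (collocationPoint node k))
      ((hF k).comp_continuous hk (hC k))
    exact ((continuous_lagrangePoly node k).measurable.comp measurable_fst).smul
      ((h1.comp (measurable_swap.comp measurable_snd)).add (h2.comp measurable_snd))
  · intro y t ht x
    refine Finset.sum_congr rfl fun k _ => ?_
    have h1 : (fun s => timeExtension T (st k) (s, x)) =ᶠ[𝓝 t] fun s => st k s x := by
      filter_upwards [isOpen_Ioo.mem_nhds ht] with s hs
      exact timeExtension_eq (Ioo_subset_Icc_self hs) x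
    simp only [spaceTimeResidual, h1.deriv_eq, timeExtension_eq (Ioo_subset_Icc_self ht)]

lemma measurable_lintegral_detResidual (hT : 0 < T)
    (hst : ∀ k, IsLipschitzReconstruction Λ T (st k)) {F : State m → Param N → State m}
    {C : Set (State m)} (hF : ∀ k, ContinuousOn (fun z => F z (collocationPoint node k)) C)
    (hC : ∀ k, ∀ p, timeExtension T (st k) p ∈ C) {τ : ℝ} (hτ : τ ≤ T) :
    Measurable fun y => ∫⁻ t in Ioo 0 τ, ∫⁻ x in Λ.cell, ‖detResidual F node st t x y‖ₑ ^ 2 := by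
  obtain ⟨D, hDm, hD⟩ := exists_measurable_eq_detResidual (F := F) (node := node) hT hst hF hC
  have h1 : (fun y => ∫⁻ t in Ioo 0 τ, ∫⁻ x in Λ.cell, ‖detResidual F node st t x y‖ₑ ^ 2)
      = fun y => ∫⁻ t in Ioo 0 τ, ∫⁻ x in Λ.cell, ‖D y t x‖ₑ ^ 2 := by
    ext y
    refine setLIntegral_congr_fun measurableSet_Ioo fun t ht => ?_
    simp only [hD y t ⟨ht.1, ht.2.trans_le hτ⟩]
  rw [h1]
  have h2 : Measurable fun a : (Param N × ℝ) × ℝ => ‖D a.1.1 a.1.2 a.2‖ₑ ^ 2 :=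
    (hDm.comp (by fun_prop : Measurable fun a : (Param N × ℝ) × ℝ =>
      (a.1.1, (a.1.2, a.2)))).enorm.pow_const 2
  exact (h2.lintegral_prod_right' (ν := volume.restrict Λ.cell)).lintegral_prod_right'
    (ν := volume.restrict (Ioo 0 τ))

end Reconstruction

/-! ### Spatial Lipschitz constants -/

section SpatialLipschitz

variable {m : ℕ} {Λ : SpatialDomain} {T : ℝ} {v : ℝ × ℝ → State m}

/-- The Lipschitz constant of `v(t,·)` on the cell. In contrast to an essential supremum of the
derivative, it is a lower semicontinuous function of `t` for every continuous `v`. -/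
noncomputable def spatialLipschitzConstant (Λ : SpatialDomain) (v : ℝ × ℝ → State m) (t : ℝ) :
    ℝ≥0∞ :=
  ⨆ i : {i : ℝ × ℝ // i.1 ∈ Λ.cell ∧ i.2 ∈ Λ.cell},
    ENNReal.ofReal (‖v (t, i.1.1) - v (t, i.1.2)‖ / |i.1.1 - i.1.2|)

lemma measurable_spatialLipschitzConstant (hv : Continuous v) :
    Measurable (spatialLipschitzConstant Λ v) := by
  refine LowerSemicontinuous.measurable (lowerSemicontinuous_iSup fun i => ?_)
  refine Continuous.lowerSemicontinuous (ENNReal.continuous_ofReal.comp ?_)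
  fun_prop

lemma spatialLipschitzConstant_le {t K : ℝ}
    (h : ∀ x ∈ Λ.cell, ∀ x' ∈ Λ.cell, ‖v (t, x) - v (t, x')‖ ≤ K * |x - x'|) (hK : 0 ≤ K) :
    spatialLipschitzConstant Λ v t ≤ ENNReal.ofReal K := by
  refine iSup_le fun i => ENNReal.ofReal_le_ofReal ?_
  exact div_le_of_le_mul₀ (abs_nonneg _) hK (h _ i.2.1 _ i.2.2)

lemma spatialLipschitzConstant_le_of_lipschitzWith {L : ℝ≥0} (hL : LipschitzWith L v) (t : ℝ) :
    spatialLipschitzConstant Λ v t ≤ L := by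
  rw [← ENNReal.ofReal_coe_nnreal]
  refine spatialLipschitzConstant_le (fun x _ x' _ => ?_) L.2
  have := hL.dist_le_mul (t, x) (t, x')
  simpa [Prod.dist_eq, Real.dist_eq, dist_eq_norm] using this

lemma norm_sub_le_spatialLipschitzConstant {t x x' : ℝ} (hx : x ∈ Λ.cell) (hx' : x' ∈ Λ.cell)
    (hfin : spatialLipschitzConstant Λ v t ≠ ⊤) :
    ‖v (t, x) - v (t, x')‖ ≤ (spatialLipschitzConstant Λ v t).toReal * |x - x'| := by
  rcases eq_or_ne x x' with rfl | hne
  · simp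
  have h1 := le_iSup (fun i : {i : ℝ × ℝ // i.1 ∈ Λ.cell ∧ i.2 ∈ Λ.cell} =>
    ENNReal.ofReal (‖v (t, i.1.1) - v (t, i.1.2)‖ / |i.1.1 - i.1.2|)) ⟨(x, x'), hx, hx'⟩
  have h2 := (ENNReal.ofReal_le_iff_le_toReal hfin).1 h1
  exact (div_le_iff₀ (abs_pos.2 (sub_ne_zero.2 hne))).1 h2

lemma norm_fderiv_space_le {t x : ℝ} (hx : Λ.cell ∈ 𝓝 x)
    (hfin : spatialLipschitzConstant Λ v t ≠ ⊤) (hd : DifferentiableAt ℝ v (t, x)) :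
    ‖fderiv ℝ v (t, x) (0, 1)‖ ≤ (spatialLipschitzConstant Λ v t).toReal := by
  refine (deriv_right_eq_fderiv hd).le_of_lip' ENNReal.toReal_nonneg ?_
  filter_upwards [hx] with z hz
  exact norm_sub_le_spatialLipschitzConstant hz (mem_of_mem_nhds hx) hfin

lemma ae_cell_mem_nhds (Λ : SpatialDomain) : ∀ᵐ x ∂(volume.restrict Λ.cell), Λ.cell ∈ 𝓝 x := by
  cases Λ with
  | line => exact Eventually.of_forall fun x => univ_mem
  | periodic =>
    filter_upwards [ae_restrict_mem measurableSet_Icc,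
      ae_restrict_of_ae (compl_mem_ae_iff.2 (measure_singleton (0 : ℝ))),
      ae_restrict_of_ae (compl_mem_ae_iff.2 (measure_singleton (1 : ℝ)))] with x hx h0 h1
    exact Icc_mem_nhds (lt_of_le_of_ne hx.1 (Ne.symm h0)) (lt_of_le_of_ne hx.2 h1)

lemma ae_norm_fderiv_space_le {L : ℝ≥0} (hL : LipschitzWith L v) :
    ∀ᵐ p ∂(spaceTimeMeasure Λ T),
      ‖fderiv ℝ v p (0, 1)‖ ≤ (spatialLipschitzConstant Λ v p.1).toReal := by
  filter_upwards [ae_snd_of_ae_cell (ae_cell_mem_nhds Λ),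
    ae_spaceTimeMeasure_of_ae hL.ae_differentiableAt] with p h1 h2
  exact norm_fderiv_space_le h1
    ((spatialLipschitzConstant_le_of_lipschitzWith hL p.1).trans_lt ENNReal.coe_lt_top).ne h2

/-- A Lipschitz function is the integral of its derivative; this is applied to the component in the
direction of the increment. -/
lemma norm_sub_le_of_ae_norm_deriv_le {g : ℝ → State m} {L : ℝ≥0} (hL : LipschitzWith L g)
    {K a b : ℝ} (hab : a ≤ b) (h : ∀ᵐ x : ℝ, x ∈ Icc a b → ‖deriv g x‖ ≤ K) :
    ‖g b - g a‖ ≤ K * (b - a) := by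
  set e := g b - g a with he
  rcases eq_or_ne e 0 with h0 | h0
  · rw [h0, norm_zero]
    rcases hab.eq_or_lt with rfl | hlt
    · simp
    have : ∃ x, x ∈ Ioo a b ∧ ‖deriv g x‖ ≤ K := by
      obtain ⟨x, hx, hx'⟩ := (Measure.dense_of_ae h).exists_mem_open isOpen_Ioo
        (nonempty_Ioo.2 hlt)
      exact ⟨x, hx', hx (Ioo_subset_Icc_self hx')⟩
    obtain ⟨x, -, hx⟩ := this
    exact mul_nonneg ((norm_nonneg _).trans hx) (by linarith)
  have hφ : LipschitzWith _ fun x => inner ℝ e (g x) := (innerSL ℝ e).lipschitz.comp hL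
  have hac : AbsolutelyContinuousOnInterval (fun x => inner ℝ e (g x)) a b :=
    (hφ.lipschitzOnWith (s := uIcc a b)).absolutelyContinuousOnInterval
  have h1 := hac.integral_deriv_eq_sub
  have h2 : ‖∫ x in a..b, deriv (fun x => inner ℝ e (g x)) x‖ ≤ ‖e‖ * K * |b - a| := by
    refine intervalIntegral.norm_integral_le_of_norm_le_const_ae ?_
    filter_upwards [h, hL.ae_differentiableAt] with x hx hd hxab
    rw [uIoc_of_le hab] at hxab
    have h3 : HasDerivAt (fun x => inner ℝ e (g x)) (innerSL ℝ e (deriv g x)) x :=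
      (innerSL ℝ e).hasFDerivAt.comp_hasDerivAt x hd.hasDerivAt
    rw [h3.deriv]
    exact (norm_inner_le_norm _ _).trans
      (mul_le_mul_of_nonneg_left (hx (Ioc_subset_Icc_self hxab)) (norm_nonneg _))
  rw [h1, ← inner_sub_right, ← he, real_inner_self_eq_norm_sq, abs_of_nonneg (by linarith),
    Real.norm_of_nonneg (by positivity)] at h2
  have h3 := norm_pos_iff.2 h0
  nlinarith

end SpatialLipschitz

section Supremum

variable {m N r : ℕ} {Λ : SpatialDomain} {T : ℝ} {node : Fin N → Fin (r + 1) → ℝ}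
  {st : MultiIndex N r → ℝ → ℝ → State m}

/-- For almost every `y`, the Lipschitz constants of the reconstruction are bounded by the norms
in `L^∞(S; L^∞(Λ))` at all times: the bound defines a closed set of parameters, hence it holds on
the support of the measure, which does not depend on the time. -/
lemma ae_spatialLipschitzConstant_le (hT : 0 < T)
    (hst : ∀ k, IsLipschitzReconstruction Λ T (st k)) (μ : Measure (Param N))
    (S : Set (Param N)) :
    ∀ᵐ y ∂(μ.restrict S), ∀ t ∈ Icc 0 T, spatialLipschitzConstant Λ
        (timeExtension T fun t x => stsReconstruction node st t x y) t
      ≤ supNormSpace μ S Λ fun x y => deriv (fun z => stsReconstruction node st t z y) x := by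
  filter_upwards [Measure.support_mem_ae (μ := μ.restrict S)] with y hy t ht
  choose L hL using fun k => (hst k).exists_lipschitzWith hT
  set K := supNormSpace μ S Λ fun x y => deriv (fun z => stsReconstruction node st t z y) x
    with hK
  rcases eq_or_ne K ⊤ with h | h
  · rw [h]; exact le_top
  rw [← ENNReal.ofReal_toReal h]
  set Z : Set (Param N) := {y | ∀ x ∈ Λ.cell, ∀ x' ∈ Λ.cell,
    ‖stsReconstruction node st t x y - stsReconstruction node st t x' y‖
      ≤ K.toReal * |x - x'|} with hZ
  have hcl : IsClosed Z := by
    have hc : ∀ x, Continuous fun y => stsReconstruction node st t x y := fun x =>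
      continuous_finsetSum _ fun k _ => (continuous_lagrangePoly node k).smul continuous_const
    simp only [hZ, ofPred_forall]
    exact isClosed_biInter fun x _ => isClosed_biInter fun x' _ =>
      isClosed_le ((hc x).sub (hc x')).norm continuous_const
  have hae : Z ∈ ae (μ.restrict S) := by
    filter_upwards [ENNReal.ae_le_essSup (μ := μ.restrict S) fun y => essSup
      (fun x => ‖deriv (fun z => stsReconstruction node st t z y) x‖ₑ)
      (volume.restrict Λ.cell)] with y hy
    obtain ⟨L', hlip⟩ : ∃ L', LipschitzWith L' fun x => stsReconstruction node st t x y := by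
      have h1 := (lipschitzWith_timeExtension_stsReconstruction (node := node) hL y).comp
        ((LipschitzWith.const t).prodMk (LipschitzWith.id (α := ℝ)))
      have h2 : (timeExtension T fun t x => stsReconstruction node st t x y)
          ∘ (fun x => (t, id x)) = fun x => stsReconstruction node st t x y :=
        funext fun x => timeExtension_eq ht x
      rw [h2] at h1
      exact ⟨_, h1⟩
    have h1 : ∀ᵐ x : ℝ, x ∈ Λ.cell →
        ‖deriv (fun z => stsReconstruction node st t z y) x‖ ≤ K.toReal := by
      rw [← ae_restrict_iff' Λ.measurableSet_cell]
      filter_upwards [ENNReal.ae_le_essSup (μ := volume.restrict Λ.cell)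
        fun x => ‖deriv (fun z => stsReconstruction node st t z y) x‖ₑ] with x hx
      rw [← toReal_enorm]
      exact ENNReal.toReal_mono h (hx.trans hy)
    have hoc : Λ.cell.OrdConnected := by
      cases Λ
      · exact ordConnected_univ
      · exact ordConnected_Icc
    have h2 : ∀ x ∈ Λ.cell, ∀ x' ∈ Λ.cell, x ≤ x' →
        ‖stsReconstruction node st t x' y - stsReconstruction node st t x y‖
          ≤ K.toReal * (x' - x) := fun x hx x' hx' hxx =>
      norm_sub_le_of_ae_norm_deriv_le hlip hxx
        (h1.mono fun z hz hz' => hz (hoc.out hx hx' hz'))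
    intro x hx x' hx'
    rcases le_total x x' with hxx | hxx
    · rw [norm_sub_rev, abs_sub_comm, abs_of_nonneg (sub_nonneg.2 hxx)]
      exact h2 x hx x' hx' hxx
    · rw [abs_of_nonneg (sub_nonneg.2 hxx)]
      exact h2 x' hx' x hx hxx
  have hyZ : y ∈ Z := Measure.support_subset_of_isClosed hcl hae hy
  refine spatialLipschitzConstant_le (fun x hx x' hx' => ?_) ENNReal.toReal_nonneg
  rw [timeExtension_eq ht, timeExtension_eq ht]
  exact hyZ x hx x' hx'

/-- Comparison of the exponential factor for one parameter with an extended one. No measurability of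
the upper bound `K` is needed. -/
lemma ofReal_exp_integral_le {ηlow ηup CF τ : ℝ} (hlow : 0 < ηlow) (hup : 0 ≤ ηup) (hCF : 0 ≤ CF)
    (hτ : 0 ≤ τ) {ℓ K : ℝ → ℝ≥0∞} (h : ∀ t ∈ Ioo 0 τ, ℓ t ≤ K t) :
    ENNReal.ofReal (Real.exp (∫ t in 0..τ, ηlow⁻¹ * (ηup * CF * (ℓ t).toReal + ηup ^ 2)))
      ≤ EReal.exp (((ENNReal.ofReal ηlow)⁻¹ * ∫⁻ t in Ioo 0 τ,
        (ENNReal.ofReal (ηup * CF) * K t + ENNReal.ofReal (ηup ^ 2)) : ℝ≥0∞) : EReal) := by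
  rw [← EReal.exp_coe, EReal.exp_le_exp_iff]
  set I := ∫ t in 0..τ, ηlow⁻¹ * (ηup * CF * (ℓ t).toReal + ηup ^ 2) with hI
  have h1 : (I : EReal) ≤ (ENNReal.ofReal I : EReal) := by
    rw [EReal.coe_ennreal_ofReal]
    exact EReal.coe_le_coe_iff.2 (le_max_left _ _)
  refine h1.trans ?_
  rw [EReal.coe_ennreal_le_coe_ennreal_iff, hI,
    intervalIntegral.integral_const_mul, ENNReal.ofReal_mul (inv_nonneg.2 hlow.le),
    ENNReal.ofReal_inv_of_pos hlow, intervalIntegral.integral_of_le hτ,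
    integral_Ioc_eq_integral_Ioo]
  refine mul_le_mul' le_rfl (ofReal_integral_le_lintegral.trans ?_)
  refine setLIntegral_mono' measurableSet_Ioo fun t ht => ?_
  have h2 : 0 ≤ ηup * CF := mul_nonneg hup hCF
  have h3 : 0 ≤ (ℓ t).toReal := ENNReal.toReal_nonneg
  rw [Real.enorm_of_nonneg (by positivity), ENNReal.ofReal_add (by positivity) (by positivity),
    ENNReal.ofReal_mul h2]
  gcongr
  exact ENNReal.ofReal_toReal_le.trans (h t ht)

end Supremum

/-! ### The law of the random parameter -/

section Law

variable {N : ℕ}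

/-- The law of the random parameter is `w(y) dy`, by independence of the components. -/
lemma IsRandomParameter.map_eq_weightedMeasure {Ω : Type*} [MeasurableSpace Ω] {P : Measure Ω}
    [IsProbabilityMeasure P] {ξ : Ω → Param N} {Ξ : Set (Param N)} {w : Fin N → ℝ → ℝ≥0}
    (hξ : IsRandomParameter P ξ Ξ w) : P.map ξ = weightedMeasure w := by
  have hm : ∀ i, Measurable fun a => ξ a i := fun i => (measurable_pi_apply i).comp hξ.measurable
  have h1 : P.map ξ = Measure.pi fun i => P.map fun a => ξ a i :=
    (iIndepFun_iff_map_fun_eq_pi_map fun i => (hm i).aemeasurable).1 hξ.indep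
  have hp : ∀ i, IsProbabilityMeasure (P.map fun a => ξ a i) := fun i =>
    Measure.isProbabilityMeasure_map (hm i).aemeasurable
  rw [h1]
  refine Measure.pi_eq fun s hs => ?_
  have hwm := hξ.measurable_density
  -- the densities restricted to the sides of a box
  set g : Fin N → ℝ → ℝ := fun i => (s i).indicator fun a => (w i a : ℝ) with hg
  have hg0 : ∀ i a, 0 ≤ g i a := fun i a => indicator_nonneg (fun _ _ => NNReal.coe_nonneg _) a
  have hge : ∀ i a, ENNReal.ofReal (g i a) = (s i).indicator (fun a => (w i a : ℝ≥0∞)) a := by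
    intro i a
    by_cases ha : a ∈ s i <;> simp [hg, ha]
  have hgi : ∀ i, Integrable (g i) := fun i => by
    refine ⟨((hwm i).coe_nnreal_real.indicator (hs i)).aestronglyMeasurable, ?_⟩
    rw [hasFiniteIntegral_iff_ofReal (Eventually.of_forall (hg0 i))]
    simp only [hge]
    rw [lintegral_indicator (hs i), ← withDensity_apply _ (hs i), ← hξ.density i]
    exact measure_lt_top _ _
  have h2 : ∀ i, P.map (fun a => ξ a i) (s i) = ENNReal.ofReal (∫ a, g i a) := fun i => by
    rw [ofReal_integral_eq_lintegral_ofReal (hgi i) (Eventually.of_forall (hg0 i))]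
    simp only [hge]
    rw [lintegral_indicator (hs i), ← withDensity_apply _ (hs i), ← hξ.density i]
  have h3 : ∀ y : Param N, (univ.pi s).indicator (fun y => (jointDensity w y : ℝ≥0∞)) y
      = ENNReal.ofReal (∏ i, g i (y i)) := by
    intro y
    rw [ENNReal.ofReal_prod_of_nonneg fun i _ => hg0 i _]
    simp only [hge]
    by_cases hy : y ∈ univ.pi s
    · rw [indicator_of_mem hy, jointDensity, ENNReal.ofNNReal_finsetProd]
      exact Finset.prod_congr rfl fun i _ => (indicator_of_mem (hy i (mem_univ i))
        fun a => (w i a : ℝ≥0∞)).symm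
    · rw [indicator_of_notMem hy]
      obtain ⟨i, hi⟩ : ∃ i, y i ∉ s i := by simpa [mem_univ_pi] using hy
      exact (Finset.prod_eq_zero (Finset.mem_univ i) (indicator_of_notMem hi _)).symm
  simp only [h2]
  rw [weightedMeasure, withDensity_apply _ (MeasurableSet.univ_pi hs),
    ← lintegral_indicator (MeasurableSet.univ_pi hs)]
  simp only [h3]
  have h4 : Integrable (fun y : Param N => ∏ i, g i (y i)) := Integrable.fintype_prod hgi
  rw [← ofReal_integral_eq_lintegral_ofReal h4
    (Eventually.of_forall fun y => Finset.prod_nonneg fun i _ => hg0 i _),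
    integral_fintype_prod_volume_eq_prod, ENNReal.ofReal_prod_of_nonneg]
  exact fun i _ => integral_nonneg (hg0 i)

lemma IsRandomParameter.ae_mem {Ω : Type*} [MeasurableSpace Ω] {P : Measure Ω}
    {ξ : Ω → Param N} {Ξ : Set (Param N)} {w : Fin N → ℝ → ℝ≥0}
    (hξ : IsRandomParameter P ξ Ξ w) : ∀ᵐ y ∂(P.map ξ), y ∈ Ξ :=
  (ae_map_iff hξ.measurable.aemeasurable hξ.measurableSet).2 (Eventually.of_forall hξ.mem)

end Law

/-! ### The solution for a fixed parameter -/

section FixedParameter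

variable {m N : ℕ} {Λ : SpatialDomain} {T : ℝ} {U C : Set (State m)}
  {F : State m → Param N → State m} {η q : State m → Param N → ℝ} {CF ηlow ηup : ℝ}
  {μ : Measure (Param N)} {u₀ : ℝ → Param N → State m} {u : ℝ → ℝ → Param N → State m}

lemma ae_isConvexEntropySystem (hU : IsOpen U) (hF : IsRandomC2 μ U F)
    (hη : IsRandomEntropyPair μ U F η q) (hC : IsCompact C) (hCc : Convex ℝ C) (hCU : C ⊆ U)
    (hb : HasUniformHessianBounds μ C F η CF ηlow ηup) :
    ∀ᵐ y ∂μ, IsConvexEntropySystem U C (fun z => F z y) (fun z => η z y) (fun z => q z y)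
      CF ηlow ηup := by
  filter_upwards [hF.contDiffOn, hη.entropy.contDiffOn, hη.entropyFlux.contDiffOn, hη.compatible,
    hb.flux, hb.entropy] with y h1 h2 h3 h4 h5 h6
  exact ⟨hU, hC, hCc, hCU, h1, h2, h3, h4, hb.flux_nonneg, hb.low_pos, hb.low_le_up, h5,
    fun z hz v => (h6 z hz v).1, fun z hz v => (h6 z hz v).2⟩

lemma ae_ae_of_ae_prod_right {α β : Type*} [MeasurableSpace α] [MeasurableSpace β]
    {ν : Measure α} {ρ : Measure β} [SFinite ν] [SFinite ρ] {Q : α × β → Prop}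
    (h : ∀ᵐ p ∂(ν.prod ρ), Q p) : ∀ᵐ y ∂ρ, ∀ᵐ x ∂ν, Q (x, y) :=
  Measure.ae_ae_of_ae_prod
    ((Measure.measurePreserving_swap (μ := ρ) (ν := ν)).quasiMeasurePreserving.ae h)

lemma ae_isEntropySolutionIn [SFinite μ]
    (hu₀ : Integrable (fun p : ℝ × Param N => u₀ p.1 p.2) ((volume.restrict Λ.cell).prod μ))
    (hu : IsRandomEntropySolution Λ T μ U F η q u₀ u)
    (hu₀C : ∀ᵐ p ∂((volume.restrict Λ.cell).prod μ), u₀ p.1 p.2 ∈ C)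
    (huC : ∀ᵐ p ∂(spaceTimeParamMeasure Λ T μ), u p.1.1 p.1.2 p.2 ∈ C) :
    ∀ᵐ y ∂μ, IsEntropySolutionIn Λ T C (fun z => F z y) (fun z => η z y) (fun z => q z y)
      (fun x => u₀ x y) (fun t x => u t x y) := by
  filter_upwards [hu.integrable.aestronglyMeasurable.prod_swap.prodMk_left,
    hu₀.aestronglyMeasurable.prod_swap.prodMk_left, ae_ae_of_ae_prod_right hu₀C,
    ae_ae_of_ae_prod_right huC, hu.weak, hu.entropy] with y h1 h2 h3 h4 h5 h6
  exact ⟨h1, h4, h2, h3, h5, h6⟩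

variable {r : ℕ} {node : Fin N → Fin (r + 1) → ℝ} {st : MultiIndex N r → ℝ → ℝ → State m}

lemma lintegral_enorm_sq_le_of_ae_eq_add {α V : Type*} [MeasurableSpace α] {ν : Measure α}
    [NormedAddCommGroup V] {f a b : α → V} (h : ∀ᵐ x ∂ν, f x = a x + b x)
    (ha : AEMeasurable (fun x => ‖a x‖ₑ ^ 2) ν) :
    ∫⁻ x, ‖f x‖ₑ ^ 2 ∂ν ≤ 2 * (∫⁻ x, ‖a x‖ₑ ^ 2 ∂ν) + 2 * ∫⁻ x, ‖b x‖ₑ ^ 2 ∂ν := by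
  rw [← lintegral_const_mul' 2 _ ENNReal.ofNat_ne_top,
    ← lintegral_const_mul' 2 _ ENNReal.ofNat_ne_top, ← lintegral_add_left' (ha.const_mul 2)]
  refine lintegral_mono_ae (h.mono fun x hx => ?_)
  rw [hx]
  exact enorm_add_sq_le _ _

lemma lintegral_fieldResidual_le (hT : 0 < T) (hst : ∀ k, IsLipschitzReconstruction Λ T (st k))
    (hFnode : ∀ k, ContinuousOn (fun z => F z (collocationPoint node k)) C)
    (hstC : ∀ k, ∀ p, timeExtension T (st k) p ∈ C) (hU : IsOpen U) {y : Param N}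
    (hF : ContDiffOn ℝ 2 (fun z => F z y) U)
    (hU' : ∀ t ∈ Icc 0 T, ∀ x ∈ Λ.cell, stsReconstruction node st t x y ∈ U) {τ : ℝ} (hτ : τ ≤ T) :
    ∫⁻ t in Ioo 0 τ, ∫⁻ x in Λ.cell, ‖fieldResidual (fun z => F z y)
        (timeExtension T fun t x => stsReconstruction node st t x y) (t, x)‖ₑ ^ 2
      ≤ 2 * (∫⁻ t in Ioo 0 τ, ∫⁻ x in Λ.cell, ‖detResidual F node st t x y‖ₑ ^ 2)
        + 2 * ∫⁻ t in Ioo 0 τ, ∫⁻ x in Λ.cell, ‖stochResidual F node st t x y‖ₑ ^ 2 := by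
  obtain ⟨D, hDm, hD⟩ := exists_measurable_eq_detResidual (F := F) (node := node) hT hst hFnode hstC
  have h1 : ∫⁻ t in Ioo 0 τ, ∫⁻ x in Λ.cell, ‖detResidual F node st t x y‖ₑ ^ 2
      = ∫⁻ t in Ioo 0 τ, ∫⁻ x in Λ.cell, ‖D y t x‖ₑ ^ 2 := by
    refine setLIntegral_congr_fun measurableSet_Ioo fun t ht => ?_
    simp only [hD y t ⟨ht.1, ht.2.trans_le hτ⟩]
  have h2 : Measurable fun a : ℝ × ℝ => ‖D y a.1 a.2‖ₑ ^ 2 :=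
    (hDm.comp measurable_prodMk_left).enorm.pow_const 2
  have h3 : Measurable fun t => ∫⁻ x in Λ.cell, ‖D y t x‖ₑ ^ 2 := h2.lintegral_prod_right'
  have h4 := ae_ae_of_ae_spaceTimeMeasure
    (ae_fieldResidual_eq_add (F := F) (node := node) (y := y) hT hst hU hF hU')
  rw [h1, ← lintegral_const_mul' 2 _ ENNReal.ofNat_ne_top,
    ← lintegral_const_mul' 2 _ ENNReal.ofNat_ne_top, ← lintegral_add_left (h3.const_mul 2)]
  refine lintegral_mono_ae ?_
  filter_upwards [ae_restrict_of_ae h4, ae_restrict_mem measurableSet_Ioo] with t ht htτ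
  have htT : t ∈ Ioo 0 T := ⟨htτ.1, htτ.2.trans_le hτ⟩
  refine lintegral_enorm_sq_le_of_ae_eq_add (a := D y t) ?_
    (h2.comp measurable_prodMk_left).aemeasurable
  filter_upwards [ht htT] with x hx
  rw [hD y t htT x]
  exact hx

/-- The stability estimate between the solution and the space-time-stochastic reconstruction for
one value of the parameter. -/
lemma stability_of_parameter (hT : 0 < T) (hst : ∀ k, IsLipschitzReconstruction Λ T (st k))
    (hFnode : ∀ k, ContinuousOn (fun z => F z (collocationPoint node k)) C)
    (hstC : ∀ k, ∀ p, timeExtension T (st k) p ∈ C) {y : Param N}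
    (h : IsConvexEntropySystem U C (fun z => F z y) (fun z => η z y) (fun z => q z y) CF ηlow ηup)
    (hu : IsEntropySolutionIn Λ T C (fun z => F z y) (fun z => η z y) (fun z => q z y)
      (fun x => u₀ x y) (fun t x => u t x y))
    (hloc : ∀ t ∈ Icc 0 T, LocallyIntegrableOn (fun x => u t x y) Λ.cell)
    (hcont : ∀ ψ : ℝ → State m, IsSpaceTest Λ ψ →
      ContinuousOn (fun t => ∫ x in Λ.cell, inner ℝ (u t x y) (ψ x)) (Icc 0 T))
    (hC : ∀ t ∈ Icc 0 T, ∀ x ∈ Λ.cell, stsReconstruction node st t x y ∈ C)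
    {τ : ℝ} (hτ : τ ∈ Icc 0 T) :
    ∫⁻ x in Λ.cell, ‖u τ x y - stsReconstruction node st τ x y‖ₑ ^ 2 ≤ (ENNReal.ofReal ηlow)⁻¹
      * (ENNReal.ofReal ηup
          * (∫⁻ x in Λ.cell, ‖u₀ x y - stsReconstruction node st 0 x y‖ₑ ^ 2)
        + (2 * (∫⁻ t in Ioo 0 τ, ∫⁻ x in Λ.cell, ‖detResidual F node st t x y‖ₑ ^ 2)
          + 2 * ∫⁻ t in Ioo 0 τ, ∫⁻ x in Λ.cell, ‖stochResidual F node st t x y‖ₑ ^ 2))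
      * ENNReal.ofReal (Real.exp (∫ t in 0..τ, ηlow⁻¹ * (ηup * CF
        * (spatialLipschitzConstant Λ
          (timeExtension T fun t x => stsReconstruction node st t x y) t).toReal + ηup ^ 2))) := by
  have hv := isLipschitzField_stsReconstruction hT hst hC
  obtain ⟨L, hL⟩ := hv.lipschitz
  have hle := fun t => spatialLipschitzConstant_le_of_lipschitzWith (Λ := Λ) hL t
  have hs := hu.stability h hv hT hloc hcont
    (measurable_spatialLipschitzConstant (Λ := Λ) hL.continuous).ennreal_toReal
    (fun t => ENNReal.toReal_nonneg) (B := L)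
    (fun t => ENNReal.toReal_le_coe_of_le_coe (hle t)) (ae_norm_fderiv_space_le hL) hτ
  simp only [timeExtension_eq hτ, timeExtension_eq (left_mem_Icc.2 hT.le)] at hs
  refine hs.trans ?_
  gcongr
  exact lintegral_fieldResidual_le hT hst hFnode hstC h.isOpen h.flux
    (fun t ht x hx => h.subset (hC t ht x hx)) hτ.2

end FixedParameter

/-! ### Integration over the parameter -/

section Integration

/-- The function `A` need not be measurable, so it need not vanish almost everywhere. -/
lemma lintegral_mul_eq_zero_of_lintegral_eq_zero {α : Type*} [MeasurableSpace α] {μ : Measure α}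
    {A φ : α → ℝ≥0∞} (hφ : Measurable φ) (hφ' : ∀ y, φ y ≠ ⊤) (hA : ∫⁻ y, A y ∂μ = 0) :
    ∫⁻ y, A y * φ y ∂μ = 0 := by
  -- the integral of `A φ` is attained by a measurable minorant `g`, and `g / φ ≤ A`
  obtain ⟨g, hgm, hgle, hg⟩ := exists_measurable_le_lintegral_eq μ fun y => A y * φ y
  have h1 : ∫⁻ y, g y * (φ y)⁻¹ ∂μ = 0 := by
    refine le_antisymm ((lintegral_mono fun y => ?_).trans hA.le) zero_le
    refine (mul_le_mul_left (hgle y) _).trans ?_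
    rw [mul_assoc]
    exact mul_le_of_le_one_right' (ENNReal.mul_inv_le_one _)
  rw [lintegral_eq_zero_iff (show Measurable fun y => g y * (φ y)⁻¹ from hgm.mul hφ.inv)] at h1
  rw [hg, lintegral_eq_zero_iff hgm]
  filter_upwards [h1] with y hy
  exact (mul_eq_zero.1 hy).resolve_right (ENNReal.inv_ne_zero.2 (hφ' y))

/-- Integration of a bound by `A · g`, where `A` need not be measurable and `g` is bounded by a
constant `X ∈ [0,∞]` and by a finite measurable function. The latter takes care of `X = ∞`, when
`A` may vanish. -/
lemma lintegral_le_lintegral_mul {α : Type*} [MeasurableSpace α] {μ : Measure α}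
    {a A g φ : α → ℝ≥0∞} {X : ℝ≥0∞} (hφ : Measurable φ) (hφ' : ∀ y, φ y ≠ ⊤)
    (h : ∀ᵐ y ∂μ, a y ≤ A y * g y) (hgX : ∀ᵐ y ∂μ, g y ≤ X) (hgφ : ∀ᵐ y ∂μ, g y ≤ φ y) :
    ∫⁻ y, a y ∂μ ≤ (∫⁻ y, A y ∂μ) * X := by
  rcases eq_or_ne X ⊤ with rfl | hX
  · rcases eq_or_ne (∫⁻ y, A y ∂μ) 0 with h0 | h0
    · rw [h0, zero_mul, ← lintegral_mul_eq_zero_of_lintegral_eq_zero hφ hφ' h0]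
      refine lintegral_mono_ae ?_
      filter_upwards [h, hgφ] with y h1 h2
      exact h1.trans (mul_le_mul' le_rfl h2)
    · rw [ENNReal.mul_top h0]; exact le_top
  · rw [← lintegral_mul_const' _ _ hX]
    refine lintegral_mono_ae ?_
    filter_upwards [h, hgX] with y h1 h2
    exact h1.trans (mul_le_mul' le_rfl h2)

end Integration

section Estimate

variable {m N r M : ℕ} {Λ : SpatialDomain} {T : ℝ} {U C : Set (State m)}
  {F : State m → Param N → State m} {η q : State m → Param N → ℝ} {CF ηlow ηup : ℝ}
  {μ : Measure (Param N)} {u₀ : ℝ → Param N → State m} {u : ℝ → ℝ → Param N → State m}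
  {node : Fin N → Fin (r + 1) → ℝ} {st : MultiIndex N r → ℝ → ℝ → State m}

lemma measurable_stsReconstruction_space (hT : 0 < T)
    (hst : ∀ k, IsLipschitzReconstruction Λ T (st k)) {τ : ℝ} (hτ : τ ∈ Icc 0 T) :
    Measurable fun a : Param N × ℝ => stsReconstruction node st τ a.2 a.1 := by
  choose L hL using fun k => (hst k).exists_lipschitzWith hT
  have h1 : (fun a : Param N × ℝ => stsReconstruction node st τ a.2 a.1)
      = fun a : Param N × ℝ => ∑ k, lagrangePoly node k a.1 • timeExtension T (st k) (τ, a.2) := by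
    ext1 a
    simp only [timeExtension_eq hτ]
    rfl
  rw [h1]
  refine Finset.measurable_sum _ fun k _ => ?_
  exact ((continuous_lagrangePoly node k).measurable.comp measurable_fst).smul
    ((hL k).continuous.measurable.comp (measurable_const.prodMk measurable_snd))

lemma measurable_interpolant_space [SFinite μ] {v : MultiIndex N r → ℝ → State m}
    (hv : ∀ k, AEStronglyMeasurable (v k) (volume.restrict Λ.cell)) :
    AEStronglyMeasurable (fun a : Param N × ℝ => interpolant node v a.2 a.1)
      (μ.prod (volume.restrict Λ.cell)) := by
  refine Finset.aestronglyMeasurable_fun_sum _ fun k _ => ?_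
  exact ((continuous_lagrangePoly node k).comp continuous_fst).aestronglyMeasurable.smul
    (hv k).comp_snd

/-- A bound of the exponential factors which is finite and measurable in the parameter; in general
it is not bounded. -/
lemma exists_measurable_bound_exp (hT : 0 < T) (hst : ∀ k, IsLipschitzReconstruction Λ T (st k))
    (hlow : 0 < ηlow) (hup : 0 ≤ ηup) (hCF : 0 ≤ CF) {τ : ℝ} (hτ : 0 ≤ τ) :
    ∃ φ : Param N → ℝ≥0∞, Measurable φ ∧ (∀ y, φ y ≠ ⊤) ∧ ∀ y,
      ENNReal.ofReal (Real.exp (∫ t in 0..τ, ηlow⁻¹ * (ηup * CF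
        * (spatialLipschitzConstant Λ
          (timeExtension T fun t x => stsReconstruction node st t x y) t).toReal + ηup ^ 2)))
        ≤ φ y := by
  choose L hL using fun k => (hst k).exists_lipschitzWith hT
  set K : Param N → ℝ≥0 := fun y => ∑ k, ‖lagrangePoly node k y‖₊ * L k with hK
  have hKm : Measurable K := by
    refine Finset.measurable_sum _ fun k _ => ?_
    exact (continuous_lagrangePoly node k).measurable.nnnorm.mul_const _
  refine ⟨fun y => EReal.exp (((ENNReal.ofReal ηlow)⁻¹ * ∫⁻ _ in Ioo 0 τ,
    (ENNReal.ofReal (ηup * CF) * (K y : ℝ≥0∞) + ENNReal.ofReal (ηup ^ 2)) : ℝ≥0∞) : EReal),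
    ?_, fun y => ?_, fun y => ?_⟩
  · simp only [setLIntegral_const]
    refine EReal.measurable_exp.comp (measurable_coe_ennreal_ereal.comp ?_)
    exact (((hKm.coe_nnreal_ennreal.const_mul _).add_const _).mul_const _).const_mul _
  · rw [Ne, EReal.exp_eq_top_iff, EReal.coe_ennreal_eq_top_iff, setLIntegral_const]
    refine ENNReal.mul_ne_top (ENNReal.inv_ne_top.2 (by simpa using hlow))
      (ENNReal.mul_ne_top (ENNReal.add_ne_top.2
        ⟨ENNReal.mul_ne_top ENNReal.ofReal_ne_top ENNReal.coe_ne_top, ENNReal.ofReal_ne_top⟩) ?_)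
    simp
  · exact ofReal_exp_integral_le hlow hup hCF hτ fun t _ =>
      spatialLipschitzConstant_le_of_lipschitzWith
        (lipschitzWith_timeExtension_stsReconstruction hL y) t

/-- The stability estimate between the solution and the space-time-stochastic reconstruction. -/
lemma sqNormSpace_sub_stsReconstruction_le [SFinite μ] (hT : 0 < T) (hU : IsOpen U)
    (hF : IsRandomC2 μ U F) (hη : IsRandomEntropyPair μ U F η q)
    (hu₀ : Integrable (fun p : ℝ × Param N => u₀ p.1 p.2) ((volume.restrict Λ.cell).prod μ))
    (hu : IsRandomEntropySolution Λ T μ U F η q u₀ u) (hu_time : IsWeaklyContinuousInTime Λ T μ u)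
    (hC : IsCompact C) (hCc : Convex ℝ C) (hCU : C ⊆ U)
    (hu₀C : ∀ᵐ p ∂((volume.restrict Λ.cell).prod μ), u₀ p.1 p.2 ∈ C)
    (huC : ∀ᵐ p ∂(spaceTimeParamMeasure Λ T μ), u p.1.1 p.1.2 p.2 ∈ C)
    (hb : HasUniformHessianBounds μ C F η CF ηlow ηup)
    (hst : ∀ k, IsLipschitzReconstruction Λ T (st k))
    (hFnode : ∀ k, ContinuousOn (fun z => F z (collocationPoint node k)) C)
    (hstC : ∀ k, ∀ p, timeExtension T (st k) p ∈ C)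
    (hstsC : ∀ᵐ y ∂μ, ∀ t ∈ Icc 0 T, ∀ x ∈ Λ.cell, stsReconstruction node st t x y ∈ C)
    (S : Set (Param N)) {τ : ℝ} (hτ : τ ∈ Icc 0 T) :
    sqNormSpace μ S Λ (fun x y => u τ x y - stsReconstruction node st τ x y)
      ≤ (ENNReal.ofReal ηlow)⁻¹
        * (ENNReal.ofReal ηup * sqNormSpace μ S Λ
            (fun x y => u₀ x y - stsReconstruction node st 0 x y)
          + (2 * sqNormSpaceTime μ S Λ τ (detResidual F node st)
            + 2 * sqNormSpaceTime μ S Λ τ (stochResidual F node st)))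
        * EReal.exp (growthExponent μ S Λ CF ηlow ηup τ (stsReconstruction node st) : EReal) := by
  have hlow := hb.low_pos
  have hup := hlow.le.trans hb.low_le_up
  obtain ⟨φ, hφm, hφt, hφ⟩ := exists_measurable_bound_exp (Λ := Λ) (node := node) hT hst hlow hup
    hb.flux_nonneg hτ.1
  have hstab := ae_restrict_of_ae (s := S) (by
    filter_upwards [ae_isConvexEntropySystem hU hF hη hC hCc hCU hb,
      ae_isEntropySolutionIn hu₀ hu hu₀C huC, hu_time, hstsC] with y h1 h2 h3 h4
    exact stability_of_parameter hT hst hFnode hstC h1 h2 h3.1 h3.2 h4 hτ)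
  have hX := (ae_spatialLipschitzConstant_le (node := node) hT hst μ S).mono fun y hy =>
    ofReal_exp_integral_le hlow hup hb.flux_nonneg hτ.1
      fun t ht => hy t ⟨ht.1.le, ht.2.le.trans hτ.2⟩
  refine (lintegral_le_lintegral_mul hφm hφt hstab hX (Eventually.of_forall hφ)).trans ?_
  have hbm : AEMeasurable
      (fun y => ∫⁻ x in Λ.cell, ‖u₀ x y - stsReconstruction node st 0 x y‖ₑ ^ 2) μ := by
    refine AEMeasurable.lintegral_prod_right' (ν := volume.restrict Λ.cell)
      (f := fun a : Param N × ℝ => ‖u₀ a.2 a.1 - stsReconstruction node st 0 a.2 a.1‖ₑ ^ 2) ?_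
    exact (hu₀.aestronglyMeasurable.prod_swap.sub (measurable_stsReconstruction_space hT hst
      (left_mem_Icc.2 hT.le)).aestronglyMeasurable).enorm.pow_const 2
  have hdm := measurable_lintegral_detResidual (Λ := Λ) (node := node) hT hst hFnode hstC hτ.2
  rw [lintegral_const_mul' _ _ (ENNReal.inv_ne_top.2 (by simpa using hlow)),
    lintegral_add_left' (hbm.restrict.const_mul _), lintegral_add_left (hdm.const_mul 2),
    lintegral_const_mul' _ _ ENNReal.ofReal_ne_top, lintegral_const_mul' 2 _ ENNReal.ofNat_ne_top,
    lintegral_const_mul' 2 _ ENNReal.ofNat_ne_top]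
  exact le_rfl

lemma sqNormSpace_sub_le [SFinite μ] {f g h : ℝ → Param N → State m}
    (hgh : AEStronglyMeasurable (fun a : Param N × ℝ => g a.2 a.1 - h a.2 a.1)
      (μ.prod (volume.restrict Λ.cell))) (S : Set (Param N)) :
    sqNormSpace μ S Λ (fun x y => f x y - h x y)
      ≤ 2 * sqNormSpace μ S Λ (fun x y => g x y - h x y)
        + 2 * sqNormSpace μ S Λ (fun x y => f x y - g x y) := by
  have hm : AEMeasurable (fun y => ∫⁻ x in Λ.cell, ‖g x y - h x y‖ₑ ^ 2) μ :=
    AEMeasurable.lintegral_prod_right' (ν := volume.restrict Λ.cell)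
      (f := fun a : Param N × ℝ => ‖g a.2 a.1 - h a.2 a.1‖ₑ ^ 2) (hgh.enorm.pow_const 2)
  simp only [sqNormSpace]
  rw [← lintegral_const_mul' 2 _ ENNReal.ofNat_ne_top,
    ← lintegral_const_mul' 2 _ ENNReal.ofNat_ne_top,
    ← lintegral_add_left' (hm.restrict.const_mul 2)]
  refine lintegral_mono_ae (ae_restrict_of_ae ?_)
  filter_upwards [hgh.prodMk_left] with y hy
  exact lintegral_enorm_sq_le_of_ae_eq_add
    (Eventually.of_forall fun x => (sub_add_sub_cancel' _ _ _).symm) (hy.enorm.pow_const 2)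

end Estimate

end RandomConservationLaw

open RandomConservationLaw in
theorem mainTheorem4
    -- the random parameter, with values in `Ξ ⊆ ℝ^N`
    {Ω : Type*} [MeasurableSpace Ω] (P : Measure Ω) [IsProbabilityMeasure P]
    {N : ℕ} (ξ : Ω → Param N) (Ξ : Set (Param N)) (w : Fin N → ℝ → ℝ≥0)
    (hξ : IsRandomParameter P ξ Ξ w)
    -- the random conservation law and its entropy pair
    {m : ℕ} (Λ : SpatialDomain) (T : ℝ) (hT : 0 < T)
    (U : Set (State m)) (hU : IsOpen U)
    (F : State m → Param N → State m) (hF : IsRandomC2 (P.map ξ) U F)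
    (η q : State m → Param N → ℝ) (hη : IsRandomEntropyPair (P.map ξ) U F η q)
    (u₀ : ℝ → Param N → State m)
    (hu₀ : Integrable (fun p : ℝ × Param N => u₀ p.1 p.2)
      ((volume.restrict Λ.cell).prod (P.map ξ)))
    (u : ℝ → ℝ → Param N → State m)
    (hu : IsRandomEntropySolution Λ T (P.map ξ) U F η q u₀ u)
    (hu_time : IsWeaklyContinuousInTime Λ T (P.map ξ) u)
    -- the compact convex set of states
    (C : Set (State m)) (hC : IsCompact C) (hC_convex : Convex ℝ C) (hCU : C ⊆ U)
    (hu₀C : ∀ᵐ p ∂((volume.restrict Λ.cell).prod (P.map ξ)), u₀ p.1 p.2 ∈ C)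
    (huC : ∀ᵐ p ∂(spaceTimeParamMeasure Λ T (P.map ξ)), u p.1.1 p.1.2 p.2 ∈ C)
    (CF ηlow ηup : ℝ) (hbounds : HasUniformHessianBounds (P.map ξ) C F η CF ηlow ηup)
    -- collocation points
    {r : ℕ} (node : Fin N → Fin (r + 1) → ℝ) (hnode : ∀ i, Function.Injective (node i))
    (hnodeΞ : ∀ k : MultiIndex N r, collocationPoint node k ∈ Ξ)
    (hFnode : ∀ k : MultiIndex N r, ContDiffOn ℝ 2 (fun z => F z (collocationPoint node k)) U)
    -- time steps, the discrete solutions and their space-time reconstructions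
    {M : ℕ} (tn : Fin (M + 1) → ℝ) (htn : StrictMono tn) (htn_zero : tn 0 = 0)
    (htn_last : tn (Fin.last M) = T)
    (uh : Fin (M + 1) → MultiIndex N r → ℝ → State m)
    (huh : ∀ n k, AEStronglyMeasurable (uh n k) (volume.restrict Λ.cell))
    (st : MultiIndex N r → ℝ → ℝ → State m)
    (hst : ∀ k, IsLipschitzReconstruction Λ T (st k))
    (hstC : ∀ t ∈ Icc 0 T, ∀ x ∈ Λ.cell, ∀ y ∈ Ξ, stsReconstruction node st t x y ∈ C)
    -- the time level and the set of parameters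
    (n : Fin (M + 1)) (S : Set (Param N)) (hS : NullMeasurableSet S (P.map ξ)) (hSΞ : S ⊆ Ξ) :
    sqNormSpace (weightedMeasure w) S Λ (fun x y => u (tn n) x y - interpolant node (uh n) x y)
      ≤ 2 * sqNormSpace (weightedMeasure w) S Λ
            (fun x y => stsReconstruction node st (tn n) x y - interpolant node (uh n) x y)
        + 2 * (ENNReal.ofReal ηlow)⁻¹
          * (2 * sqNormSpaceTime (weightedMeasure w) S Λ (tn n) (detResidual F node st)
            + 2 * sqNormSpaceTime (weightedMeasure w) S Λ (tn n) (stochResidual F node st)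
            + ENNReal.ofReal ηup * sqNormSpace (weightedMeasure w) S Λ
                (fun x y => u₀ x y - stsReconstruction node st 0 x y))
          * EReal.exp (growthExponent (weightedMeasure w) S Λ CF ηlow ηup (tn n)
              (stsReconstruction node st) : EReal) := by
  have : IsProbabilityMeasure (P.map ξ) :=
    Measure.isProbabilityMeasure_map hξ.measurable.aemeasurable
  rw [← hξ.map_eq_weightedMeasure]
  have hτ : tn n ∈ Icc 0 T :=
    ⟨htn_zero ▸ htn.monotone (Fin.zero_le n), htn_last ▸ htn.monotone (Fin.le_last n)⟩
  have hstC' : ∀ k, ∀ p, timeExtension T (st k) p ∈ C := by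
    intro k p
    have h1 := (isLipschitzField_stsReconstruction hT hst fun t ht x hx =>
      hstC t ht x hx _ (hnodeΞ k)).mem p
    rwa [timeExtension, stsReconstruction_collocationPoint hnode] at h1
  have h1 := sqNormSpace_sub_stsReconstruction_le hT hU hF hη hu₀ hu hu_time hC hC_convex hCU hu₀C
    huC hbounds hst (fun k => ((hFnode k).continuousOn).mono hCU) hstC'
    (hξ.ae_mem.mono fun y hy t ht x hx => hstC t ht x hx y hy) S hτ
  have h2 := sqNormSpace_sub_le (μ := P.map ξ) (Λ := Λ) (f := u (tn n))
    (g := stsReconstruction node st (tn n)) (h := interpolant node (uh n))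
    ((measurable_stsReconstruction_space hT hst hτ).aestronglyMeasurable.sub
      (measurable_interpolant_space (huh n))) S
  refine h2.trans (add_le_add le_rfl ((mul_le_mul_right h1 2).trans (le_of_eq ?_)))
  ring
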